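/- Graphs are finite multigraphs (loops and multiple edges are allowed), and all maps are piecewise linear. A *spatial embedding* of a graph $G$ is an embedding of $G$ into the $3$-sphere $S^3$. A *cycle* of $G$ is a subgraph of $G$ homeomorphic to the circle; two cycles are *disjoint* if they have no common vertex. A knot in $S^3$ is *trivial* if some homeomorphism of $S^3$ carries it onto a great circle, and a $2$-component link is *splittable* if there is a $2$-sphere in $S^3$ that is disjoint from the link and separates its two components. A graph $G$ is called *intrinsically knotted or completely $3$-linked* (I(K or C3L)) if for every spatial embedding $f$ of $G$, either there is a cycle $\gamma$ of $G$ such that $f(\gamma)$ is a nontrivial knot, or there are three pairwise disjoint cycles $\gamma_1,\gamma_2,\gamma_3$ of $G$ such that each of the three $2$-component links $f(\gamma_i)\cup f(\gamma_j)$, $i<j$, is nonsplittable. Let $G_\triangle$ be a graph containing a cycle with exactly three edges $\overline{uv},\overline{vw},\overline{wu}$ ($u,v,w$ distinct vertices). Let $G_Y$ be obtained from $G_\triangle$ by a single $\triangle Y$-exchange, that is, by removing these three edges and adding a new vertex $x$ together with three new edges $\overline{xu},\overline{xv},\overline{xw}$. **Lemma.** If $G_\triangle$ is I(K or C3L), then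 $G_Y$ is also I(K or C3L). -/

import Mathlib

namespace SpatialGraph

/-! ### The piecewise linear 3-sphere

The 3-sphere is the unit sphere of `ℝ⁴`, that is, the space of rays from the origin of `ℝ⁴`, with
its usual piecewise linear structure: the simplices are the intersections of the sphere with the
simplicial cones of `ℝ⁴`. (Radial projection onto the boundary of a convex 4-polytope around the
origin carries the straight segments of that boundary to great circle arcs and identifies the
polyhedra of the two models.) -/

/-- Euclidean 4-space. -/
abbrev R4 : Type := EuclideanSpace ℝ (Fin 4)

/-- The 3-sphere. -/
abbrev S3 : Type := Metric.sphere (0 : R4) 1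

/-- `H : ℝ⁴ → ℝ⁴` agrees at every point with one of finitely many linear maps. A continuous map
with this property is linear on each cone of some finite polyhedral fan. -/
def IsPiecewiseLinear (H : R4 → R4) : Prop :=
  ∃ F : Set (R4 →ₗ[ℝ] R4), F.Finite ∧ ∀ x, ∃ A ∈ F, H x = A x

/-- A homeomorphism `h` of the 3-sphere is piecewise linear if it is induced, on rays from the
origin, by a homeomorphism `H` of `ℝ⁴` that is positively homogeneous and piecewise linear in both
directions: `h` carries the simplices of a geodesic triangulation of the sphere to those of
another one, linearly in homogeneous coordinates. -/
def IsPLHomeo (h : S3 ≃ₜ S3) : Prop :=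
  ∃ H : R4 ≃ₜ R4,
    (∀ (r : ℝ) (x : R4), 0 ≤ r → H (r • x) = r • H x) ∧
    IsPiecewiseLinear H ∧ IsPiecewiseLinear H.symm ∧
    ∀ x : S3, ∃ r : ℝ, 0 < r ∧ H (x : R4) = r • (h x : R4)

/-- `c` restricted to `[0, 1]` is a piecewise linear (polygonal) path in the 3-sphere: for some
subdivision `0 = t 0 < ⋯ < t n = 1` it is, on each interval of the subdivision, the radial
projection to the sphere of an affine map that avoids the origin. -/
def IsPLPath (c : ℝ → S3) : Prop :=
  ∃ (n : ℕ) (t : ℕ → ℝ), t 0 = 0 ∧ t n = 1 ∧ (∀ i < n, t i < t (i + 1)) ∧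
    ∀ i < n, ∃ a b : R4, ∀ s ∈ Set.Icc (t i) (t (i + 1)),
      ∃ r : ℝ, 0 < r ∧ a + s • b = r • (c s : R4)

/-! ### Knots and links -/

/-- A great circle of the 3-sphere. -/
def greatCircle : Set S3 := {x | (x : R4) 2 = 0 ∧ (x : R4) 3 = 0}

/-- The knot `K` is trivial: a piecewise linear homeomorphism of the 3-sphere carries it to a
great circle. -/
def IsTrivialKnot (K : Set S3) : Prop :=
  ∃ h : S3 ≃ₜ S3, IsPLHomeo h ∧ h '' K = greatCircle

/-- The 2-component link `K ∪ L` is splittable: some piecewise linear 2-sphere (the preimage of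
the equator `x₃ = 0` under a piecewise linear homeomorphism of the 3-sphere) is disjoint from the
link and separates its two components. -/
def IsSplittable (K L : Set S3) : Prop :=
  ∃ h : S3 ≃ₜ S3, IsPLHomeo h ∧
    (∀ x ∈ K, 0 < (h x : R4) 3) ∧ (∀ x ∈ L, (h x : R4) 3 < 0)

/-! ### Graphs, their cycles and their spatial embeddings

Graphs are multigraphs: loops and multiple edges are allowed. -/

variable {α : Type*} {β : Type*}

/-- A cycle of `G`, that is, a subgraph homeomorphic to the circle, traversed once:
`vert 0, edge 0, vert 1, edge 1, …, vert m, edge m, vert 0`, where indices are taken modulo the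
length `m + 1`. A loop is a cycle of length 1, a pair of parallel edges a cycle of length 2. -/
structure Cycle (G : Graph α β) where
  m : ℕ
  vert : Fin (m + 1) → α
  edge : Fin (m + 1) → β
  vert_injective : Function.Injective vert
  edge_injective : Function.Injective edge
  isLink : ∀ i, G.IsLink (edge i) (vert i) (vert (i + 1))

/-- Two cycles are disjoint: they have no common vertex (hence no common edge). -/
def Cycle.IsDisjoint {G : Graph α β} (γ δ : Cycle G) : Prop :=
  Disjoint (Set.range γ.vert) (Set.range δ.vert)

/-- A spatial embedding of `G`: a piecewise linear injective map from (the geometric realization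
of) `G` to the 3-sphere, given by the images of the vertices and by a parametrization over `[0, 1]`
of the image of each edge. -/
structure SpatialEmbedding (G : Graph α β) where
  vert : α → S3
  edge : β → ℝ → S3
  isPLPath : ∀ e ∈ G.edgeSet, IsPLPath (edge e)
  ends : ∀ e u v, G.IsLink e u v →
    (edge e 0 = vert u ∧ edge e 1 = vert v) ∨ (edge e 0 = vert v ∧ edge e 1 = vert u)
  vert_injOn : Set.InjOn vert G.vertexSet
  edge_ne_vert : ∀ e ∈ G.edgeSet, ∀ s ∈ Set.Ioo (0 : ℝ) 1, ∀ v ∈ G.vertexSet, edge e s ≠ vert v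
  edge_inj : ∀ e ∈ G.edgeSet, ∀ e' ∈ G.edgeSet, ∀ s ∈ Set.Ioo (0 : ℝ) 1,
    ∀ s' ∈ Set.Icc (0 : ℝ) 1, edge e s = edge e' s' → e = e' ∧ s = s'

/-- The image `f(γ)` of a cycle under a spatial embedding: a knot. -/
def SpatialEmbedding.image {G : Graph α β} (f : SpatialEmbedding G) (γ : Cycle G) : Set S3 :=
  ⋃ i, f.edge (γ.edge i) '' Set.Icc (0 : ℝ) 1

/-- `G` is intrinsically knotted or completely 3-linked, I(K or C3L): for every spatial embedding
`f` of `G`, `f(G)` contains a nontrivial knot, or a 3-component link all of whose 2-component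
sublinks are nonsplittable. -/
def IsIKC3L (G : Graph α β) : Prop :=
  ∀ f : SpatialEmbedding G,
    (∃ γ : Cycle G, ¬ IsTrivialKnot (f.image γ)) ∨
    (∃ γ₁ γ₂ γ₃ : Cycle G,
      γ₁.IsDisjoint γ₂ ∧ γ₁.IsDisjoint γ₃ ∧ γ₂.IsDisjoint γ₃ ∧
      ¬ IsSplittable (f.image γ₁) (f.image γ₂) ∧
      ¬ IsSplittable (f.image γ₁) (f.image γ₃) ∧
      ¬ IsSplittable (f.image γ₂) (f.image γ₃))

/-- `GY` is obtained from `GΔ` by a single ΔY-exchange: the three edges `a = uv`, `b = vw`, `c = wu`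
of a 3-cycle of `GΔ` are removed, and a new vertex `x` and new edges `p = xu`, `q = xv`, `r = xw`
are added. (The names of the three removed edges may be used again.) -/
def IsDeltaYExchange (GΔ GY : Graph α β) : Prop :=
  ∃ (u v w x : α) (a b c p q r : β),
    u ≠ v ∧ v ≠ w ∧ w ≠ u ∧
    GΔ.IsLink a u v ∧ GΔ.IsLink b v w ∧ GΔ.IsLink c w u ∧
    x ∉ GΔ.vertexSet ∧
    p ≠ q ∧ q ≠ r ∧ r ≠ p ∧
    (∀ e ∈ ({p, q, r} : Set β), e ∉ GΔ.edgeSet \ {a, b, c}) ∧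
    GY.vertexSet = insert x GΔ.vertexSet ∧
    ∀ e y z, GY.IsLink e y z ↔
      (GΔ.IsLink e y z ∧ e ∉ ({a, b, c} : Set β)) ∨
      (e = p ∧ s(y, z) = s(x, u)) ∨ (e = q ∧ s(y, z) = s(x, v)) ∨ (e = r ∧ s(y, z) = s(x, w))

end SpatialGraph

/-!
From a spatial embedding `f` of `GY` an embedding `g` of `GΔ` is constructed whose knots and links,
apart from the triangle, are knots and links of `f`. The idea is to run the three edges of the
triangle parallel to the pairs of edges of the `Y`, so close to the `Y` that they and the discs
they bound together with it miss the rest of the graph.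

All geometry takes place in `ℝ⁴`, where subsets of the sphere are replaced by the cones over them
and homeomorphisms by positively homogeneous piecewise linear ones (`IsPLIso`). Isotopies
are composed of elementary moves across a triangle that is disjoint from the rest of the picture
(`exists_elementary_move`); they exist because the sets involved are polyhedral enough to stay away
from a neighbourhood of the triangle, which is expressed by `IsTame`. By such moves, polygonal arcs
are shortened to segments (`IsArc.exists_straighten`), and a `Y` becomes straight with linearly
independent ends and centre (`exists_straighten_star`). When its ends are chosen small, as in
`IsTame.exists_isThinAt`, the rest of the graph misses an explicit neighbourhood of the `Y`. In it,
with centre `X` and ends `U`, `V`, `W`, the new edges are the paths from `U` via `2X + U + V` to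
`V`, and so on (`IsExchange.exists_isCompanion`).

A cycle of `GΔ` that contains one or two of the edges of the triangle is isotopic to the cycle of
`GY` that uses two edges of the `Y` instead (`movesTo_of_one_edge`, `movesTo_of_two_edges`), and the
isotopy fixes all disjoint cycles. In the case of two edges the common vertex of these is no longer
on the cycle, and the move across it is possible because no other edge of the link ends there. The
triangle itself bounds a disc that is disjoint from all cycles disjoint from it
(`movesTo_of_three_edges`). Therefore it is a trivial knot (`exists_triangle_to_greatCircle`) and is
split from all disjoint cycles (`exists_triangle_split`), so that it is neither a nontrivial knot
nor a component of a nonsplittable link. Finally, at most one of several disjoint cycles contains edges of the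
triangle, as each of these edges contains two of its three vertices, so that a completely 3-linked
link of `g` is carried to one of `f`.
-/


namespace SpatialGraph

/-! ### Piecewise linear homeomorphisms of the space of rays -/

/-- A positively homogeneous homeomorphism of `ℝ⁴` that is piecewise linear in both directions:
the data that induce a piecewise linear homeomorphism of the sphere. -/
def IsPLIso (H : R4 ≃ₜ R4) : Prop :=
  (∀ (r : ℝ) (x : R4), 0 ≤ r → H (r • x) = r • H x) ∧
    IsPiecewiseLinear H ∧ IsPiecewiseLinear H.symm

lemma isPLIso_refl : IsPLIso (Homeomorph.refl R4) :=
  ⟨fun _ _ _ ↦ rfl, ⟨{LinearMap.id}, Set.finite_singleton _, fun _ ↦ ⟨_, rfl, rfl⟩⟩,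
    ⟨{LinearMap.id}, Set.finite_singleton _, fun _ ↦ ⟨_, rfl, rfl⟩⟩⟩

lemma IsPLIso.symm {H : R4 ≃ₜ R4} (h : IsPLIso H) : IsPLIso H.symm := by
  refine ⟨fun r x hr ↦ ?_, h.2.2, by simpa using h.2.1⟩
  apply H.injective
  rw [h.1 r _ hr]
  simp

lemma IsPiecewiseLinear.comp {f g : R4 → R4} (hf : IsPiecewiseLinear f)
    (hg : IsPiecewiseLinear g) : IsPiecewiseLinear (f ∘ g) := by
  obtain ⟨F, hF, hf⟩ := hf
  obtain ⟨G, hG, hg⟩ := hg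
  refine ⟨Set.image2 (fun A B ↦ A ∘ₗ B) F G, hF.image2 _ hG, fun x ↦ ?_⟩
  obtain ⟨B, hB, hxB⟩ := hg x
  obtain ⟨A, hA, hxA⟩ := hf (g x)
  exact ⟨A ∘ₗ B, ⟨A, hA, B, hB, rfl⟩, by simp [← hxB, hxA]⟩

lemma IsPLIso.trans {H K : R4 ≃ₜ R4} (h : IsPLIso H) (k : IsPLIso K) :
    IsPLIso (H.trans K) := by
  refine ⟨fun r x hr ↦ ?_, k.2.1.comp h.2.1, h.2.2.comp k.2.2⟩
  simp [h.1 r x hr, k.1 r _ hr]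

lemma isPLIso_linear (e : R4 ≃L[ℝ] R4) : IsPLIso e.toHomeomorph :=
  ⟨fun r x _ ↦ e.map_smul r x,
    ⟨{(e : R4 →ₗ[ℝ] R4)}, Set.finite_singleton _, fun _ ↦ ⟨_, rfl, rfl⟩⟩,
    ⟨{(e.symm : R4 →ₗ[ℝ] R4)}, Set.finite_singleton _, fun _ ↦ ⟨_, rfl, rfl⟩⟩⟩

lemma IsPLIso.map_zero {H : R4 ≃ₜ R4} (h : IsPLIso H) : H 0 = 0 := by
  simpa using h.1 0 0 le_rfl

/-- `φ` agrees at every point with one of finitely many linear functionals. -/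
def IsPLFun (φ : R4 → ℝ) : Prop :=
  ∃ F : Set (R4 →ₗ[ℝ] ℝ), F.Finite ∧ ∀ x, ∃ l ∈ F, φ x = l x

lemma isPLFun_inf' {n : ℕ} (l : Fin (n + 1) → R4 →ₗ[ℝ] ℝ) :
    IsPLFun (fun x ↦ Finset.univ.inf' Finset.univ_nonempty (fun i ↦ l i x)) := by
  refine ⟨Set.range l, Set.finite_range _, fun x ↦ ?_⟩
  obtain ⟨i, -, hi⟩ := Finset.exists_mem_eq_inf' (s := Finset.univ) Finset.univ_nonempty
    (fun i ↦ l i x)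
  exact ⟨l i, ⟨i, rfl⟩, hi⟩

lemma IsPLFun.max_zero {φ : R4 → ℝ} (h : IsPLFun φ) : IsPLFun (fun x ↦ max 0 (φ x)) := by
  obtain ⟨F, hF, h⟩ := h
  refine ⟨insert 0 F, hF.insert _, fun x ↦ ?_⟩
  obtain ⟨l, hl, hx⟩ := h x
  rcases le_total 0 (φ x) with h0 | h0
  · exact ⟨l, Set.mem_insert_of_mem _ hl, (max_eq_right h0).trans hx⟩
  · exact ⟨0, Set.mem_insert _ _, by simp [max_eq_left h0]⟩

lemma IsPLFun.sub_linear {φ : R4 → ℝ} (h : IsPLFun φ) (m : R4 →ₗ[ℝ] ℝ) :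
    IsPLFun (fun x ↦ φ x - m x) := by
  obtain ⟨F, hF, h⟩ := h
  refine ⟨(fun l ↦ l - m) '' F, hF.image _, fun x ↦ ?_⟩
  obtain ⟨l, hl, hx⟩ := h x
  exact ⟨_, ⟨l, hl, rfl⟩, by simp [hx]⟩

lemma IsPLFun.linear_sub {φ : R4 → ℝ} (h : IsPLFun φ) (m : R4 →ₗ[ℝ] ℝ) :
    IsPLFun (fun x ↦ m x - φ x) := by
  obtain ⟨F, hF, h⟩ := h
  refine ⟨(fun l ↦ m - l) '' F, hF.image _, fun x ↦ ?_⟩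
  obtain ⟨l, hl, hx⟩ := h x
  exact ⟨_, ⟨l, hl, rfl⟩, by simp [hx]⟩

lemma IsPLFun.isPiecewiseLinear_shear {φ : R4 → ℝ} (h : IsPLFun φ) (d : R4) :
    IsPiecewiseLinear (fun x ↦ x + φ x • d) := by
  obtain ⟨F, hF, h⟩ := h
  refine ⟨(fun l : R4 →ₗ[ℝ] ℝ ↦ LinearMap.id + l.smulRight d) '' F, hF.image _, fun x ↦ ?_⟩
  obtain ⟨l, hl, hx⟩ := h x
  exact ⟨_, ⟨l, hl, rfl⟩, by simp [hx]⟩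

/-- Two piecewise linear translations along a direction `d` that undo each other form a piecewise
linear isomorphism. All nonlinear homeomorphisms of the argument are of this form. -/
lemma exists_shear {φ ψ : R4 → ℝ} {d : R4} (hφ : IsPLFun φ) (hψ : IsPLFun ψ)
    (cφ : Continuous φ) (cψ : Continuous ψ)
    (hom : ∀ (r : ℝ) (x : R4), 0 ≤ r → φ (r • x) = r * φ x)
    (h₁ : ∀ x, ψ (x + φ x • d) = -φ x) (h₂ : ∀ x, φ (x + ψ x • d) = -ψ x) :
    ∃ H : R4 ≃ₜ R4, IsPLIso H ∧ ∀ x, H x = x + φ x • d := by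
  refine ⟨{ toFun := fun x ↦ x + φ x • d
            invFun := fun x ↦ x + ψ x • d
            left_inv := fun x ↦ by simp [h₁]
            right_inv := fun x ↦ by simp [h₂]
            continuous_toFun := by fun_prop
            continuous_invFun := by fun_prop }, ⟨fun r x hr ↦ ?_, ?_, ?_⟩, fun x ↦ rfl⟩
  · change r • x + φ (r • x) • d = r • (x + φ x • d)
    rw [hom r x hr, smul_add, mul_smul]
  · exact hφ.isPiecewiseLinear_shear d
  · exact hψ.isPiecewiseLinear_shear d

lemma continuous_inf'_linear {n : ℕ} (l : Fin (n + 1) → R4 →ₗ[ℝ] ℝ) :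
    Continuous (fun x ↦ Finset.univ.inf' Finset.univ_nonempty (fun i ↦ l i x)) :=
  Continuous.finset_inf'_apply _ fun i _ ↦ (l i).continuous_of_finiteDimensional

lemma inf'_smul {n : ℕ} (l : Fin (n + 1) → R4 →ₗ[ℝ] ℝ) {r : ℝ} (hr : 0 ≤ r) (x : R4) :
    Finset.univ.inf' Finset.univ_nonempty (fun i ↦ l i (r • x)) =
      r * Finset.univ.inf' Finset.univ_nonempty (fun i ↦ l i x) := by
  simp only [map_smul, smul_eq_mul]
  exact (Finset.apply_inf'_eq_inf'_comp Finset.univ_nonempty (fun y ↦ r * y)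
    fun a b ↦ mul_min_of_nonneg a b hr).symm

/-- The cone on the boundary of a convex polyhedral cone `{x | ∀ i, 0 ≤ l i x}`: moving the cone
point from `p` to `q` (both interior) extends linearly over the faces, and by the identity
outside. -/
lemma exists_push {n : ℕ} (l : Fin (n + 1) → R4 →ₗ[ℝ] ℝ) (p q : R4)
    (hp : ∀ i, 0 < l i p) (hq : ∀ i, 0 < l i q) :
    ∃ H : R4 ≃ₜ R4, IsPLIso H ∧ (∀ x, (∃ i, l i x ≤ 0) → H x = x) ∧
      ∀ (x : R4) (t : ℝ), 0 ≤ t → (∀ i, 0 ≤ l i x) → (∃ i, l i x = 0) →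
        H (x + t • p) = x + t • q := by
  -- `T p x` is the largest `t` for which `x - t • p` lies in the cone, cut off at `0`.
  let L : R4 → Fin (n + 1) → R4 →ₗ[ℝ] ℝ := fun p i ↦ (l i p)⁻¹ • l i
  let T : R4 → R4 → ℝ := fun p x ↦
    max 0 (Finset.univ.inf' Finset.univ_nonempty (fun i ↦ L p i x))
  have hT0 : ∀ p, (∀ i, 0 < l i p) → ∀ x, (∃ i, l i x ≤ 0) → T p x = 0 := by
    rintro p hp x ⟨i, hi⟩
    refine max_eq_left ((Finset.inf'_le _ (Finset.mem_univ i)).trans ?_)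
    simp only [L, LinearMap.smul_apply, smul_eq_mul]
    exact mul_nonpos_of_nonneg_of_nonpos (inv_nonneg.2 (hp i).le) hi
  have hT1 : ∀ p, (∀ i, 0 < l i p) → ∀ (x : R4) (t : ℝ), 0 ≤ t → (∀ i, 0 ≤ l i x) →
      (∃ i, l i x = 0) → T p (x + t • p) = t := by
    rintro p hp x t ht hx ⟨i, hi⟩
    have key : Finset.univ.inf' Finset.univ_nonempty (fun i ↦ L p i (x + t • p)) = t := by
      apply le_antisymm
      · refine (Finset.inf'_le _ (Finset.mem_univ i)).trans ?_
        simp [L, hi, mul_comm t, inv_mul_cancel_left₀ (hp i).ne']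
      · refine Finset.le_inf' _ _ fun j _ ↦ ?_
        have : L p j (x + t • p) = (l j p)⁻¹ * l j x + t := by
          simp [L, mul_add, mul_comm t, inv_mul_cancel_left₀ (hp j).ne']
        rw [this]
        have := mul_nonneg (inv_nonneg.2 (hp j).le) (hx j)
        linarith
    simp only [T]
    rw [key, max_eq_right ht]
  have hT2 : ∀ p, (∀ i, 0 < l i p) → ∀ x, (∀ i, 0 < l i x) →
      0 ≤ T p x ∧ (∀ i, 0 ≤ l i (x - T p x • p)) ∧ ∃ i, l i (x - T p x • p) = 0 := by
    intro p hp x hx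
    have h0 : 0 ≤ Finset.univ.inf' Finset.univ_nonempty (fun i ↦ L p i x) := by
      refine Finset.le_inf' _ _ fun j _ ↦ ?_
      simp only [L, LinearMap.smul_apply, smul_eq_mul]
      exact mul_nonneg (inv_nonneg.2 (hp j).le) (hx j).le
    have hTx : T p x = Finset.univ.inf' Finset.univ_nonempty (fun i ↦ L p i x) :=
      max_eq_right h0
    have e : ∀ i, l i x = l i p * L p i x := fun i ↦ by
      simp [L, mul_inv_cancel_left₀ (hp i).ne']
    refine ⟨le_max_left _ _, fun i ↦ ?_, ?_⟩
    · have : T p x ≤ L p i x := hTx ▸ Finset.inf'_le _ (Finset.mem_univ i)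
      simp only [map_sub, map_smul, smul_eq_mul]
      rw [e i]
      nlinarith [hp i]
    · obtain ⟨i, -, hi⟩ := Finset.exists_mem_eq_inf' (s := Finset.univ) Finset.univ_nonempty
        (fun i ↦ L p i x)
      refine ⟨i, ?_⟩
      simp only [map_sub, map_smul, smul_eq_mul]
      rw [e i, hTx, hi]
      ring
  have inv : ∀ p q, (∀ i, 0 < l i p) → (∀ i, 0 < l i q) → ∀ x,
      T q (x + T p x • (q - p)) = T p x := by
    intro p q hp hq x
    by_cases hx : ∃ i, l i x ≤ 0
    · simp [hT0 p hp x hx, hT0 q hq x hx]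
    · push Not at hx
      obtain ⟨h1, h2, h3⟩ := hT2 p hp x hx
      have := hT1 q hq (x - T p x • p) (T p x) h1 h2 h3
      rw [← this]
      congr 1
      rw [this]
      module
  have hPL : ∀ p, IsPLFun (T p) := fun p ↦ (isPLFun_inf' (L p)).max_zero
  have hC : ∀ p, Continuous (T p) := fun p ↦ continuous_const.max (continuous_inf'_linear (L p))
  obtain ⟨H, hH, hHx⟩ := exists_shear (φ := T p) (ψ := fun x ↦ - T q x) (d := q - p) (hPL p)
    (by simpa using (hPL q).linear_sub 0) (hC p) (hC q).neg
    (fun r x hr ↦ by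
      simp only [T]
      rw [inf'_smul _ hr, mul_max_of_nonneg _ _ hr, mul_zero])
    (fun x ↦ by simp only [inv p q hp hq x])
    (fun x ↦ by
      have := inv q p hq hp x
      rw [neg_neg, ← this]
      congr 1
      rw [this]
      module)
  refine ⟨H, hH, fun x hx ↦ by simp [hHx, hT0 p hp x hx], fun x t ht hx hx' ↦ ?_⟩
  rw [hHx, hT1 p hp x t ht hx hx']
  module

/-! ### Polyhedral cones -/

/-- The ray through `A`, with the origin. -/
def ray (A : R4) : Set R4 := {x | ∃ s : ℝ, 0 ≤ s ∧ x = s • A}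

/-- The convex cone spanned by `A` and `B`: a segment of the sphere, in homogeneous coordinates. -/
def cone (A B : R4) : Set R4 := {x | ∃ s t : ℝ, 0 ≤ s ∧ 0 ≤ t ∧ x = s • A + t • B}

lemma cone_comm (A B : R4) : cone A B = cone B A := by
  ext x
  constructor <;> rintro ⟨s, t, hs, ht, rfl⟩ <;> exact ⟨t, s, ht, hs, add_comm _ _⟩

lemma ray_subset_cone_left (A B : R4) : ray A ⊆ cone A B := by
  rintro _ ⟨s, hs, rfl⟩
  exact ⟨s, 0, hs, le_rfl, by simp⟩

lemma ray_subset_cone_right (A B : R4) : ray B ⊆ cone A B := by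
  rintro _ ⟨s, hs, rfl⟩
  exact ⟨0, s, le_rfl, hs, by simp⟩

lemma self_mem_ray (A : R4) : A ∈ ray A := ⟨1, zero_le_one, by simp⟩

lemma zero_mem_ray (A : R4) : (0 : R4) ∈ ray A := ⟨0, le_rfl, by simp⟩

lemma cone_self (A : R4) : cone A A = ray A := by
  refine Set.Subset.antisymm ?_ (ray_subset_cone_left A A)
  rintro _ ⟨s, t, hs, ht, rfl⟩
  exact ⟨s + t, add_nonneg hs ht, by module⟩

lemma ray_smul (A : R4) {r : ℝ} (hr : 0 < r) : ray (r • A) = ray A := by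
  ext x
  constructor
  · rintro ⟨s, hs, rfl⟩
    exact ⟨s * r, by positivity, by module⟩
  · rintro ⟨s, hs, rfl⟩
    exact ⟨s / r, by positivity, by rw [smul_smul, div_mul_cancel₀ _ hr.ne']⟩

lemma cone_smul_left (A B : R4) {r : ℝ} (hr : 0 < r) : cone (r • A) B = cone A B := by
  ext x
  constructor
  · rintro ⟨s, t, hs, ht, rfl⟩
    exact ⟨s * r, t, by positivity, ht, by module⟩
  · rintro ⟨s, t, hs, ht, rfl⟩
    exact ⟨s / r, t, by positivity, ht, by rw [smul_smul, div_mul_cancel₀ _ hr.ne']⟩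

lemma cone_smul_right (A B : R4) {r : ℝ} (hr : 0 < r) : cone A (r • B) = cone A B := by
  rw [cone_comm, cone_smul_left _ _ hr, cone_comm]

/-- A finitely generated convex cone is closed (conic Carathéodory: it is a finite union of linear
images of orthants under injective maps). -/
lemma isClosed_conic_hull {ι : Type*} [DecidableEq ι] (v : ι → R4) (S : Finset ι) :
    IsClosed {x | ∃ c : ι → ℝ, (∀ i ∈ S, 0 ≤ c i) ∧ x = ∑ i ∈ S, c i • v i} := by
  induction S using Finset.strongInduction with
  | H S ih =>
  by_cases hS : LinearIndependent ℝ (fun i : S ↦ v i)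
  · let f : (S → ℝ) →ₗ[ℝ] R4 := Fintype.linearCombination ℝ (fun i : S ↦ v i)
    have hf : Topology.IsClosedEmbedding f := by
      apply LinearMap.isClosedEmbedding_of_injective
      rw [LinearMap.ker_eq_bot]
      exact linearIndependent_iff_injective_fintypeLinearCombination.1 hS
    have hc : IsClosed {c : S → ℝ | ∀ i, 0 ≤ c i} := by
      simp only [Set.ofPred_forall]
      exact isClosed_iInter fun i ↦ isClosed_le continuous_const (continuous_apply i)
    convert hf.isClosedMap _ hc using 1
    ext x
    simp only [Set.mem_ofPred_eq, Set.mem_image]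
    constructor
    · rintro ⟨c, hc, rfl⟩
      refine ⟨fun i ↦ c i, fun i ↦ hc i i.2, ?_⟩
      simp only [f, Fintype.linearCombination_apply]
      exact Finset.sum_coe_sort S (fun i ↦ c i • v i)
    · rintro ⟨c, hc, rfl⟩
      refine ⟨fun i ↦ if h : i ∈ S then c ⟨i, h⟩ else 0, fun i hi ↦ by simp [hi, hc], ?_⟩
      simp only [f, Fintype.linearCombination_apply]
      rw [← Finset.sum_coe_sort S]
      exact Finset.sum_congr rfl fun i _ ↦ by simp
  · -- A linear relation lets one coefficient be reduced to zero.
    have key : {x | ∃ c : ι → ℝ, (∀ i ∈ S, 0 ≤ c i) ∧ x = ∑ i ∈ S, c i • v i} =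
        ⋃ j ∈ S, {x | ∃ c : ι → ℝ, (∀ i ∈ S.erase j, 0 ≤ c i) ∧
          x = ∑ i ∈ S.erase j, c i • v i} := by
      obtain ⟨g, hg0, j₀, hj₀⟩ : ∃ g : ι → ℝ, ∑ i ∈ S, g i • v i = 0 ∧ ∃ j ∈ S, 0 < g j := by
        rw [Fintype.linearIndependent_iff] at hS
        push Not at hS
        obtain ⟨g, hg, j, hj⟩ := hS
        let g' : ι → ℝ := fun i ↦ if h : i ∈ S then g ⟨i, h⟩ else 0
        have hg' : ∑ i ∈ S, g' i • v i = 0 := by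
          rw [← Finset.sum_coe_sort S, ← hg]
          exact Finset.sum_congr rfl fun i _ ↦ by simp [g']
        have hj' : g' j ≠ 0 := by simpa [g'] using hj
        rcases hj'.lt_or_gt with h | h
        · exact ⟨-g', by simp [hg'], j, j.2, by simpa using h⟩
        · exact ⟨g', hg', j, j.2, h⟩
      ext x
      simp only [Set.mem_ofPred_eq, Set.mem_iUnion, exists_prop]
      constructor
      · rintro ⟨c, hc, rfl⟩
        obtain ⟨j, hj, hmin⟩ := Finset.exists_min_image (S.filter fun i ↦ 0 < g i)
          (fun i ↦ c i / g i) ⟨j₀, by simp [hj₀.1, hj₀.2]⟩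
        simp only [Finset.mem_filter] at hj hmin
        have hcj : c j - c j / g j * g j = 0 := by
          rw [div_mul_cancel₀ _ hj.2.ne', sub_self]
        refine ⟨j, hj.1, fun i ↦ c i - c j / g j * g i, fun i hi ↦ ?_, ?_⟩
        · have hiS := Finset.mem_of_mem_erase hi
          rcases lt_or_ge 0 (g i) with h | h
          · have := hmin i ⟨hiS, h⟩
            rw [le_div_iff₀ h] at this
            linarith
          · have : 0 ≤ c j / g j := div_nonneg (hc j hj.1) hj.2.le
            nlinarith [hc i hiS]
        · rw [Finset.sum_erase _ (by simp only [hcj, zero_smul])]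
          simp only [sub_smul, Finset.sum_sub_distrib, mul_smul, ← Finset.smul_sum, hg0]
          simp
      · rintro ⟨j, hj, c, hc, rfl⟩
        refine ⟨fun i ↦ if i = j then 0 else c i, fun i hi ↦ ?_, ?_⟩
        · by_cases h : i = j
          · simp [h]
          · simpa [h] using hc i (Finset.mem_erase.2 ⟨h, hi⟩)
        · rw [← Finset.sum_erase (a := j) S (by simp)]
          exact Finset.sum_congr rfl fun i hi ↦ by simp [Finset.ne_of_mem_erase hi]
    rw [key]
    exact S.finite_toSet.isClosed_biUnion fun j hj ↦ ih _ (Finset.erase_ssubset hj)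

/-- The property of polyhedral sets that the argument uses: the set is invariant under scaling, and
its tangent cones are closed, so that a cone from `A` which meets it only in the ray of `A` can be
thickened. -/
def IsTame (L : Set R4) : Prop :=
  (∀ x ∈ L, ∀ r : ℝ, 0 ≤ r → r • x ∈ L) ∧
    ∀ A : R4, IsClosed {y | ∃ s : ℝ, 0 ≤ s ∧ y + s • A ∈ L}

lemma isTame_empty : IsTame ∅ := ⟨by simp, by simp⟩

lemma IsTame.union {L M : Set R4} (hL : IsTame L) (hM : IsTame M) : IsTame (L ∪ M) := by
  refine ⟨fun x hx r hr ↦ hx.imp (fun h ↦ hL.1 x h r hr) (fun h ↦ hM.1 x h r hr), fun A ↦ ?_⟩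
  convert (hL.2 A).union (hM.2 A) using 1
  ext y
  simp only [Set.mem_union, Set.mem_ofPred_eq]
  constructor
  · rintro ⟨s, hs, h | h⟩
    exacts [Or.inl ⟨s, hs, h⟩, Or.inr ⟨s, hs, h⟩]
  · rintro (⟨s, hs, h⟩ | ⟨s, hs, h⟩)
    exacts [⟨s, hs, Or.inl h⟩, ⟨s, hs, Or.inr h⟩]

lemma isTame_biUnion {ι : Type*} {S : Set ι} (hS : S.Finite) {L : ι → Set R4}
    (h : ∀ i ∈ S, IsTame (L i)) : IsTame (⋃ i ∈ S, L i) := by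
  induction S, hS using Set.Finite.induction_on with
  | empty => simpa using isTame_empty
  | insert _ _ ih =>
    rw [Set.biUnion_insert]
    exact (h _ (Set.mem_insert _ _)).union (ih fun i hi ↦ h i (Set.mem_insert_of_mem _ hi))

lemma isTame_cone (P Q : R4) : IsTame (cone P Q) := by
  refine ⟨?_, fun A ↦ ?_⟩
  · rintro _ ⟨s, t, hs, ht, rfl⟩ r hr
    exact ⟨r * s, r * t, by positivity, by positivity, by module⟩
  · convert isClosed_conic_hull ![P, Q, -A] Finset.univ using 1
    ext y
    simp only [Set.mem_ofPred_eq, Fin.sum_univ_three]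
    constructor
    · rintro ⟨s, hs, p, q, hp, hq, h⟩
      refine ⟨![p, q, s], by simp [Fin.forall_fin_succ, hp, hq, hs], ?_⟩
      simp only [Matrix.cons_val]
      rw [eq_sub_of_add_eq h]
      module
    · rintro ⟨c, hc, rfl⟩
      refine ⟨c 2, hc 2 (by simp), c 0, c 1, hc 0 (by simp), hc 1 (by simp), ?_⟩
      simp only [Matrix.cons_val]
      module

lemma isTame_ray (P : R4) : IsTame (ray P) := cone_self P ▸ isTame_cone P P

lemma IsTame.smul_notMem {L : Set R4} (hL : IsTame L) {x : R4} (hx : x ∉ L) {r : ℝ} (hr : 0 < r) :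
    r • x ∉ L := fun h ↦ hx (by
  have := hL.1 _ h r⁻¹ (by positivity)
  rwa [smul_smul, inv_mul_cancel₀ hr.ne', one_smul] at this)

lemma IsTame.exists_thickening {L : Set R4} (hL : IsTame L) {A : R4} {S : Set R4}
    (hS : IsCompact S) (h : ∀ y ∈ S, ∀ s : ℝ, 0 ≤ s → y + s • A ∉ L) :
    ∃ ε > 0, ∀ y ∈ S, ∀ w : R4, ‖w‖ < ε → ∀ s : ℝ, 0 ≤ s → y + w + s • A ∉ L := by
  obtain ⟨ε, hε, hsub⟩ := hS.exists_thickening_subset_open (hL.2 A).isOpen_compl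
    (fun y hy ⟨s, hs, hy'⟩ ↦ h y hy s hs hy')
  refine ⟨ε, hε, fun y hy w hw s hs hmem ↦ ?_⟩
  have : y + w ∈ Metric.thickening ε S :=
    Metric.mem_thickening_iff.2 ⟨y, hy, by simpa [dist_eq_norm] using hw⟩
  exact hsub this ⟨s, hs, hmem⟩

/-- A segment from `A` that meets a polyhedral set only at `A` can be thickened away from `A`. -/
lemma IsTame.exists_thin {L : Set R4} (hL : IsTame L) {A B : R4} (E₁ E₂ : R4)
    (h : ∀ s : ℝ, 0 ≤ s → B + s • A ∉ L) :
    ∃ η₀ > 0, ∀ η : ℝ, 0 ≤ η → η ≤ η₀ → ∀ s b c d : ℝ, 0 ≤ s → 0 ≤ b → 0 ≤ c → 0 ≤ d →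
      0 < b + c + d → s • A + b • B + c • (B + η • E₁) + d • (B + η • E₂) ∉ L := by
  obtain ⟨ε, hε, H⟩ := hL.exists_thickening (isCompact_singleton (x := B)) (A := A)
    (by simpa using h)
  refine ⟨ε / 2 / (‖E₁‖ + ‖E₂‖ + 1), by positivity, fun η hη0 hη s b c d hs hb hc hd hσ ↦ ?_⟩
  set σ := b + c + d with hσ'
  have key := H B rfl ((c / σ * η) • E₁ + (d / σ * η) • E₂) ?_ (s / σ) (by positivity)
  · convert hL.smul_notMem key hσ using 2
    simp only [smul_add, smul_smul]
    rw [mul_div_cancel₀ _ hσ.ne', ← mul_assoc, mul_div_cancel₀ _ hσ.ne', ← mul_assoc,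
      mul_div_cancel₀ _ hσ.ne', hσ']
    module
  · have h1 : c / σ ≤ 1 := (div_le_one hσ).2 (by linarith)
    have h2 : d / σ ≤ 1 := (div_le_one hσ).2 (by linarith)
    have h1' : 0 ≤ c / σ := by positivity
    have h2' : 0 ≤ d / σ := by positivity
    rw [le_div_iff₀ (by positivity)] at hη
    calc ‖(c / σ * η) • E₁ + (d / σ * η) • E₂‖ ≤ c / σ * η * ‖E₁‖ + d / σ * η * ‖E₂‖ := by
          refine (norm_add_le _ _).trans ?_
          rw [norm_smul, norm_smul, Real.norm_of_nonneg (by positivity),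
            Real.norm_of_nonneg (by positivity)]
      _ ≤ 1 * η * ‖E₁‖ + 1 * η * ‖E₂‖ := by gcongr
      _ < ε := by nlinarith [norm_nonneg E₁, norm_nonneg E₂]

/-- The neighbourhood `|e| ≤ δ (b + δ c)`, `-δ b ≤ c` of the cone spanned by `B` and `D`, coned from
`A`, avoids `L` for small `δ`. -/
lemma IsTame.exists_thin_triangle {L : Set R4} (hL : IsTame L) {A B D : R4} (E : R4)
    (h : ∀ t s : ℝ, 0 ≤ t → t ≤ 1 → 0 ≤ s → (1 - t) • B + t • D + s • A ∉ L) :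
    ∃ δ₀ > 0, ∀ δ : ℝ, 0 < δ → δ ≤ δ₀ → ∀ s b c e : ℝ, 0 ≤ s → |e| ≤ δ * (b + δ * c) →
      0 ≤ c + δ * b → (b ≠ 0 ∨ c ≠ 0) → s • A + b • B + c • D + e • E ∉ L := by
  have hS : IsCompact ((fun t : ℝ ↦ (1 - t) • B + t • D) '' Set.Icc 0 1) :=
    isCompact_Icc.image (by fun_prop)
  obtain ⟨ε, hε, H⟩ := hL.exists_thickening hS (A := A) (by
    rintro _ ⟨t, ht, rfl⟩ s hs
    exact h t s ht.1 ht.2 hs)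
  have HB := H B ⟨0, by simp, by simp⟩
  have HD := H D ⟨1, by simp, by simp⟩
  set N := ‖B‖ + ‖D‖ + ‖E‖ + 1 with hN
  have hBN := norm_nonneg B
  have hDN := norm_nonneg D
  have hEN := norm_nonneg E
  refine ⟨min (1 / 2) (ε / 2 / N), by positivity, fun δ hδ hδ' s b c e hs he hc hbc ↦ ?_⟩
  have hδ1 : δ ≤ 1 / 2 := hδ'.trans (min_le_left _ _)
  have hδ2 : δ * N < ε := by
    have := hδ'.trans (min_le_right _ _)
    rw [le_div_iff₀ (by positivity)] at this
    linarith
  have hb : 0 ≤ b + δ * c := by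
    have := (abs_nonneg e).trans he
    nlinarith
  have bound : ∀ (x y : ℝ) (F : R4), ‖F‖ ≤ ‖B‖ + ‖D‖ → |x| ≤ δ → |y| ≤ δ →
      ‖x • F + y • E‖ < ε := by
    intro x y F hF hx hy
    calc ‖x • F + y • E‖ ≤ |x| * ‖F‖ + |y| * ‖E‖ := by
          refine (norm_add_le _ _).trans ?_
          rw [norm_smul, norm_smul, Real.norm_eq_abs, Real.norm_eq_abs]
      _ ≤ δ * (‖B‖ + ‖D‖) + δ * ‖E‖ := by gcongr
      _ < ε := by nlinarith
  rcases lt_or_ge b 0 with hb0 | hb0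
  · have hc0 : 0 < c := by nlinarith
    have key := HD ((b / c) • B + (e / c) • E) (bound _ _ _ (by linarith) ?_ ?_) (s / c)
      (by positivity)
    · convert hL.smul_notMem key hc0 using 2
      simp only [smul_add, smul_smul, mul_div_cancel₀ _ hc0.ne']
      module
    · rw [abs_div, abs_of_pos hc0, div_le_iff₀ hc0, abs_of_neg hb0]
      linarith
    · rw [abs_div, abs_of_pos hc0, div_le_iff₀ hc0]
      nlinarith
  rcases lt_or_ge c 0 with hc0 | hc0
  · have hb0 : 0 < b := by nlinarith
    have key := HB ((c / b) • D + (e / b) • E) (bound _ _ _ (by linarith) ?_ ?_) (s / b)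
      (by positivity)
    · convert hL.smul_notMem key hb0 using 2
      simp only [smul_add, smul_smul, mul_div_cancel₀ _ hb0.ne']
      module
    · rw [abs_div, abs_of_pos hb0, div_le_iff₀ hb0, abs_of_neg hc0]
      linarith
    · rw [abs_div, abs_of_pos hb0, div_le_iff₀ hb0]
      have : δ * c ≤ 0 := by nlinarith
      nlinarith
  have hσ : 0 < b + c := by
    rcases hbc with h | h
    · have := lt_of_le_of_ne hb0 h.symm
      linarith
    · have := lt_of_le_of_ne hc0 h.symm
      linarith
  have key := H ((1 - c / (b + c)) • B + (c / (b + c)) • D)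
    ⟨c / (b + c), ⟨by positivity, (div_le_one hσ).2 (by linarith)⟩, rfl⟩
    ((0 : ℝ) • B + (e / (b + c)) • E) (bound _ _ _ (by linarith) (by simpa using hδ.le) ?_)
    (s / (b + c)) (by positivity)
  · convert hL.smul_notMem key hσ using 2
    simp only [smul_add, smul_smul, mul_div_cancel₀ _ hσ.ne', mul_sub]
    module
  · rw [abs_div, abs_of_pos hσ, div_le_iff₀ hσ]
    have : δ * c ≤ c := by nlinarith
    nlinarith

/-! ### Elementary moves -/

lemma exists_notMem_of_ne_top {S : Submodule ℝ R4} (hS : S ≠ ⊤) : ∃ x, x ∉ S := by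
  by_contra! h
  exact hS (Submodule.eq_top_iff'.2 h)

lemma span_ne_top {n : ℕ} (v : Fin n → R4) (hn : n < 4) :
    Submodule.span ℝ (Set.range v) ≠ ⊤ := by
  intro h
  have h1 := finrank_range_le_card (R := ℝ) v
  rw [Set.finrank, h, finrank_top, finrank_euclideanSpace] at h1
  simp at h1
  omega

/-- Linear coordinates with respect to four independent vectors of `ℝ⁴`. -/
lemma exists_coords {A B C D : R4} (h : LinearIndependent ℝ ![A, B, C, D]) :
    ∃ a b c d : R4 →ₗ[ℝ] ℝ,
      (a A = 1 ∧ a B = 0 ∧ a C = 0 ∧ a D = 0) ∧ (b A = 0 ∧ b B = 1 ∧ b C = 0 ∧ b D = 0) ∧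
      (c A = 0 ∧ c B = 0 ∧ c C = 1 ∧ c D = 0) ∧ (d A = 0 ∧ d B = 0 ∧ d C = 0 ∧ d D = 1) ∧
      ∀ x, x = a x • A + b x • B + c x • C + d x • D := by
  let β := basisOfLinearIndependentOfCardEqFinrank h (by simp)
  have hβ : ∀ i, β i = ![A, B, C, D] i := fun i ↦ by simp [β]
  have key : ∀ i j, β.coord i (![A, B, C, D] j) = if j = i then 1 else 0 := fun i j ↦ by
    rw [← hβ, Module.Basis.coord_apply, Module.Basis.repr_self, Finsupp.single_apply]
  refine ⟨β.coord 0, β.coord 1, β.coord 2, β.coord 3,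
    ⟨?_, ?_, ?_, ?_⟩, ⟨?_, ?_, ?_, ?_⟩, ⟨?_, ?_, ?_, ?_⟩, ⟨?_, ?_, ?_, ?_⟩, fun x ↦ ?_⟩
  · simpa using key 0 0
  · simpa using key 0 1
  · simpa using key 0 2
  · simpa using key 0 3
  · simpa using key 1 0
  · simpa using key 1 1
  · simpa using key 1 2
  · simpa using key 1 3
  · simpa using key 2 0
  · simpa using key 2 1
  · simpa using key 2 2
  · simpa using key 2 3
  · simpa using key 3 0
  · simpa using key 3 1
  · simpa using key 3 2
  · simpa using key 3 3
  · have := β.sum_repr x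
    simpa [Fin.sum_univ_four, hβ] using this.symm

lemma linearIndependent_three_iff {A B C : R4} : LinearIndependent ℝ ![A, B, C] ↔
    ∀ r s t : ℝ, r • A + s • B + t • C = 0 → r = 0 ∧ s = 0 ∧ t = 0 := by
  rw [Fintype.linearIndependent_iff]
  constructor
  · intro h r s t hrst
    have := h ![r, s, t] (by simpa [Fin.sum_univ_three] using hrst)
    exact ⟨this 0, this 1, this 2⟩
  · intro h g hg
    have := h (g 0) (g 1) (g 2) (by simpa [Fin.sum_univ_three] using hg)
    simpa [Fin.forall_fin_succ] using this

lemma linearIndependent_four_iff {A B C D : R4} : LinearIndependent ℝ ![A, B, C, D] ↔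
    ∀ r s t u : ℝ, r • A + s • B + t • C + u • D = 0 → r = 0 ∧ s = 0 ∧ t = 0 ∧ u = 0 := by
  rw [Fintype.linearIndependent_iff]
  constructor
  · intro h r s t u hrst
    have := h ![r, s, t, u] (by simpa [Fin.sum_univ_four] using hrst)
    exact ⟨this 0, this 1, this 2, this 3⟩
  · intro h g hg
    have := h (g 0) (g 1) (g 2) (g 3) (by simpa [Fin.sum_univ_four] using hg)
    simpa [Fin.forall_fin_succ] using this

lemma exists_linearIndependent_four {A B C : R4} (h : LinearIndependent ℝ ![A, B, C]) :
    ∃ D, LinearIndependent ℝ ![A, B, C, D] := by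
  obtain ⟨D, hD⟩ := exists_notMem_of_ne_top (span_ne_top ![A, B, C] (by norm_num))
  have h4 : LinearIndependent ℝ ![D, A, B, C] := linearIndependent_finCons.2 ⟨h, hD⟩
  rw [linearIndependent_four_iff] at h4
  refine ⟨D, linearIndependent_four_iff.2 fun r s t u hr ↦ ?_⟩
  obtain ⟨h1, h2, h3, h5⟩ := h4 u r s t (by rw [← hr]; module)
  exact ⟨h2, h3, h5, h1⟩

lemma image_cone {H : R4 → R4} {A B A' B' : R4}
    (h : ∀ s t : ℝ, 0 ≤ s → 0 ≤ t → H (s • A + t • B) = s • A' + t • B') :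
    H '' cone A B = cone A' B' := by
  ext x
  constructor
  · rintro ⟨_, ⟨s, t, hs, ht, rfl⟩, rfl⟩
    exact ⟨s, t, hs, ht, h s t hs ht⟩
  · rintro ⟨s, t, hs, ht, rfl⟩
    exact ⟨_, ⟨s, t, hs, ht, rfl⟩, h s t hs ht⟩

lemma cone_union_cone_of_mem {A C q : R4} {α γ : ℝ} (hα : 0 < α) (hγ : 0 < γ)
    (hq : q = α • A + γ • C) : cone A q ∪ cone q C = cone A C := by
  subst hq
  ext x
  constructor
  · rintro (⟨s, t, hs, ht, rfl⟩ | ⟨s, t, hs, ht, rfl⟩)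
    · exact ⟨s + t * α, t * γ, by positivity, by positivity, by module⟩
    · exact ⟨s * α, s * γ + t, by positivity, by positivity, by module⟩
  · rintro ⟨s, t, hs, ht, rfl⟩
    rcases le_total (t * α) (s * γ) with h | h
    · refine Or.inl ⟨s - t / γ * α, t / γ, ?_, by positivity, ?_⟩
      · rw [sub_nonneg, div_mul_eq_mul_div, div_le_iff₀ hγ]
        exact h
      · rw [smul_add, smul_smul, smul_smul, div_mul_cancel₀ _ hγ.ne']
        module
    · refine Or.inr ⟨s / α, t - s / α * γ, by positivity, ?_, ?_⟩
      · rw [sub_nonneg, div_mul_eq_mul_div, div_le_iff₀ hα]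
        exact h
      · rw [smul_add, smul_smul, smul_smul, div_mul_cancel₀ _ hα.ne']
        module

lemma cone_union_cone_add (A C : R4) : cone A (A + C) ∪ cone (A + C) C = cone A C :=
  cone_union_cone_of_mem one_pos one_pos (by simp)

/-- The elementary move across a triangle `ABC` that meets the polyhedral set `L` at most in the
vertices `A` and `C`: a homeomorphism that fixes `L` carries the path `ABC` to the side `AC`.
It is the push, in a thin neighbourhood of the triangle, of `B` to the point `A + C` of that
side. -/
lemma exists_elementary_move {A B C : R4} (hABC : LinearIndependent ℝ ![A, B, C]) {L : Set R4}
    (hL : IsTame L)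
    (h : ∀ r s t : ℝ, 0 ≤ r → 0 ≤ s → 0 ≤ t → r • A + s • B + t • C ∈ L →
      s = 0 ∧ (r = 0 ∨ t = 0)) :
    ∃ H : R4 ≃ₜ R4, IsPLIso H ∧ (∀ x ∈ L, H x = x) ∧ H A = A ∧ H C = C ∧ H B = A + C ∧
      H '' cone A B = cone A (A + C) ∧ H '' cone B C = cone (A + C) C := by
  obtain ⟨E, hE⟩ := exists_linearIndependent_four hABC
  obtain ⟨a, b, c, e, ⟨aA, aB, aC, aE⟩, ⟨bA, bB, bC, bE⟩, ⟨cA, cB, cC, cE⟩, ⟨eA, eB, eC, eE⟩, hx⟩ :=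
    exists_coords hE
  have hA : ∀ t s : ℝ, 0 ≤ t → t ≤ 1 → 0 ≤ s → (1 - t) • B + t • (A + C) + s • A ∉ L := by
    intro t s ht ht1 hs hmem
    obtain ⟨h1, h2⟩ := h (t + s) (1 - t) t (by linarith) (by linarith) ht
      (by convert hmem using 1; module)
    rcases h2 with h2 | h2 <;> linarith
  have hC : ∀ t s : ℝ, 0 ≤ t → t ≤ 1 → 0 ≤ s → (1 - t) • B + t • (A + C) + s • C ∉ L := by
    intro t s ht ht1 hs hmem
    obtain ⟨h1, h2⟩ := h t (1 - t) (t + s) ht (by linarith) (by linarith)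
      (by convert hmem using 1; module)
    rcases h2 with h2 | h2 <;> linarith
  obtain ⟨δ₁, hδ₁, h₁⟩ := hL.exists_thin_triangle E hA
  obtain ⟨δ₂, hδ₂, h₂⟩ := hL.exists_thin_triangle E hC
  set δ := min δ₁ δ₂ with hδ'
  have hδ : 0 < δ := lt_min hδ₁ hδ₂
  -- The neighbourhood: `A` and `C` lie on its boundary, `B` and `A + C` in its interior.
  let l : Fin 6 → R4 →ₗ[ℝ] ℝ :=
    ![b + δ • c + δ⁻¹ • e, b + δ • c - δ⁻¹ • e, b + δ • a + δ⁻¹ • e, b + δ • a - δ⁻¹ • e,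
      a + δ • b, c + δ • b]
  obtain ⟨H, hH, hfix, hmove⟩ := exists_push l B (A + C)
    (by simp [l, Fin.forall_fin_succ, aB, bB, cB, eB, hδ])
    (by simp [l, Fin.forall_fin_succ, aA, bA, cA, eA, aC, bC, cC, eC, hδ])
  have hHA : H A = A := hfix A ⟨0, by simp [l, bA, cA, eA]⟩
  have hHC : H C = C := hfix C ⟨2, by simp [l, aC, bC, eC]⟩
  have hAB : ∀ s t : ℝ, 0 ≤ s → 0 ≤ t → H (s • A + t • B) = s • A + t • (A + C) :=
    fun s t hs ht ↦ hmove (s • A) t ht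
      (by simp [l, Fin.forall_fin_succ, aA, bA, cA, eA, hs, mul_nonneg hs hδ.le])
      ⟨0, by simp [l, bA, cA, eA]⟩
  have hCB : ∀ s t : ℝ, 0 ≤ s → 0 ≤ t → H (s • C + t • B) = s • C + t • (A + C) :=
    fun s t hs ht ↦ hmove (s • C) t ht
      (by simp [l, Fin.forall_fin_succ, aC, bC, cC, eC, hs, mul_nonneg hs hδ.le])
      ⟨2, by simp [l, aC, bC, eC]⟩
  refine ⟨H, hH, fun x hxL ↦ hfix x ?_, hHA, hHC, by simpa using hAB 0 1 le_rfl zero_le_one,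
    image_cone hAB, ?_⟩
  · by_contra! hpos
    simp only [l, Fin.forall_fin_succ, Fin.isValue, Matrix.cons_val_zero, LinearMap.add_apply,
      LinearMap.smul_apply, smul_eq_mul, Matrix.cons_val_succ, LinearMap.sub_apply,
      Matrix.cons_val_fin_one, IsEmpty.forall_iff, and_true] at hpos
    obtain ⟨p1, p2, p3, p4, p5, p6⟩ := hpos
    have habs : ∀ y : ℝ, 0 < y + δ⁻¹ * e x → 0 < y - δ⁻¹ * e x → |e x| ≤ δ * y := by
      intro y h1 h2
      have h3 : |δ⁻¹ * e x| ≤ y := abs_le.2 ⟨by linarith, by linarith⟩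
      rw [abs_mul, abs_of_pos (inv_pos.2 hδ), inv_mul_le_iff₀ hδ] at h3
      exact h3
    rcases le_total (c x) (a x) with hac | hac
    · refine h₁ δ hδ (min_le_left _ _) (a x - c x) (b x) (c x) (e x) (by linarith)
        (habs _ p1 p2) p6.le ?_ ?_
      · by_contra! h0
        simp [h0.1, h0.2] at p6
      · convert hxL using 1
        conv_rhs => rw [hx x]
        module
    · refine h₂ δ hδ (min_le_right _ _) (c x - a x) (b x) (a x) (e x) (by linarith)
        (habs _ p3 p4) p5.le ?_ ?_
      · by_contra! h0
        simp [h0.1, h0.2] at p5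
      · convert hxL using 1
        conv_rhs => rw [hx x]
        module
  · rw [cone_comm B C, cone_comm (A + C) C]
    exact image_cone hCB

/-! ### Straightening arcs -/

lemma linearIndependent_two_iff {A B : R4} : LinearIndependent ℝ ![A, B] ↔
    ∀ r s : ℝ, r • A + s • B = 0 → r = 0 ∧ s = 0 :=
  LinearIndependent.pair_iff

lemma add_smul_notMem_ray {A B : R4} (h : LinearIndependent ℝ ![A, B]) (s : ℝ) :
    B + s • A ∉ ray A := by
  rintro ⟨r, -, hr⟩
  have := (linearIndependent_two_iff.1 h (s - r) 1
    (by rw [sub_smul, ← hr]; module)).2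
  exact one_ne_zero this

/-- A segment `AB` that meets the polyhedral set `L` at most in `A` can be pulled back towards `A`,
slightly off its direction, by a homeomorphism that fixes `L`. -/
lemma exists_pull {A B F : R4} (hABF : LinearIndependent ℝ ![A, B, F]) {L : Set R4}
    (hL : IsTame L) (h : ∀ s : ℝ, 0 ≤ s → B + s • A ∉ L) :
    ∃ η > (0 : ℝ), ∀ t : ℝ, 0 < t → ∃ H : R4 ≃ₜ R4, IsPLIso H ∧ (∀ x ∈ L, H x = x) ∧ H A = A ∧
      H B = (2 : ℝ) • A + t • (B + η • F) ∧ H '' cone A B = cone A (H B) := by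
  obtain ⟨η, hη, hthin⟩ := hL.exists_thin F 0 h
  refine ⟨η, hη, fun t ht ↦ ?_⟩
  rw [linearIndependent_three_iff] at hABF
  obtain ⟨H, hH, hfix, hHA, -, hHB, him, -⟩ := exists_elementary_move
    (A := A) (B := B) (C := A + t • (B + η • F)) (linearIndependent_three_iff.2 (by
      intro a b c habc
      obtain ⟨h1, h2, h3⟩ := hABF (a + c) (b + c * t) (c * t * η) (by rw [← habc]; module)
      have hc : c = 0 := by
        have : t * η ≠ 0 := by positivity
        rw [mul_assoc] at h3
        exact (mul_eq_zero.1 h3).resolve_right this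
      subst hc
      exact ⟨by simpa using h1, by simpa using h2, rfl⟩)) hL (by
      intro a b c ha hb hc hmem
      by_contra hbc
      refine hthin η hη.le le_rfl (a + c) b (c * t) 0 (by positivity) hb (by positivity) le_rfl ?_
        (by convert hmem using 1; module)
      by_contra! h0
      have hct : 0 ≤ c * t := by positivity
      have h1 : b = 0 := by linarith
      have h2 : c * t = 0 := by linarith
      exact hbc ⟨h1, Or.inr ((mul_eq_zero.1 h2).resolve_right ht.ne')⟩)
  have hHB' : H B = (2 : ℝ) • A + t • (B + η • F) := by rw [hHB]; module
  exact ⟨H, hH, hfix, hHA, hHB', by rw [him, hHB]⟩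

/-- The end of a segment can be moved out of a given subspace. -/
lemma exists_move_off_subspace {A B : R4} (hAB : LinearIndependent ℝ ![A, B]) {L : Set R4}
    (hL : IsTame L) (h : ∀ s : ℝ, 0 ≤ s → B + s • A ∉ L) {S : Submodule ℝ R4} (hS : S ≠ ⊤)
    (hA : A ∈ S) :
    ∃ H : R4 ≃ₜ R4, IsPLIso H ∧ (∀ x ∈ L, H x = x) ∧ H A = A ∧ H B ∉ S ∧
      H '' cone A B = cone A (H B) := by
  by_cases hB : B ∈ S
  · obtain ⟨F, hF⟩ := exists_notMem_of_ne_top hS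
    have h3 : LinearIndependent ℝ ![A, B, F] := by
      rw [linearIndependent_three_iff]
      intro a b c habc
      have hc : c = 0 := by
        by_contra hc
        refine hF ((S.smul_mem_iff hc).1 ?_)
        rw [eq_neg_of_add_eq_zero_right habc]
        exact S.neg_mem (S.add_mem (S.smul_mem _ hA) (S.smul_mem _ hB))
      subst hc
      obtain ⟨h1, h2⟩ := linearIndependent_two_iff.1 hAB a b (by simpa using habc)
      exact ⟨h1, h2, rfl⟩
    obtain ⟨η, hη, hpull⟩ := exists_pull h3 hL h
    obtain ⟨H, hH, hfix, hHA, hHB, him⟩ := hpull 1 one_pos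
    refine ⟨H, hH, hfix, hHA, fun hmem ↦ hF ((S.smul_mem_iff hη.ne').1 ?_), him⟩
    have : η • F = H B - (2 : ℝ) • A - B := by rw [hHB]; module
    rw [this]
    exact S.sub_mem (S.sub_mem hmem (S.smul_mem _ hA)) hB
  · exact ⟨Homeomorph.refl _, isPLIso_refl, fun _ _ ↦ rfl, rfl, hB, by simp⟩

/-- `IsArc A S B`: the cone `S` represents a simple polygonal arc of the sphere from `A` to `B`. -/
inductive IsArc : R4 → Set R4 → R4 → Prop
  | segment {A B : R4} : LinearIndependent ℝ ![A, B] → IsArc A (cone A B) B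
  | cons {A B C : R4} {S : Set R4} : LinearIndependent ℝ ![A, B] → IsArc B S C →
      cone A B ∩ S ⊆ ray B → IsArc A (cone A B ∪ S) C

lemma IsArc.isTame {A C : R4} {S : Set R4} (h : IsArc A S C) : IsTame S := by
  induction h with
  | segment _ => exact isTame_cone _ _
  | cons _ _ _ ih => exact (isTame_cone _ _).union ih

/-- A polygonal arc that meets the polyhedral set `Z` only in its first point can be made straight
by a homeomorphism that fixes `Z`: straighten all but the first segment, pull the result back
until the triangle at the remaining corner is thin, and move across this triangle. -/
lemma IsArc.exists_straighten {A C : R4} {S : Set R4} (h : IsArc A S C) :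
    ∀ Z : Set R4, IsTame Z → Z ∩ S ⊆ ray A →
      ∃ H : R4 ≃ₜ R4, IsPLIso H ∧ (∀ x ∈ Z, H x = x) ∧ H A = A ∧
        LinearIndependent ℝ ![A, H C] ∧ H '' S = cone A (H C) := by
  induction h with
  | segment h =>
    exact fun Z _ _ ↦ ⟨Homeomorph.refl _, isPLIso_refl, fun _ _ ↦ rfl, rfl, h, by simp⟩
  | @cons A B C S hAB hS hint ih =>
    intro Z hZ hZS
    have hZ' : IsTame (Z ∪ cone A B) := hZ.union (isTame_cone A B)
    have hdisj : (Z ∪ cone A B) ∩ S ⊆ ray B := by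
      rintro z ⟨hz | hz, hzS⟩
      · exact hint ⟨ray_subset_cone_left A B (hZS ⟨hz, Or.inr hzS⟩), hzS⟩
      · exact hint ⟨hz, hzS⟩
    obtain ⟨H₁, hH₁, hfix₁, hB₁, hBq, him₁⟩ := ih _ hZ' hdisj
    set q := H₁ C with hq
    have hqL : ∀ s : ℝ, 0 ≤ s → q + s • B ∉ Z ∪ cone A B := by
      intro s hs hmem
      have h1 : q + s • B ∈ H₁ '' S := by
        rw [him₁]
        exact ⟨s, 1, hs, zero_le_one, by module⟩
      obtain ⟨y, hy, hyq⟩ := h1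
      have h2 : y = q + s • B := H₁.injective (by rw [hyq, hfix₁ _ hmem])
      exact add_smul_notMem_ray hBq s (hdisj ⟨hmem, h2 ▸ hy⟩)
    obtain ⟨F, hF⟩ := exists_notMem_of_ne_top (span_ne_top ![A, B, q] (by norm_num))
    have hF' : ∀ a b c d : ℝ, a • A + b • B + c • q + d • F = 0 → d = 0 := by
      intro a b c d h0
      by_contra hd
      refine hF ((Submodule.smul_mem_iff _ hd).1 ?_)
      rw [eq_neg_of_add_eq_zero_right h0]
      have hm : ∀ i, ![A, B, q] i ∈ Submodule.span ℝ (Set.range ![A, B, q]) :=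
        fun i ↦ Submodule.subset_span ⟨i, rfl⟩
      exact Submodule.neg_mem _ (Submodule.add_mem _ (Submodule.add_mem _
        (Submodule.smul_mem _ _ (hm 0)) (Submodule.smul_mem _ _ (hm 1)))
        (Submodule.smul_mem _ _ (hm 2)))
    have hBqF : LinearIndependent ℝ ![B, q, F] := by
      rw [linearIndependent_three_iff]
      intro b c d h0
      have hd := hF' 0 b c d (by simpa using h0)
      subst hd
      obtain ⟨h1, h2⟩ := linearIndependent_two_iff.1 hBq b c (by simpa using h0)
      exact ⟨h1, h2, rfl⟩
    obtain ⟨η, hη, hpull⟩ := exists_pull hBqF hZ' hqL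
    obtain ⟨t, ht, hthin⟩ := hZ.exists_thin (A := A) (B := B) (q + η • F) 0 (by
      intro s hs hmem
      exact add_smul_notMem_ray hAB s
        (hZS ⟨hmem, Or.inl ⟨s, 1, hs, zero_le_one, by module⟩⟩))
    obtain ⟨H₂, hH₂, hfix₂, hB₂, hq₂, him₂⟩ := hpull (2 * t) (by positivity)
    set q' := H₂ q with hq'
    have hABq' : LinearIndependent ℝ ![A, B, q'] := by
      rw [linearIndependent_three_iff]
      intro a b c h0
      have hc : c = 0 := by
        have h1 := hF' a (b + c * 2) (c * 2 * t) (c * 2 * t * η) (by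
          rw [← h0, hq₂]; module)
        have : 2 * t * η ≠ 0 := by positivity
        rw [show c * 2 * t * η = c * (2 * t * η) by ring] at h1
        exact (mul_eq_zero.1 h1).resolve_right this
      subst hc
      obtain ⟨h1, h2⟩ := linearIndependent_two_iff.1 hAB a b (by simpa using h0)
      exact ⟨h1, h2, rfl⟩
    obtain ⟨H₃, hH₃, hfix₃, hA₃, hq₃, -, him₃, him₃'⟩ := exists_elementary_move hABq' hZ (by
      intro a b c ha hb hc hmem
      by_contra hbc
      refine hthin t ht.le le_rfl a b (2 * c) 0 ha hb (by positivity) le_rfl ?_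
        (by convert hmem using 1; rw [hq₂]; module)
      by_contra! h0
      have h1 : b = 0 := by linarith
      have h2 : c = 0 := by linarith
      exact hbc ⟨h1, Or.inr h2⟩)
    have hmem : A ∈ Z ∪ cone A B := Or.inr (ray_subset_cone_left A B (self_mem_ray A))
    have hfixcone : ∀ H : R4 ≃ₜ R4, (∀ x ∈ Z ∪ cone A B, H x = x) →
        H '' cone A B = cone A B := fun H hH ↦
      (Set.image_congr fun x hx ↦ hH x (Or.inr hx)).trans (Set.image_id _)
    refine ⟨(H₁.trans H₂).trans H₃, (hH₁.trans hH₂).trans hH₃, fun x hx ↦ ?_, ?_, ?_, ?_⟩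
    · simp [hfix₁ x (Or.inl hx), hfix₂ x (Or.inl hx), hfix₃ x hx]
    · simp [hfix₁ A hmem, hfix₂ A hmem, hA₃]
    · have : ((H₁.trans H₂).trans H₃) C = q' := by simp [← hq, ← hq', hq₃]
      rw [this, linearIndependent_two_iff]
      intro a c h0
      obtain ⟨h1, -, h2⟩ := linearIndependent_three_iff.1 hABq' a 0 c (by simpa using h0)
      exact ⟨h1, h2⟩
    · have : ((H₁.trans H₂).trans H₃) C = q' := by simp [← hq, ← hq', hq₃]
      rw [this]
      change (H₃ ∘ H₂ ∘ H₁) '' _ = _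
      rw [Set.image_comp, Set.image_comp, Set.image_union, hfixcone H₁ hfix₁, him₁,
        Set.image_union, hfixcone H₂ hfix₂, him₂,
        Set.image_union, him₃, him₃', cone_union_cone_add]

/-! ### Moves across the neighbourhood of a straight `Y` -/

lemma exists_triangle_move {A B C : R4} (hABC : LinearIndependent ℝ ![A, B, C]) {L : Set R4}
    (hL : IsTame L)
    (h : ∀ r s t : ℝ, 0 ≤ r → 0 ≤ s → 0 ≤ t → r • A + s • B + t • C ∈ L →
      s = 0 ∧ (r = 0 ∨ t = 0)) :
    ∃ H : R4 ≃ₜ R4, IsPLIso H ∧ (∀ x ∈ L, H x = x) ∧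
      H '' (cone A B ∪ cone B C) = cone A C := by
  obtain ⟨H, hH, hfix, -, -, -, h1, h2⟩ := exists_elementary_move hABC hL h
  exact ⟨H, hH, hfix, by rw [Set.image_union, h1, h2, cone_union_cone_add]⟩

/-- `K'` is the image of `K` under a piecewise linear isomorphism that fixes `L` pointwise. -/
def MovesTo (L K K' : Set R4) : Prop :=
  ∃ H : R4 ≃ₜ R4, IsPLIso H ∧ (∀ x ∈ L, H x = x) ∧ H '' K = K'

lemma MovesTo.trans {L K₁ K₂ K₃ : Set R4} (h : MovesTo L K₁ K₂) (h' : MovesTo L K₂ K₃) :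
    MovesTo L K₁ K₃ := by
  obtain ⟨H, hH, hfix, him⟩ := h
  obtain ⟨H', hH', hfix', him'⟩ := h'
  refine ⟨H.trans H', hH.trans hH', fun x hx ↦ by simp [hfix x hx, hfix' x hx], ?_⟩
  change (H' ∘ H) '' K₁ = K₃
  rw [Set.image_comp, him, him']

lemma MovesTo.symm {L K K' : Set R4} (h : MovesTo L K K') : MovesTo L K' K := by
  obtain ⟨H, hH, hfix, rfl⟩ := h
  refine ⟨H.symm, hH.symm, fun x hx ↦ ?_, ?_⟩
  · rw [Homeomorph.symm_apply_eq, hfix x hx]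
  · ext x
    simp

lemma MovesTo.union {L M K K' : Set R4} (h : MovesTo (L ∪ M) K K') :
    MovesTo L (K ∪ M) (K' ∪ M) := by
  obtain ⟨H, hH, hfix, rfl⟩ := h
  refine ⟨H, hH, fun x hx ↦ hfix x (Or.inl hx), ?_⟩
  rw [Set.image_union, Set.image_congr fun x hx ↦ hfix x (Or.inr hx), Set.image_id']

/-- The polyhedral set `L` meets the cone spanned by `A`, `B`, `B + E₁` and `B + E₂`, a
neighbourhood of the segment `AB` in a corner region, at most in the ray of `A`. -/
def IsThinAt (L : Set R4) (A B E₁ E₂ : R4) : Prop :=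
  ∀ a b c d : ℝ, 0 ≤ a → 0 ≤ b → 0 ≤ c → 0 ≤ d →
    a • A + b • B + c • (B + E₁) + d • (B + E₂) ∈ L → b = 0 ∧ c = 0 ∧ d = 0

lemma IsThinAt.swap {L : Set R4} {A B E₁ E₂ : R4} (h : IsThinAt L A B E₁ E₂) :
    IsThinAt L A B E₂ E₁ := by
  intro a b c d ha hb hc hd hmem
  obtain ⟨h1, h2, h3⟩ := h a b d c ha hb hd hc (by convert hmem using 1; module)
  exact ⟨h1, h3, h2⟩

lemma IsThinAt.mono {L M : Set R4} {A B E₁ E₂ : R4} (h : IsThinAt L A B E₁ E₂) (hM : M ⊆ L) :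
    IsThinAt M A B E₁ E₂ :=
  fun a b c d ha hb hc hd hmem ↦ h a b c d ha hb hc hd (hM hmem)

/-- The corner of the new path from `U` to `V`, close to the centre `X` of the `Y`. -/
def corner (X U V : R4) : R4 := (2 : ℝ) • X + U + V

/-- Coordinates with respect to a basis `X, U, V, W` may be compared. -/
lemma coeff_eq {X U V W : R4} (h : LinearIndependent ℝ ![X, U, V, W]) {x u v w x' u' v' w' : ℝ}
    {y y' : R4} (e : y = y') (hy : y = x • X + u • U + v • V + w • W)
    (hy' : y' = x' • X + u' • U + v' • V + w' • W) : x = x' ∧ u = u' ∧ v = v' ∧ w = w' := by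
  obtain ⟨h1, h2, h3, h4⟩ := linearIndependent_four_iff.1 h (x - x') (u - u') (v - v') (w - w')
    (by rw [hy, hy'] at e; rw [← sub_eq_zero] at e; rw [← e]; module)
  exact ⟨sub_eq_zero.1 h1, sub_eq_zero.1 h2, sub_eq_zero.1 h3, sub_eq_zero.1 h4⟩

/-- The path of `Δ` that replaces one edge is isotopic to the path through the centre of the `Y`:
cross the triangles `M X V` and `U M X`. -/
lemma movesTo_of_one_edge {X U V W : R4} (hb : LinearIndependent ℝ ![X, U, V, W]) {L : Set R4}
    (hL : IsTame L) (hU : IsThinAt L U X V W) (hV : IsThinAt L V X U W) :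
    MovesTo L (cone U (corner X U V) ∪ cone (corner X U V) V) (cone X U ∪ cone X V) := by
  set M := corner X U V with hM
  unfold corner at hM
  have m₁ : MovesTo (L ∪ cone U M) (cone M X ∪ cone X V) (cone M V) := by
    refine exists_triangle_move (linearIndependent_three_iff.2 fun r s t h0 ↦ ?_)
      (hL.union (isTame_cone _ _)) ?_
    · obtain ⟨h1, h2, h3, h4⟩ := linearIndependent_four_iff.1 hb (2 * r + s) r (r + t) 0
        (by rw [← h0, hM]; module)
      exact ⟨by linarith, by linarith, by linarith⟩
    · rintro r s t hr hs ht (h | ⟨α, β, hα, hβ, h⟩)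
      · obtain ⟨h1, h2, h3⟩ := hV (r + t) (r + s) r 0 (by positivity) (by positivity) hr le_rfl
          (by convert h using 1; rw [hM]; module)
        exact ⟨by linarith, Or.inl h2⟩
      · obtain ⟨h1, h2, h3, h4⟩ := coeff_eq hb h (x := 2 * r + s) (u := r) (v := r + t) (w := 0)
          (x' := 2 * β) (u' := α + β) (v' := β) (w' := 0) (by rw [hM]; module) (by rw [hM]; module)
        exact ⟨by linarith, Or.inr (by linarith)⟩
  have m₂ : MovesTo (L ∪ cone X V) (cone U M ∪ cone M X) (cone U X) := by
    refine exists_triangle_move (linearIndependent_three_iff.2 fun r s t h0 ↦ ?_)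
      (hL.union (isTame_cone _ _)) ?_
    · obtain ⟨h1, h2, h3, h4⟩ := linearIndependent_four_iff.1 hb (2 * s + t) (r + s) s 0
        (by rw [← h0, hM]; module)
      exact ⟨by linarith, by linarith, by linarith⟩
    · rintro r s t hr hs ht (h | ⟨α, β, hα, hβ, h⟩)
      · obtain ⟨h1, h2, h3⟩ := hU (r + s) (s + t) s 0 (by positivity) (by positivity) hs le_rfl
          (by convert h using 1; rw [hM]; module)
        exact ⟨h2, Or.inr (by linarith)⟩
      · obtain ⟨h1, h2, h3, h4⟩ := coeff_eq hb h (x := 2 * s + t) (u := r + s) (v := s) (w := 0)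
          (x' := α) (u' := 0) (v' := β) (w' := 0) (by rw [hM]; module) (by module)
        exact ⟨by linarith, Or.inl (by linarith)⟩
  have e₁ := m₁.symm.union
  have e₂ := m₂.union
  rw [cone_comm X U, Set.union_comm]
  refine e₁.trans ?_
  rwa [show cone M X ∪ cone X V ∪ cone U M = cone U M ∪ cone M X ∪ cone X V by
    rw [Set.union_comm, Set.union_assoc]]

/-- The path of `Δ` that replaces two edges is isotopic to the path through the centre of the `Y`
that joins its ends, provided nothing else is attached at its midpoint `V`: cross the triangles
`M V M'`, `M X M'`, `U M X` and `X M' W`. -/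
lemma movesTo_of_two_edges {X U V W : R4} (hb : LinearIndependent ℝ ![X, U, V, W]) {L : Set R4}
    (hL : IsTame L) (hU : IsThinAt L U X V W) (hV : IsThinAt L V X U W) (hW : IsThinAt L W X U V)
    (hVL : V ∉ L) :
    MovesTo L ((cone U (corner X U V) ∪ cone (corner X U V) V) ∪
      (cone V (corner X V W) ∪ cone (corner X V W) W)) (cone X U ∪ cone X W) := by
  set M := corner X U V with hM
  set M' := corner X V W with hM'
  unfold corner at hM hM'
  have hT : IsTame (L ∪ (cone U M ∪ cone M' W)) :=
    hL.union ((isTame_cone _ _).union (isTame_cone _ _))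
  have m₁ : MovesTo (L ∪ (cone U M ∪ cone M' W)) (cone M V ∪ cone V M') (cone M M') := by
    refine exists_triangle_move (linearIndependent_three_iff.2 fun r s t h0 ↦ ?_) hT ?_
    · obtain ⟨h1, h2, h3, h4⟩ := linearIndependent_four_iff.1 hb (2 * r + 2 * t) r (r + s + t) t
        (by rw [← h0, hM, hM']; module)
      exact ⟨by linarith, by linarith, by linarith⟩
    · rintro r s t hr hs ht (h | ⟨α, β, hα, hβ, h⟩ | ⟨α, β, hα, hβ, h⟩)
      · obtain ⟨h1, h2, h3⟩ := hV (r + s + t) (r + t) r t (by positivity) (by positivity) hr ht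
          (by convert h using 1; rw [hM, hM']; module)
        refine ⟨?_, Or.inl h2⟩
        by_contra hs0
        refine hL.smul_notMem hVL (lt_of_le_of_ne hs (Ne.symm hs0)) ?_
        simpa [h2, h3] using h
      · obtain ⟨h1, h2, h3, h4⟩ := coeff_eq hb h (x := 2 * r + 2 * t) (u := r) (v := r + s + t)
          (w := t) (x' := 2 * β) (u' := α + β) (v' := β) (w' := 0) (by rw [hM, hM']; module)
          (by rw [hM]; module)
        exact ⟨by linarith, Or.inr (by linarith)⟩
      · obtain ⟨h1, h2, h3, h4⟩ := coeff_eq hb h (x := 2 * r + 2 * t) (u := r) (v := r + s + t)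
          (w := t) (x' := 2 * α) (u' := 0) (v' := α) (w' := α + β) (by rw [hM, hM']; module)
          (by rw [hM']; module)
        exact ⟨by linarith, Or.inl (by linarith)⟩
  have m₂ : MovesTo (L ∪ (cone U M ∪ cone M' W)) (cone M X ∪ cone X M') (cone M M') := by
    refine exists_triangle_move (linearIndependent_three_iff.2 fun r s t h0 ↦ ?_) hT ?_
    · obtain ⟨h1, h2, h3, h4⟩ := linearIndependent_four_iff.1 hb (2 * r + s + 2 * t) r (r + t) t
        (by rw [← h0, hM, hM']; module)
      exact ⟨by linarith, by linarith, by linarith⟩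
    · rintro r s t hr hs ht (h | ⟨α, β, hα, hβ, h⟩ | ⟨α, β, hα, hβ, h⟩)
      · obtain ⟨h1, h2, h3⟩ := hV (r + t) (r + s + t) r t (by positivity) (by positivity) hr ht
          (by convert h using 1; rw [hM, hM']; module)
        exact ⟨by linarith, Or.inl h2⟩
      · obtain ⟨h1, h2, h3, h4⟩ := coeff_eq hb h (x := 2 * r + s + 2 * t) (u := r) (v := r + t)
          (w := t) (x' := 2 * β) (u' := α + β) (v' := β) (w' := 0) (by rw [hM, hM']; module)
          (by rw [hM]; module)
        exact ⟨by linarith, Or.inr (by linarith)⟩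
      · obtain ⟨h1, h2, h3, h4⟩ := coeff_eq hb h (x := 2 * r + s + 2 * t) (u := r) (v := r + t)
          (w := t) (x' := 2 * α) (u' := 0) (v' := α) (w' := α + β) (by rw [hM, hM']; module)
          (by rw [hM']; module)
        exact ⟨by linarith, Or.inl (by linarith)⟩
  have m₃ : MovesTo (L ∪ (cone X M' ∪ cone M' W)) (cone U M ∪ cone M X) (cone U X) := by
    refine exists_triangle_move (linearIndependent_three_iff.2 fun r s t h0 ↦ ?_)
      (hL.union ((isTame_cone _ _).union (isTame_cone _ _))) ?_
    · obtain ⟨h1, h2, h3, h4⟩ := linearIndependent_four_iff.1 hb (2 * s + t) (r + s) s 0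
        (by rw [← h0, hM]; module)
      exact ⟨by linarith, by linarith, by linarith⟩
    · rintro r s t hr hs ht (h | ⟨α, β, hα, hβ, h⟩ | ⟨α, β, hα, hβ, h⟩)
      · obtain ⟨h1, h2, h3⟩ := hU (r + s) (s + t) s 0 (by positivity) (by positivity) hs le_rfl
          (by convert h using 1; rw [hM]; module)
        exact ⟨h2, Or.inr (by linarith)⟩
      · obtain ⟨h1, h2, h3, h4⟩ := coeff_eq hb h (x := 2 * s + t) (u := r + s) (v := s) (w := 0)
          (x' := α + 2 * β) (u' := 0) (v' := β) (w' := β) (by rw [hM]; module)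
          (by rw [hM']; module)
        exact ⟨by linarith, Or.inl (by linarith)⟩
      · obtain ⟨h1, h2, h3, h4⟩ := coeff_eq hb h (x := 2 * s + t) (u := r + s) (v := s) (w := 0)
          (x' := 2 * α) (u' := 0) (v' := α) (w' := α + β) (by rw [hM]; module)
          (by rw [hM']; module)
        exact ⟨by linarith, Or.inl (by linarith)⟩
  have m₄ : MovesTo (L ∪ cone U X) (cone X M' ∪ cone M' W) (cone X W) := by
    refine exists_triangle_move (linearIndependent_three_iff.2 fun r s t h0 ↦ ?_)
      (hL.union (isTame_cone _ _)) ?_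
    · obtain ⟨h1, h2, h3, h4⟩ := linearIndependent_four_iff.1 hb (r + 2 * s) 0 s (s + t)
        (by rw [← h0, hM']; module)
      exact ⟨by linarith, by linarith, by linarith⟩
    · rintro r s t hr hs ht (h | ⟨α, β, hα, hβ, h⟩)
      · obtain ⟨h1, h2, h3⟩ := hW (s + t) (r + s) 0 s (by positivity) (by positivity) le_rfl hs
          (by convert h using 1; rw [hM']; module)
        exact ⟨h3, Or.inl (by linarith)⟩
      · obtain ⟨h1, h2, h3, h4⟩ := coeff_eq hb h (x := r + 2 * s) (u := 0) (v := s) (w := s + t)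
          (x' := β) (u' := α) (v' := 0) (w' := 0) (by rw [hM']; module) (by module)
        exact ⟨by linarith, Or.inr (by linarith)⟩
  have e₁ := m₁.union.trans m₂.symm.union
  have e₂ := m₃.union
  have e₃ := m₄.union
  rw [show cone M X ∪ cone X M' ∪ (cone U M ∪ cone M' W) =
    cone U M ∪ cone M X ∪ (cone X M' ∪ cone M' W) by ext; simp only [Set.mem_union]; tauto] at e₁
  rw [Set.union_comm (cone U X)] at e₂
  have := (e₁.trans e₂).trans e₃
  rw [cone_comm X U, Set.union_comm (cone U X)]
  rwa [show cone U M ∪ cone M V ∪ (cone V M' ∪ cone M' W) =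
    cone M V ∪ cone V M' ∪ (cone U M ∪ cone M' W) by ext; simp only [Set.mem_union]; tauto]

/-- The three paths of `Δ` form a hexagon that is isotopic, away from a set `L` that misses the
neighbourhood of the `Y`, to a triangle whose interior misses `L`. -/
lemma movesTo_of_three_edges {X U V W : R4} (hb : LinearIndependent ℝ ![X, U, V, W]) {L : Set R4}
    (hL : IsTame L) (hU : IsThinAt L U X V W) (hV : IsThinAt L V X U W) (hW : IsThinAt L W X U V)
    (hUL : U ∉ L) (hVL : V ∉ L) (hWL : W ∉ L) :
    ∃ P Q R : R4, LinearIndependent ℝ ![P, Q, R] ∧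
      (∀ r s t : ℝ, 0 ≤ r → 0 ≤ s → 0 ≤ t → r • P + s • Q + t • R ∈ L →
        r = 0 ∧ s = 0 ∧ t = 0) ∧
      MovesTo L ((cone U (corner X U V) ∪ cone (corner X U V) V) ∪
        (cone V (corner X V W) ∪ cone (corner X V W) W) ∪
        (cone W (corner X W U) ∪ cone (corner X W U) U)) (cone P Q ∪ cone Q R ∪ cone R P) := by
  set P := corner X U V with hP
  set Q := corner X V W with hQ
  set R := corner X W U with hR
  unfold corner at hP hQ hR
  have smul_eq : ∀ Y : R4, Y ∉ L → ∀ s : ℝ, 0 ≤ s → s • Y ∈ L → s = 0 := by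
    intro Y hY s hs h
    by_contra hs0
    exact hL.smul_notMem hY (lt_of_le_of_ne hs (Ne.symm hs0)) h
  have hPQR : LinearIndependent ℝ ![P, Q, R] := by
    refine linearIndependent_three_iff.2 fun r s t h0 ↦ ?_
    obtain ⟨h1, h2, h3, h4⟩ := linearIndependent_four_iff.1 hb (2 * r + 2 * s + 2 * t) (r + t)
      (r + s) (s + t) (by rw [← h0, hP, hQ, hR]; module)
    exact ⟨by linarith, by linarith, by linarith⟩
  have m₁ : MovesTo (L ∪ (cone Q W ∪ cone W R ∪ cone R U ∪ cone U P)) (cone P V ∪ cone V Q)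
      (cone P Q) := by
    refine exists_triangle_move (linearIndependent_three_iff.2 fun r s t h0 ↦ ?_)
      (hL.union ((((isTame_cone _ _).union (isTame_cone _ _)).union (isTame_cone _ _)).union
        (isTame_cone _ _))) ?_
    · obtain ⟨h1, h2, h3, h4⟩ := linearIndependent_four_iff.1 hb (2 * r + 2 * t) r (r + s + t) t
        (by rw [← h0, hP, hQ]; module)
      exact ⟨by linarith, by linarith, by linarith⟩
    · intro r s t hr hs ht h
      have key : r • P + s • V + t • Q =
        (2 * r + 2 * t) • X + r • U + (r + s + t) • V + t • W := by rw [hP, hQ]; module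
      rcases h with h | ((⟨α, β, hα, hβ, h⟩ | ⟨α, β, hα, hβ, h⟩) | ⟨α, β, hα, hβ, h⟩) |
        ⟨α, β, hα, hβ, h⟩
      · obtain ⟨h1, h2, h3⟩ := hV (r + s + t) (r + t) r t (by positivity) (by positivity) hr ht
          (by convert h using 1; rw [hP, hQ]; module)
        exact ⟨smul_eq V hVL s hs (by simpa [h2, h3] using h), Or.inl h2⟩
      · obtain ⟨h1, h2, h3, h4⟩ := coeff_eq hb h key (x' := 2 * α) (u' := 0) (v' := α)
          (w' := α + β) (by rw [hQ]; module)
        exact ⟨by linarith, Or.inl (by linarith)⟩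
      · obtain ⟨h1, h2, h3, h4⟩ := coeff_eq hb h key (x' := 2 * β) (u' := β) (v' := 0)
          (w' := α + β) (by rw [hR]; module)
        exact ⟨by linarith, Or.inl (by linarith)⟩
      · obtain ⟨h1, h2, h3, h4⟩ := coeff_eq hb h key (x' := 2 * α) (u' := α + β) (v' := 0)
          (w' := α) (by rw [hR]; module)
        exact ⟨by linarith, Or.inl (by linarith)⟩
      · obtain ⟨h1, h2, h3, h4⟩ := coeff_eq hb h key (x' := 2 * β) (u' := α + β) (v' := β)
          (w' := 0) (by rw [hP]; module)
        exact ⟨by linarith, Or.inr (by linarith)⟩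
  have m₂ : MovesTo (L ∪ (cone R U ∪ cone U P ∪ cone P Q)) (cone Q W ∪ cone W R)
      (cone Q R) := by
    refine exists_triangle_move (linearIndependent_three_iff.2 fun r s t h0 ↦ ?_)
      (hL.union (((isTame_cone _ _).union (isTame_cone _ _)).union (isTame_cone _ _))) ?_
    · obtain ⟨h1, h2, h3, h4⟩ := linearIndependent_four_iff.1 hb (2 * r + 2 * t) t r (r + s + t)
        (by rw [← h0, hQ, hR]; module)
      exact ⟨by linarith, by linarith, by linarith⟩
    · intro r s t hr hs ht h
      have key : r • Q + s • W + t • R =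
        (2 * r + 2 * t) • X + t • U + r • V + (r + s + t) • W := by rw [hQ, hR]; module
      rcases h with h | (⟨α, β, hα, hβ, h⟩ | ⟨α, β, hα, hβ, h⟩) | ⟨α, β, hα, hβ, h⟩
      · obtain ⟨h1, h2, h3⟩ := hW (r + s + t) (r + t) t r (by positivity) (by positivity) ht hr
          (by convert h using 1; rw [hQ, hR]; module)
        exact ⟨smul_eq W hWL s hs (by simpa [h2, h3] using h), Or.inl h3⟩
      · obtain ⟨h1, h2, h3, h4⟩ := coeff_eq hb h key (x' := 2 * α) (u' := α + β) (v' := 0)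
          (w' := α) (by rw [hR]; module)
        exact ⟨by linarith, Or.inl (by linarith)⟩
      · obtain ⟨h1, h2, h3, h4⟩ := coeff_eq hb h key (x' := 2 * β) (u' := α + β) (v' := β)
          (w' := 0) (by rw [hP]; module)
        exact ⟨by linarith, Or.inr (by linarith)⟩
      · obtain ⟨h1, h2, h3, h4⟩ := coeff_eq hb h key (x' := 2 * α + 2 * β) (u' := α)
          (v' := α + β) (w' := β) (by rw [hP, hQ]; module)
        exact ⟨by linarith, Or.inr (by linarith)⟩
  have m₃ : MovesTo (L ∪ (cone P Q ∪ cone Q R)) (cone R U ∪ cone U P) (cone R P) := by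
    refine exists_triangle_move (linearIndependent_three_iff.2 fun r s t h0 ↦ ?_)
      (hL.union ((isTame_cone _ _).union (isTame_cone _ _))) ?_
    · obtain ⟨h1, h2, h3, h4⟩ := linearIndependent_four_iff.1 hb (2 * r + 2 * t) (r + s + t) t r
        (by rw [← h0, hR, hP]; module)
      exact ⟨by linarith, by linarith, by linarith⟩
    · intro r s t hr hs ht h
      have key : r • R + s • U + t • P =
        (2 * r + 2 * t) • X + (r + s + t) • U + t • V + r • W := by rw [hR, hP]; module
      rcases h with h | ⟨α, β, hα, hβ, h⟩ | ⟨α, β, hα, hβ, h⟩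
      · obtain ⟨h1, h2, h3⟩ := hU (r + s + t) (r + t) t r (by positivity) (by positivity) ht hr
          (by convert h using 1; rw [hR, hP]; module)
        exact ⟨smul_eq U hUL s hs (by simpa [h2, h3] using h), Or.inl h3⟩
      · obtain ⟨h1, h2, h3, h4⟩ := coeff_eq hb h key (x' := 2 * α + 2 * β) (u' := α)
          (v' := α + β) (w' := β) (by rw [hP, hQ]; module)
        exact ⟨by linarith, Or.inl (by linarith)⟩
      · obtain ⟨h1, h2, h3, h4⟩ := coeff_eq hb h key (x' := 2 * α + 2 * β) (u' := β)
          (v' := α) (w' := α + β) (by rw [hQ, hR]; module)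
        exact ⟨by linarith, Or.inr (by linarith)⟩
  refine ⟨P, Q, R, hPQR, fun r s t hr hs ht h ↦ ?_, ?_⟩
  · obtain ⟨h1, h2, h3⟩ := hU (r + t) (r + t) (r + s) (s + t) (by positivity) (by positivity)
      (by positivity) (by positivity) (by convert h using 1; rw [hP, hQ, hR]; module)
    exact ⟨by linarith, by linarith, by linarith⟩
  · have e₁ := m₁.union
    have e₂ := m₂.union
    have e₃ := m₃.union
    rw [show cone P Q ∪ (cone Q W ∪ cone W R ∪ cone R U ∪ cone U P) =
      cone Q W ∪ cone W R ∪ (cone R U ∪ cone U P ∪ cone P Q) by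
        ext; simp only [Set.mem_union]; tauto] at e₁
    rw [show cone Q R ∪ (cone R U ∪ cone U P ∪ cone P Q) =
      cone R U ∪ cone U P ∪ (cone P Q ∪ cone Q R) by
        ext; simp only [Set.mem_union]; tauto] at e₂
    have := (e₁.trans e₂).trans e₃
    rw [Set.union_comm (cone R P)] at this
    rwa [show cone U P ∪ cone P V ∪ (cone V Q ∪ cone Q W) ∪ (cone W R ∪ cone R U) =
      cone P V ∪ cone V Q ∪ (cone Q W ∪ cone W R ∪ cone R U ∪ cone U P) by
        ext; simp only [Set.mem_union]; tauto]

/-! ### Triangles are trivial and split off -/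

/-- Folding: a convex polyhedral cone `{x | ∀ i, 0 ≤ l i x}` with interior point `d` is carried to
the half-space `0 ≤ m`, along the direction `d`. -/
lemma exists_fold {n : ℕ} (l : Fin (n + 1) → R4 →ₗ[ℝ] ℝ) (d : R4) (hd : ∀ i, 0 < l i d)
    (m : R4 →ₗ[ℝ] ℝ) (hm : m d = 1) :
    ∃ H : R4 ≃ₜ R4, IsPLIso H ∧ (∀ x, ∃ r : ℝ, H x = x + r • d) ∧
      (∀ x, 0 < m (H x) ↔ ∀ i, 0 < l i x) ∧ (∀ x, 0 ≤ m (H x) ↔ ∀ i, 0 ≤ l i x) := by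
  let l' : Fin (n + 1) → R4 →ₗ[ℝ] ℝ := fun i ↦ (l i d)⁻¹ • l i
  let T : R4 → ℝ := fun x ↦ Finset.univ.inf' Finset.univ_nonempty (fun i ↦ l' i x)
  have hT : ∀ x (s : ℝ), T (x + s • d) = T x + s := by
    intro x s
    have h1 : ∀ i, l' i (x + s • d) = l' i x + s := fun i ↦ by
      simp [l', mul_add, mul_comm s, inv_mul_cancel_left₀ (hd i).ne']
    simp only [T, h1]
    exact (Finset.apply_inf'_eq_inf'_comp Finset.univ_nonempty (fun y ↦ y + s)
      fun a b ↦ (min_add_add_right a b s).symm).symm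
  have hTPL : IsPLFun T := isPLFun_inf' l'
  have hTC : Continuous T := continuous_inf'_linear l'
  have hmC : Continuous m := m.continuous_of_finiteDimensional
  obtain ⟨H, hH, hHx⟩ := exists_shear (φ := fun x ↦ T x - m x) (ψ := fun x ↦ m x - T x) (d := d)
    (hTPL.sub_linear m) (hTPL.linear_sub m) (hTC.sub hmC) (hmC.sub hTC)
    (fun r x hr ↦ by
      simp only [T]
      rw [inf'_smul _ hr, map_smul, smul_eq_mul, mul_sub])
    (fun x ↦ by
      simp only [hT, map_add, map_smul, hm, smul_eq_mul]
      ring)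
    (fun x ↦ by
      simp only [hT, map_add, map_smul, hm, smul_eq_mul]
      ring)
  have hmH : ∀ x, m (H x) = T x := fun x ↦ by
    rw [hHx]
    simp [hm]
  refine ⟨H, hH, fun x ↦ ⟨_, hHx x⟩, fun x ↦ ?_, fun x ↦ ?_⟩
  · rw [hmH, Finset.lt_inf'_iff]
    refine ⟨fun h i ↦ ?_, fun h i _ ↦ ?_⟩
    · have := h i (Finset.mem_univ i)
      simp only [l', LinearMap.smul_apply, smul_eq_mul] at this
      exact (pos_iff_pos_of_mul_pos this).1 (inv_pos.2 (hd i))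
    · simp only [l', LinearMap.smul_apply, smul_eq_mul]
      exact mul_pos (inv_pos.2 (hd i)) (h i)
  · rw [hmH, Finset.le_inf'_iff]
    refine ⟨fun h i ↦ ?_, fun h i _ ↦ ?_⟩
    · have := h i (Finset.mem_univ i)
      simp only [l', LinearMap.smul_apply, smul_eq_mul] at this
      exact nonneg_of_mul_nonneg_right this (inv_pos.2 (hd i))
    · simp only [l', LinearMap.smul_apply, smul_eq_mul]
      exact mul_nonneg (inv_pos.2 (hd i)).le (h i)

lemma exists_linear_iso (f : Fin 4 → R4 →ₗ[ℝ] ℝ) (hf : ∀ x, (∀ i, f i x = 0) → x = 0) :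
    ∃ A : R4 ≃L[ℝ] R4, ∀ x i, A x i = f i x := by
  let A₀ : R4 →ₗ[ℝ] R4 := (WithLp.linearEquiv 2 ℝ (Fin 4 → ℝ)).symm.toLinearMap ∘ₗ LinearMap.pi f
  have hA : ∀ x i, A₀ x i = f i x := fun x i ↦ rfl
  have hinj : Function.Injective A₀ := by
    rw [injective_iff_map_eq_zero]
    exact fun x hx ↦ hf x fun i ↦ by rw [← hA, hx]; rfl
  exact ⟨(LinearEquiv.ofInjectiveEndo A₀ hinj).toContinuousLinearEquiv, fun x i ↦ hA x i⟩

/-- The boundary of a triangle is a trivial knot. -/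
lemma exists_triangle_to_greatCircle {P Q R : R4} (h : LinearIndependent ℝ ![P, Q, R]) :
    ∃ H : R4 ≃ₜ R4, IsPLIso H ∧
      H '' (cone P Q ∪ cone Q R ∪ cone R P) = {x | x 2 = 0 ∧ x 3 = 0} := by
  obtain ⟨E, hE⟩ := exists_linearIndependent_four h
  obtain ⟨p, q, r, e, ⟨pP, pQ, pR, pE⟩, ⟨qP, qQ, qR, qE⟩, ⟨rP, rQ, rR, rE⟩, ⟨eP, eQ, eR, eE⟩, hx⟩ :=
    exists_coords hE
  obtain ⟨H, hH, hHd, hpos, hnonneg⟩ := exists_fold ![p, q, r] (P + Q + R)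
    (by simp [Fin.forall_fin_succ, pP, pQ, pR, qP, qQ, qR, rP, rQ, rR])
    ((1 / 3 : ℝ) • (p + q + r)) (by simp [pP, pQ, pR, qP, qQ, qR, rP, rQ, rR]; norm_num)
  set m : R4 →ₗ[ℝ] ℝ := (1 / 3 : ℝ) • (p + q + r) with hm
  have hmx : ∀ x, m x = (p x + q x + r x) / 3 := fun x ↦ by simp [hm]; ring
  have heH : ∀ x, e (H x) = e x := fun x ↦ by
    obtain ⟨s, hs⟩ := hHd x
    simp [hs, eP, eQ, eR]
  simp only [Fin.forall_fin_succ, Fin.isValue, Matrix.cons_val_zero, Matrix.cons_val_succ,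
    Matrix.cons_val_fin_one, IsEmpty.forall_iff, and_true] at hpos hnonneg
  obtain ⟨A, hA⟩ := exists_linear_iso ![p, q, m, e] (by
    intro x h0
    have h0p : p x = 0 := h0 0
    have h0q : q x = 0 := h0 1
    have h0m : m x = 0 := h0 2
    have h0e : e x = 0 := h0 3
    rw [hmx] at h0m
    rw [hx x, h0p, h0q, h0e, show r x = 0 by linarith]
    simp)
  refine ⟨H.trans A.toHomeomorph, hH.trans (isPLIso_linear A), ?_⟩
  have hmem : ∀ x, x ∈ cone P Q ∪ cone Q R ∪ cone R P ↔ m (H x) = 0 ∧ e (H x) = 0 := by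
    intro x
    rw [heH]
    constructor
    · intro hxm
      have : e x = 0 ∧ (0 ≤ p x ∧ 0 ≤ q x ∧ 0 ≤ r x) ∧ (p x = 0 ∨ q x = 0 ∨ r x = 0) := by
        rcases hxm with (⟨s, t, hs, ht, rfl⟩ | ⟨s, t, hs, ht, rfl⟩) | ⟨s, t, hs, ht, rfl⟩ <;>
          simp [pP, pQ, pR, qP, qQ, qR, rP, rQ, rR, eP, eQ, eR, hs, ht]
      refine ⟨le_antisymm (not_lt.1 fun hlt ↦ ?_) ((hnonneg x).2 this.2.1), this.1⟩
      obtain ⟨h1, h2, h3⟩ := (hpos x).1 hlt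
      rcases this.2.2 with h | h | h <;> linarith
    · rintro ⟨h1, h2⟩
      obtain ⟨h3, h4, h5⟩ := (hnonneg x).1 h1.ge
      have hxe := hx x
      rw [h2, zero_smul, add_zero] at hxe
      by_cases h6 : p x = 0
      · exact Or.inl (Or.inr ⟨q x, r x, h4, h5, by rw [h6] at hxe; simpa using hxe⟩)
      by_cases h7 : q x = 0
      · exact Or.inr ⟨r x, p x, h5, h3, by rw [h7] at hxe; rw [add_comm]; simpa using hxe⟩
      by_cases h8 : r x = 0
      · exact Or.inl (Or.inl ⟨p x, q x, h3, h4, by rw [h8] at hxe; simpa using hxe⟩)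
      have := (hpos x).2 ⟨lt_of_le_of_ne h3 (Ne.symm h6), lt_of_le_of_ne h4 (Ne.symm h7),
        lt_of_le_of_ne h5 (Ne.symm h8)⟩
      exact absurd h1 this.ne'
  ext y
  constructor
  · rintro ⟨x, hxm, rfl⟩
    obtain ⟨h1, h2⟩ := (hmem x).1 hxm
    exact ⟨(hA (H x) 2).trans h1, (hA (H x) 3).trans h2⟩
  · rintro ⟨h1, h2⟩
    refine ⟨H.symm (A.symm y), (hmem _).2 ?_, by simp⟩
    have h3 := hA (A.symm y) 2
    have h4 := hA (A.symm y) 3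
    simp only [ContinuousLinearEquiv.apply_symm_apply, h1, h2] at h3 h4
    rw [H.apply_symm_apply]
    exact ⟨h3.symm, h4.symm⟩

/-- A triangle is separated by a sphere from every polyhedral set disjoint from it. -/
lemma exists_triangle_split {P Q R : R4} (h : LinearIndependent ℝ ![P, Q, R]) {L : Set R4}
    (hL : IsTame L) (hPQR : ∀ r s t : ℝ, 0 ≤ r → 0 ≤ s → 0 ≤ t → r • P + s • Q + t • R ∈ L →
      r = 0 ∧ s = 0 ∧ t = 0) :
    ∃ H : R4 ≃ₜ R4, IsPLIso H ∧
      (∀ x ∈ cone P Q ∪ cone Q R ∪ cone R P, x ≠ 0 → 0 < H x 3) ∧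
      ∀ x ∈ L, x ≠ 0 → H x 3 < 0 := by
  obtain ⟨E, hE⟩ := exists_linearIndependent_four h
  obtain ⟨p, q, r, e, ⟨pP, pQ, pR, pE⟩, ⟨qP, qQ, qR, qE⟩, ⟨rP, rQ, rR, rE⟩, ⟨eP, eQ, eR, eE⟩, hx⟩ :=
    exists_coords hE
  let d := P + Q + R
  have hS : IsCompact ((fun c : Fin 3 → ℝ ↦ c 0 • P + c 1 • Q + c 2 • R) '' stdSimplex ℝ (Fin 3)) :=
    (isCompact_stdSimplex ℝ (Fin 3)).image (by fun_prop)
  obtain ⟨ε, hε, hthick⟩ := hL.exists_thickening hS (A := 0) (by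
    rintro _ ⟨c, ⟨hc0, hc1⟩, rfl⟩ s - hmem
    obtain ⟨h1, h2, h3⟩ := hPQR (c 0) (c 1) (c 2) (hc0 0) (hc0 1) (hc0 2) (by simpa using hmem)
    simp [Fin.sum_univ_three, h1, h2, h3] at hc1)
  -- A thin neighbourhood of the triangle, whose complement contains `L`.
  set δ := ε / 2 / (‖d‖ + ‖E‖ + 1) with hδ'
  have hδ : 0 < δ := by positivity
  let σ : R4 →ₗ[ℝ] ℝ := p + q + r
  obtain ⟨H, hH, hHd, hpos, hnonneg⟩ := exists_fold
    ![p + δ • σ, q + δ • σ, r + δ • σ, δ • σ - e, δ • σ + e] d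
    (by
      simp [Fin.forall_fin_succ, σ, d, pP, pQ, pR, qP, qQ, qR, rP, rQ, rR, eP, eQ, eR]
      refine ⟨?_, ?_, ?_, ?_⟩ <;> positivity)
    ((1 / 3 : ℝ) • σ) (by simp [σ, d, pP, pQ, pR, qP, qQ, qR, rP, rQ, rR]; norm_num)
  simp only [Fin.forall_fin_succ, Fin.isValue, Matrix.cons_val_zero, Matrix.cons_val_succ,
    Matrix.cons_val_fin_one, IsEmpty.forall_iff, and_true, LinearMap.add_apply,
    LinearMap.sub_apply, LinearMap.smul_apply, smul_eq_mul] at hpos hnonneg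
  have hσx : ∀ x, σ x = p x + q x + r x := fun x ↦ rfl
  obtain ⟨A, hA⟩ := exists_linear_iso ![p, q, e, (1 / 3 : ℝ) • σ] (by
    intro x h0
    have h0p : p x = 0 := h0 0
    have h0q : q x = 0 := h0 1
    have h0e : e x = 0 := h0 2
    have h0m : (1 / 3 : ℝ) * σ x = 0 := h0 3
    rw [hσx] at h0m
    rw [hx x, h0p, h0q, h0e, show r x = 0 by linarith]
    simp)
  have hA3 : ∀ x, (H.trans A.toHomeomorph) x 3 = (1 / 3 : ℝ) * σ (H x) := fun x ↦ hA (H x) 3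
  refine ⟨H.trans A.toHomeomorph, hH.trans (isPLIso_linear A), fun x hxm hx0 ↦ ?_,
    fun x hxL hx0 ↦ ?_⟩
  · rw [hA3, hpos]
    have : e x = 0 ∧ 0 ≤ p x ∧ 0 ≤ q x ∧ 0 ≤ r x := by
      rcases hxm with (⟨s, t, hs, ht, rfl⟩ | ⟨s, t, hs, ht, rfl⟩) | ⟨s, t, hs, ht, rfl⟩ <;>
        simp [pP, pQ, pR, qP, qQ, qR, rP, rQ, rR, eP, eQ, eR, hs, ht]
    obtain ⟨he, hp, hq, hr⟩ := this
    have hσ : 0 < σ x := by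
      rw [hσx]
      by_contra! h0
      apply hx0
      rw [hx x, he, show p x = 0 by linarith, show q x = 0 by linarith, show r x = 0 by linarith]
      simp
    have := mul_pos hδ hσ
    refine ⟨?_, ?_, ?_, ?_, ?_⟩ <;> linarith
  · rw [hA3]
    by_contra! hge
    rw [hnonneg] at hge
    obtain ⟨h1, h2, h3, h4, h5⟩ := hge
    have hσ0 : 0 ≤ σ x := by
      have := hσx x
      nlinarith
    have hσ : 0 < σ x := by
      refine lt_of_le_of_ne hσ0 fun h0 ↦ hx0 ?_
      rw [← h0] at h1 h2 h3 h4 h5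
      have := hσx x
      rw [hx x, show e x = 0 by linarith, show p x = 0 by linarith, show q x = 0 by linarith,
        show r x = 0 by linarith]
      simp
    set k := (1 + 3 * δ) * σ x with hk
    have hk0 : 0 < k := by positivity
    refine hL.smul_notMem (hthick _ ⟨![(p x + δ * σ x) / k, (q x + δ * σ x) / k,
      (r x + δ * σ x) / k], ⟨?_, ?_⟩, rfl⟩ ((-(δ * σ x) / k) • d + (e x / k) • E) ?_ 0 le_rfl) hk0
      ?_
    · simp only [Fin.forall_fin_succ, Fin.isValue, Matrix.cons_val_zero, Matrix.cons_val_succ,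
        Matrix.cons_val_fin_one, IsEmpty.forall_iff, and_true]
      exact ⟨by positivity, by positivity, by positivity⟩
    · simp only [Fin.sum_univ_three, Matrix.cons_val]
      rw [← add_div, ← add_div, div_eq_one_iff_eq hk0.ne', hk]
      have := hσx x
      linarith
    · have hk1 : σ x ≤ k := by nlinarith
      have h6 : |-(δ * σ x) / k| ≤ δ := by
        rw [abs_div, abs_neg, abs_of_pos hk0, abs_of_pos (by positivity), div_le_iff₀ hk0]
        gcongr
      have h7 : |e x / k| ≤ δ := by
        rw [abs_div, abs_of_pos hk0, div_le_iff₀ hk0]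
        exact (abs_le.2 ⟨by linarith, by linarith⟩ : |e x| ≤ δ * σ x).trans (by gcongr)
      calc _ ≤ |-(δ * σ x) / k| * ‖d‖ + |e x / k| * ‖E‖ := by
            refine (norm_add_le _ _).trans ?_
            rw [norm_smul, norm_smul, Real.norm_eq_abs, Real.norm_eq_abs]
        _ ≤ δ * ‖d‖ + δ * ‖E‖ := by gcongr
        _ < ε := by
          have : δ * (‖d‖ + ‖E‖ + 1) = ε / 2 := div_mul_cancel₀ _ (by positivity)
          nlinarith
    · convert hxL using 1
      simp only [smul_add, smul_smul, Matrix.cons_val, mul_div_cancel₀ _ hk0.ne', smul_zero,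
        add_zero]
      conv_rhs => rw [hx x]
      simp only [d]
      module

/-! ### Cones over subsets of the sphere -/

/-- The cone from the origin over a subset of the sphere. -/
def coneOver (K : Set S3) : Set R4 := {x | ∃ y ∈ K, ∃ r : ℝ, 0 ≤ r ∧ x = r • (y : R4)}

lemma S3.norm_eq (x : S3) : ‖(x : R4)‖ = 1 := by simp

lemma S3.ne_zero (x : S3) : (x : R4) ≠ 0 := fun h ↦ by
  have := S3.norm_eq x
  simp [h] at this

lemma S3.eq_of_smul_eq {x y : S3} {r s : ℝ} (hr : 0 < r) (hs : 0 ≤ s)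
    (h : r • (x : R4) = s • (y : R4)) : x = y ∧ r = s := by
  have h1 : r = s := by
    have := congrArg norm h
    rwa [norm_smul, norm_smul, S3.norm_eq, S3.norm_eq, mul_one, mul_one, Real.norm_of_nonneg hr.le,
      Real.norm_of_nonneg hs] at this
  subst h1
  exact ⟨Subtype.ext (smul_right_injective R4 hr.ne' h), rfl⟩

lemma mem_coneOver {K : Set S3} {x : S3} : (x : R4) ∈ coneOver K ↔ x ∈ K := by
  constructor
  · rintro ⟨y, hy, r, hr, h⟩
    have h1 : (1 : ℝ) • (x : R4) = r • (y : R4) := (one_smul ℝ _).trans h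
    rwa [(S3.eq_of_smul_eq one_pos hr h1).1]
  · exact fun hx ↦ ⟨x, hx, 1, zero_le_one, by simp⟩

lemma coneOver_mono {K L : Set S3} (h : K ⊆ L) : coneOver K ⊆ coneOver L :=
  fun _ ⟨y, hy, hr⟩ ↦ ⟨y, h hy, hr⟩

lemma coneOver_union (K L : Set S3) : coneOver (K ∪ L) = coneOver K ∪ coneOver L := by
  ext x
  constructor
  · rintro ⟨y, hy | hy, hr⟩
    exacts [Or.inl ⟨y, hy, hr⟩, Or.inr ⟨y, hy, hr⟩]
  · rintro (⟨y, hy, hr⟩ | ⟨y, hy, hr⟩)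
    exacts [⟨y, Or.inl hy, hr⟩, ⟨y, Or.inr hy, hr⟩]

lemma coneOver_biUnion {ι : Type*} (S : Set ι) (K : ι → Set S3) :
    coneOver (⋃ i ∈ S, K i) = ⋃ i ∈ S, coneOver (K i) := by
  ext x
  simp only [Set.mem_iUnion, exists_prop]
  constructor
  · rintro ⟨y, hy, hr⟩
    simp only [Set.mem_iUnion, exists_prop] at hy
    obtain ⟨i, hi, hy⟩ := hy
    exact ⟨i, hi, y, hy, hr⟩
  · rintro ⟨i, hi, y, hy, hr⟩
    exact ⟨y, by simp only [Set.mem_iUnion, exists_prop]; exact ⟨i, hi, hy⟩, hr⟩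

lemma coneOver_singleton (y : S3) : coneOver {y} = ray (y : R4) := by
  ext x
  constructor
  · rintro ⟨_, rfl, r, hr, h⟩
    exact ⟨r, hr, h⟩
  · rintro ⟨r, hr, h⟩
    exact ⟨y, rfl, r, hr, h⟩

lemma coneOver_inter_subset {K L : Set S3} {y : S3} (h : K ∩ L ⊆ {y}) :
    coneOver K ∩ coneOver L ⊆ ray (y : R4) := by
  rintro _ ⟨⟨k, hk, r, hr, rfl⟩, l, hl, s, hs, hrs⟩
  rcases hr.eq_or_lt with rfl | hr'
  · rw [zero_smul]
    exact zero_mem_ray _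
  · have h1 := (S3.eq_of_smul_eq hr' hs hrs).1
    subst h1
    have h2 : k = y := h ⟨hk, hl⟩
    subst h2
    exact ⟨r, hr, rfl⟩

lemma coneOver_injective : Function.Injective coneOver := fun K L h ↦ by
  ext x
  rw [← mem_coneOver, h, mem_coneOver]

/-! ### Homeomorphisms of the sphere -/

lemma IsPLIso.ne_zero {H : R4 ≃ₜ R4} (h : IsPLIso H) {x : R4} (hx : x ≠ 0) : H x ≠ 0 :=
  fun h0 ↦ hx (H.injective (by rw [h0, h.map_zero]))

/-- The homeomorphism of the sphere induced by a piecewise linear isomorphism of `ℝ⁴`. -/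
noncomputable def IsPLIso.sphere {H : R4 ≃ₜ R4} (h : IsPLIso H) : S3 ≃ₜ S3 where
  toFun x := ⟨‖H x‖⁻¹ • H x, by
    simp [norm_smul, inv_mul_cancel₀ (norm_ne_zero_iff.2 (h.ne_zero x.ne_zero))]⟩
  invFun x := ⟨‖H.symm x‖⁻¹ • H.symm x, by
    simp [norm_smul, inv_mul_cancel₀ (norm_ne_zero_iff.2 (h.symm.ne_zero x.ne_zero))]⟩
  left_inv x := by
    apply Subtype.ext
    have h1 : 0 < ‖H x‖ := norm_pos_iff.2 (h.ne_zero x.ne_zero)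
    simp only [h.symm.1 _ _ (inv_nonneg.2 h1.le), H.symm_apply_apply, norm_smul, S3.norm_eq]
    rw [smul_smul, Real.norm_of_nonneg (inv_nonneg.2 h1.le)]
    simp [h1.ne']
  right_inv x := by
    apply Subtype.ext
    have h1 : 0 < ‖H.symm x‖ := norm_pos_iff.2 (h.symm.ne_zero x.ne_zero)
    simp only [h.1 _ _ (inv_nonneg.2 h1.le), H.apply_symm_apply, norm_smul, S3.norm_eq]
    rw [smul_smul, Real.norm_of_nonneg (inv_nonneg.2 h1.le)]
    simp [h1.ne']
  continuous_toFun := by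
    have : Continuous fun x : S3 ↦ H x := H.continuous.comp continuous_subtype_val
    exact ((this.norm.inv₀ fun x ↦ norm_ne_zero_iff.2 (h.ne_zero x.ne_zero)).smul this).subtype_mk _
  continuous_invFun := by
    have : Continuous fun x : S3 ↦ H.symm x := H.symm.continuous.comp continuous_subtype_val
    exact ((this.norm.inv₀ fun x ↦
      norm_ne_zero_iff.2 (h.symm.ne_zero x.ne_zero)).smul this).subtype_mk _

lemma IsPLIso.apply_eq {H : R4 ≃ₜ R4} (h : IsPLIso H) (x : S3) :
    H x = ‖H x‖ • (h.sphere x : R4) := by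
  change _ = ‖H x‖ • (‖H x‖⁻¹ • H x)
  rw [smul_smul, mul_inv_cancel₀ (norm_ne_zero_iff.2 (h.ne_zero x.ne_zero)), one_smul]

lemma IsPLIso.norm_pos {H : R4 ≃ₜ R4} (h : IsPLIso H) (x : S3) : 0 < ‖H x‖ :=
  norm_pos_iff.2 (h.ne_zero x.ne_zero)

lemma IsPLIso.isPLHomeo {H : R4 ≃ₜ R4} (h : IsPLIso H) : IsPLHomeo h.sphere :=
  ⟨H, h.1, h.2.1, h.2.2, fun x ↦ ⟨‖H x‖, h.norm_pos x, h.apply_eq x⟩⟩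

lemma IsPLHomeo.trans {h k : S3 ≃ₜ S3} (hh : IsPLHomeo h) (hk : IsPLHomeo k) :
    IsPLHomeo (h.trans k) := by
  obtain ⟨H, h1, h2, h3, h4⟩ := hh
  obtain ⟨K, k1, k2, k3, k4⟩ := hk
  obtain ⟨t1, t2, t3⟩ := IsPLIso.trans (H := H) (K := K) ⟨h1, h2, h3⟩ ⟨k1, k2, k3⟩
  refine ⟨H.trans K, t1, t2, t3, fun x ↦ ?_⟩
  obtain ⟨r, hr, hx⟩ := h4 x
  obtain ⟨s, hs, hx'⟩ := k4 (h x)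
  refine ⟨r * s, mul_pos hr hs, ?_⟩
  simp [hx, k1 r _ hr.le, hx', smul_smul]

lemma IsPLIso.coneOver_image {H : R4 ≃ₜ R4} (h : IsPLIso H) (K : Set S3) :
    coneOver (h.sphere '' K) = H '' coneOver K := by
  ext x
  constructor
  · rintro ⟨_, ⟨y, hy, rfl⟩, r, hr, rfl⟩
    refine ⟨(r * ‖H y‖⁻¹) • (y : R4), ⟨y, hy, _, mul_nonneg hr (inv_nonneg.2 (h.norm_pos y).le),
      rfl⟩, ?_⟩
    rw [h.1 _ _ (mul_nonneg hr (inv_nonneg.2 (h.norm_pos y).le)), h.apply_eq y, smul_smul,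
      ← h.apply_eq y, mul_assoc, inv_mul_cancel₀ (h.norm_pos y).ne', mul_one]
  · rintro ⟨_, ⟨y, hy, r, hr, rfl⟩, rfl⟩
    refine ⟨h.sphere y, ⟨y, hy, rfl⟩, r * ‖H y‖, mul_nonneg hr (h.norm_pos y).le, ?_⟩
    rw [h.1 _ _ hr, mul_smul, ← h.apply_eq]

lemma IsPLIso.sphere_image_eq {H : R4 ≃ₜ R4} (h : IsPLIso H) {K K' : Set S3}
    (hK : H '' coneOver K = coneOver K') : h.sphere '' K = K' :=
  coneOver_injective ((h.coneOver_image K).trans hK)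

lemma isTrivialKnot_of_image {H : R4 ≃ₜ R4} (h : IsPLIso H) {K : Set S3}
    (hK : H '' coneOver K = {x | x 2 = 0 ∧ x 3 = 0}) : IsTrivialKnot K := by
  refine ⟨h.sphere, h.isPLHomeo, h.sphere_image_eq (hK.trans ?_)⟩
  ext x
  constructor
  · rintro ⟨h2, h3⟩
    rcases eq_or_ne x 0 with rfl | hx
    · exact ⟨⟨EuclideanSpace.single 0 1, by simp⟩, by simp [greatCircle], 0, le_rfl, by simp⟩
    · refine ⟨⟨‖x‖⁻¹ • x, by simp [norm_smul, hx]⟩, by simp [greatCircle, h2, h3], ‖x‖,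
        norm_nonneg x, ?_⟩
      rw [smul_smul, mul_inv_cancel₀ (norm_ne_zero_iff.2 hx), one_smul]
  · rintro ⟨y, ⟨h2, h3⟩, r, hr, rfl⟩
    simp [h2, h3]

lemma IsTrivialKnot.of_image {H : R4 ≃ₜ R4} (h : IsPLIso H) {K K' : Set S3}
    (hK : H '' coneOver K = coneOver K') (hK' : IsTrivialKnot K') : IsTrivialKnot K := by
  obtain ⟨k, hk, hkK⟩ := hK'
  refine ⟨h.sphere.trans k, h.isPLHomeo.trans hk, ?_⟩
  change (k ∘ h.sphere) '' K = _
  rw [Set.image_comp, h.sphere_image_eq hK, hkK]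

lemma IsSplittable.of_image {H : R4 ≃ₜ R4} (h : IsPLIso H) {K K' L L' : Set S3}
    (hK : H '' coneOver K = coneOver K') (hL : H '' coneOver L = coneOver L')
    (hKL : IsSplittable K' L') : IsSplittable K L := by
  obtain ⟨k, hk, hkK, hkL⟩ := hKL
  refine ⟨h.sphere.trans k, h.isPLHomeo.trans hk, fun x hx ↦ hkK _ ?_, fun x hx ↦ hkL _ ?_⟩
  · rw [← h.sphere_image_eq hK]
    exact ⟨x, hx, rfl⟩
  · rw [← h.sphere_image_eq hL]
    exact ⟨x, hx, rfl⟩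

lemma isSplittable_of_sign {H : R4 ≃ₜ R4} (h : IsPLIso H) {K L : Set S3}
    (hK : ∀ x ∈ coneOver K, x ≠ 0 → 0 < H x 3) (hL : ∀ x ∈ coneOver L, x ≠ 0 → H x 3 < 0) :
    IsSplittable K L := by
  have key : ∀ x : S3, H x 3 = ‖H x‖ * (h.sphere x : R4) 3 := fun x ↦ by
    conv_lhs => rw [h.apply_eq x]
    simp
  refine ⟨h.sphere, h.isPLHomeo, fun x hx ↦ ?_, fun x hx ↦ ?_⟩
  · have := hK x (mem_coneOver.2 hx) x.ne_zero
    rw [key] at this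
    exact (pos_iff_pos_of_mul_pos this).1 (h.norm_pos x)
  · have := hL x (mem_coneOver.2 hx) x.ne_zero
    rw [key] at this
    by_contra! h0
    exact this.not_ge (mul_nonneg (h.norm_pos x).le h0)

lemma IsSplittable.symm {K L : Set S3} (h : IsSplittable K L) : IsSplittable L K := by
  obtain ⟨k, hk, hK, hL⟩ := h
  let e := LinearIsometryEquiv.neg (E := R4) ℝ
  have he := isPLIso_linear e.toContinuousLinearEquiv
  have hs : ∀ x : S3, (he.sphere x : R4) = -(x : R4) := fun x ↦ by
    have h1 : e.toContinuousLinearEquiv.toHomeomorph (x : R4) = -(x : R4) := rfl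
    have h2 := he.apply_eq x
    rw [h1, norm_neg, S3.norm_eq, one_smul] at h2
    exact h2.symm
  refine ⟨k.trans he.sphere, hk.trans he.isPLHomeo, fun x hx ↦ ?_, fun x hx ↦ ?_⟩
  · simpa [hs] using hL x hx
  · simpa [hs] using hK x hx

/-! ### Polygonal paths -/

/-- `c` is a geodesic segment on `[s₀, s₁]`. -/
def IsSegment (c : ℝ → S3) (s₀ s₁ : ℝ) : Prop :=
  ∃ a b : R4, ∀ s ∈ Set.Icc s₀ s₁, ∃ r : ℝ, 0 < r ∧ a + s • b = r • (c s : R4)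

/-- `c` is a polygonal path on `[s₀, s₁]`; the inductive form of `IsPLPath`. -/
inductive IsPolygonal (c : ℝ → S3) : ℝ → ℝ → Prop
  | refl (s : ℝ) : IsPolygonal c s s
  | cons {s₀ s₁ s₂ : ℝ} : s₀ < s₁ → IsSegment c s₀ s₁ → IsPolygonal c s₁ s₂ → IsPolygonal c s₀ s₂

lemma IsPolygonal.le {c : ℝ → S3} {s₀ s₁ : ℝ} (h : IsPolygonal c s₀ s₁) : s₀ ≤ s₁ := by
  induction h with
  | refl _ => rfl
  | cons h _ _ ih => exact h.le.trans ih

lemma IsPolygonal.trans {c : ℝ → S3} {s₀ s₁ s₂ : ℝ} (h : IsPolygonal c s₀ s₁)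
    (h' : IsPolygonal c s₁ s₂) : IsPolygonal c s₀ s₂ := by
  induction h with
  | refl _ => exact h'
  | cons hlt hseg _ ih => exact .cons hlt hseg (ih h')

lemma IsSegment.isPolygonal {c : ℝ → S3} {s₀ s₁ : ℝ} (h : IsSegment c s₀ s₁) (hlt : s₀ < s₁) :
    IsPolygonal c s₀ s₁ := .cons hlt h (.refl _)

lemma isPLPath_iff {c : ℝ → S3} : IsPLPath c ↔ IsPolygonal c 0 1 := by
  constructor
  · rintro ⟨n, t, h0, hn, hlt, hseg⟩
    have key : ∀ k ≤ n, IsPolygonal c (t 0) (t k) := by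
      intro k
      induction k with
      | zero => exact fun _ ↦ .refl _
      | succ k ih =>
        exact fun hk ↦ (ih (by omega)).trans
          (IsSegment.isPolygonal (hseg k (by omega)) (hlt k (by omega)))
    have := key n le_rfl
    rwa [h0, hn] at this
  · intro h
    have key : ∀ s₀ s₁, IsPolygonal c s₀ s₁ → ∃ (n : ℕ) (t : ℕ → ℝ), t 0 = s₀ ∧ t n = s₁ ∧
        (∀ i < n, t i < t (i + 1)) ∧ ∀ i < n, IsSegment c (t i) (t (i + 1)) := by
      intro s₀ s₁ h
      induction h with
      | refl s => exact ⟨0, fun _ ↦ s, rfl, rfl, by simp, by simp⟩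
      | @cons s₀ s₁ s₂ hlt hseg _ ih =>
        obtain ⟨n, t, h0, hn, hlt', hseg'⟩ := ih
        refine ⟨n + 1, fun i ↦ Nat.casesOn i s₀ t, rfl, hn, fun i hi ↦ ?_, fun i hi ↦ ?_⟩
        · cases i with
          | zero => simpa [h0] using hlt
          | succ i => exact hlt' i (by omega)
        · cases i with
          | zero => simpa [h0] using hseg
          | succ i => exact hseg' i (by omega)
    exact key 0 1 h

lemma IsPLPath.reverse {c : ℝ → S3} (h : IsPLPath c) : IsPLPath (fun s ↦ c (1 - s)) := by
  rw [isPLPath_iff] at h ⊢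
  have key : ∀ s₀ s₁, IsPolygonal c s₀ s₁ →
      IsPolygonal (fun s ↦ c (1 - s)) (1 - s₁) (1 - s₀) := by
    intro s₀ s₁ h
    induction h with
    | refl s => exact .refl _
    | @cons s₀ s₁ s₂ hlt hseg _ ih =>
      obtain ⟨a, b, hab⟩ := hseg
      refine ih.trans (IsSegment.isPolygonal ⟨a + b, -b, fun s hs ↦ ?_⟩ (by linarith))
      obtain ⟨r, hr, h⟩ := hab (1 - s) ⟨by linarith [hs.2], by linarith [hs.1]⟩
      exact ⟨r, hr, by rw [← h]; module⟩
  simpa using key 0 1 h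

/-- A continuous curve that at every point agrees with one of finitely many affine curves is affine
on the pieces of a subdivision. -/
lemma exists_affine_of_finite {g : ℝ → R4} (hg : Continuous g) {F : Set (R4 × R4)}
    {N : Set ℝ} (hN : ∀ s, ∀ p ∈ F, ∀ q ∈ F, p.1 + s • p.2 = q.1 + s • q.2 → p ≠ q → s ∈ N)
    (hF : F.Finite) {s₀ s₁ : ℝ} (hlt : s₀ < s₁)
    (hgF : ∀ s ∈ Set.Icc s₀ s₁, ∃ p ∈ F, g s = p.1 + s • p.2) (hdisj : Disjoint (Set.Ioo s₀ s₁) N) :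
    ∃ p ∈ F, ∀ s ∈ Set.Icc s₀ s₁, g s = p.1 + s • p.2 := by
  have hclosed : ∀ p : R4 × R4, IsClosed {s : ℝ | g s = p.1 + s • p.2} :=
    fun p ↦ isClosed_eq hg (by fun_prop)
  obtain ⟨m, hm⟩ := Set.nonempty_Ioo.2 hlt
  obtain ⟨p, hp, hmp⟩ := hgF m (Set.Ioo_subset_Icc_self hm)
  refine ⟨p, hp, ?_⟩
  suffices h : Set.Ioo s₀ s₁ ⊆ {s : ℝ | g s = p.1 + s • p.2} by
    have := closure_minimal h (hclosed p)
    rwa [closure_Ioo hlt.ne] at this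
  by_contra hnot
  obtain ⟨m', hm', hmp'⟩ := Set.not_subset.1 hnot
  have hD : IsClosed (⋃ q ∈ F \ {p}, {s : ℝ | g s = q.1 + s • q.2}) :=
    (hF.subset Set.sdiff_subset).isClosed_biUnion fun q _ ↦ hclosed q
  obtain ⟨q, hq, hmq⟩ := hgF m' (Set.Ioo_subset_Icc_self hm')
  have hqp : q ≠ p := fun h ↦ hmp' (h ▸ hmq)
  obtain ⟨s, hs, hsp, hsq⟩ := isPreconnected_closed_iff.1 isPreconnected_Ioo _ _ (hclosed p) hD
    (fun s hs ↦ by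
      obtain ⟨q, hq, hsq⟩ := hgF s (Set.Ioo_subset_Icc_self hs)
      by_cases h : q = p
      · exact Or.inl (h ▸ hsq)
      · exact Or.inr (Set.mem_biUnion (x := q) ⟨hq, h⟩ hsq))
    ⟨m, hm, hmp⟩ ⟨m', hm', Set.mem_biUnion (x := q) ⟨hq, hqp⟩ hmq⟩
  simp only [Set.mem_iUnion, exists_prop] at hsq
  obtain ⟨q', ⟨hq', hne⟩, hsq⟩ := hsq
  exact Set.disjoint_left.1 hdisj hs (hN s p hp q' hq' (hsp.symm.trans hsq) (Ne.symm hne))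

lemma isPolygonal_of_finite_subdivision {c : ℝ → S3} {N : Set ℝ} (hN : N.Finite) :
    ∀ s₀ s₁ : ℝ, s₀ < s₁ →
      (∀ t₀ t₁, t₀ < t₁ → s₀ ≤ t₀ → t₁ ≤ s₁ → Disjoint (Set.Ioo t₀ t₁) N → IsSegment c t₀ t₁) →
      IsPolygonal c s₀ s₁ := by
  induction N, hN using Set.Finite.induction_on with
  | empty =>
    exact fun s₀ s₁ hlt h ↦ (h s₀ s₁ hlt le_rfl le_rfl (Set.disjoint_empty _)).isPolygonal hlt
  | @insert x N _ _ ih =>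
    intro s₀ s₁ hlt h
    by_cases hx : x ∈ Set.Ioo s₀ s₁
    · refine (ih s₀ x hx.1 fun t₀ t₁ ht h0 h1 hd ↦ ?_).trans
        (ih x s₁ hx.2 fun t₀ t₁ ht h0 h1 hd ↦ ?_)
      · exact h t₀ t₁ ht h0 (h1.trans hx.2.le)
          (Set.disjoint_insert_right.2 ⟨fun hx' ↦ absurd hx'.2 h1.not_gt, hd⟩)
      · exact h t₀ t₁ ht (hx.1.le.trans h0) h1
          (Set.disjoint_insert_right.2 ⟨fun hx' ↦ absurd hx'.1 h0.not_gt, hd⟩)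
    · refine ih s₀ s₁ hlt fun t₀ t₁ ht h0 h1 hd ↦ h t₀ t₁ ht h0 h1
        (Set.disjoint_insert_right.2 ⟨fun hx' ↦ hx ⟨h0.trans_lt hx'.1, hx'.2.trans_le h1⟩, hd⟩)

lemma IsPLPath.comp {c : ℝ → S3} (hc : IsPLPath c) {H : R4 ≃ₜ R4} (h : IsPLIso H) :
    IsPLPath (fun s ↦ h.sphere (c s)) := by
  rw [isPLPath_iff] at hc ⊢
  have key : ∀ s₀ s₁, s₀ < s₁ → IsSegment c s₀ s₁ →
      IsPolygonal (fun s ↦ h.sphere (c s)) s₀ s₁ := by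
    rintro s₀ s₁ hlt ⟨a, b, hab⟩
    obtain ⟨G, hG, hHG⟩ := h.2.1
    let F : Set (R4 × R4) := (fun A : R4 →ₗ[ℝ] R4 ↦ (A a, A b)) '' G
    have hF : F.Finite := hG.image _
    let N : Set ℝ := ⋃ p ∈ F, ⋃ q ∈ F, {s | p.1 + s • p.2 = q.1 + s • q.2 ∧ p ≠ q}
    have hN : N.Finite := by
      refine hF.biUnion fun p _ ↦ hF.biUnion fun q _ ↦ Set.Subsingleton.finite ?_
      rintro s ⟨hs, hpq⟩ t ⟨ht, -⟩
      by_contra hst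
      have h1 : (s - t) • (p.2 - q.2) = 0 := by
        have e1 : s • (p.2 - q.2) = q.1 - p.1 := by
          rw [smul_sub, sub_eq_sub_iff_add_eq_add, add_comm, hs, add_comm]
        have e2 : t • (p.2 - q.2) = q.1 - p.1 := by
          rw [smul_sub, sub_eq_sub_iff_add_eq_add, add_comm, ht, add_comm]
        rw [sub_smul, e1, e2, sub_self]
      have h2 : p.2 = q.2 := sub_eq_zero.1 ((smul_eq_zero.1 h1).resolve_left (sub_ne_zero.2 hst))
      rw [h2] at hs
      exact hpq (Prod.ext (add_right_cancel hs) h2)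
    refine isPolygonal_of_finite_subdivision hN s₀ s₁ hlt fun t₀ t₁ ht h0 h1 hd ↦ ?_
    obtain ⟨⟨a', b'⟩, -, hp⟩ := exists_affine_of_finite (g := fun s ↦ H (a + s • b)) (F := F)
      (N := N)
      (H.continuous.comp (by fun_prop))
      (fun s p hp q hq hpq hne ↦ Set.mem_biUnion hp (Set.mem_biUnion hq ⟨hpq, hne⟩)) hF ht
      (fun s _ ↦ by
        obtain ⟨A, hA, hx⟩ := hHG (a + s • b)
        exact ⟨_, ⟨A, hA, rfl⟩, by simp [hx]⟩) hd
    refine ⟨a', b', fun s hs ↦ ?_⟩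
    obtain ⟨r, hr, hrs⟩ := hab s ⟨h0.trans hs.1, hs.2.trans h1⟩
    refine ⟨r * ‖H (c s)‖, mul_pos hr (h.norm_pos _), ?_⟩
    rw [← hp s hs, mul_smul, ← h.apply_eq, ← h.1 _ _ hr.le, ← hrs]
  have key' : ∀ s₀ s₁, IsPolygonal c s₀ s₁ →
      IsPolygonal (fun s ↦ h.sphere (c s)) s₀ s₁ := by
    intro s₀ s₁ hpol
    induction hpol with
    | refl _ => exact .refl _
    | cons hlt hseg _ ih => exact (key _ _ hlt hseg).trans ih
  exact key' 0 1 hc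

lemma IsSegment.coneOver_eq {c : ℝ → S3} {s₀ s₁ : ℝ} (h : IsSegment c s₀ s₁) (hlt : s₀ < s₁) :
    coneOver (c '' Set.Icc s₀ s₁) = cone (c s₀ : R4) (c s₁) := by
  obtain ⟨a, b, hab⟩ := h
  obtain ⟨r₀, hr₀, h₀⟩ := hab s₀ ⟨le_rfl, hlt.le⟩
  obtain ⟨r₁, hr₁, h₁⟩ := hab s₁ ⟨hlt.le, le_rfl⟩
  rw [← cone_smul_left _ _ hr₀, ← cone_smul_right _ _ hr₁, ← h₀, ← h₁]
  have hd : 0 < s₁ - s₀ := sub_pos.2 hlt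
  ext x
  constructor
  · rintro ⟨_, ⟨s, hs, rfl⟩, r, hr, rfl⟩
    obtain ⟨r', hr', h'⟩ := hab s hs
    refine ⟨r / r' * ((s₁ - s) / (s₁ - s₀)), r / r' * ((s - s₀) / (s₁ - s₀)),
      mul_nonneg (by positivity) (div_nonneg (by linarith [hs.2]) hd.le),
      mul_nonneg (by positivity) (div_nonneg (by linarith [hs.1]) hd.le), ?_⟩
    have : r • (c s : R4) = (r / r') • (a + s • b) := by
      rw [h', smul_smul, div_mul_cancel₀ _ hr'.ne']
    rw [this, mul_smul, mul_smul, ← smul_add]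
    congr 1
    have e1 : (s₁ - s) / (s₁ - s₀) + (s - s₀) / (s₁ - s₀) = 1 := by field_simp; ring
    have e2 : (s₁ - s) / (s₁ - s₀) * s₀ + (s - s₀) / (s₁ - s₀) * s₁ = s := by field_simp; ring
    calc a + s • b = ((s₁ - s) / (s₁ - s₀) + (s - s₀) / (s₁ - s₀)) • a +
          ((s₁ - s) / (s₁ - s₀) * s₀ + (s - s₀) / (s₁ - s₀) * s₁) • b := by rw [e1, e2, one_smul]
      _ = _ := by module
  · rintro ⟨σ, τ, hσ, hτ, rfl⟩
    rcases (add_nonneg hσ hτ).eq_or_lt with h0 | h0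
    · have e1 : σ = 0 := by linarith
      have e2 : τ = 0 := by linarith
      exact ⟨c s₀, ⟨s₀, ⟨le_rfl, hlt.le⟩, rfl⟩, 0, le_rfl, by simp [e1, e2]⟩
    · have hs : (σ * s₀ + τ * s₁) / (σ + τ) ∈ Set.Icc s₀ s₁ := by
        constructor
        · rw [le_div_iff₀ h0]
          nlinarith
        · rw [div_le_iff₀ h0]
          nlinarith
      obtain ⟨r', hr', h'⟩ := hab _ hs
      refine ⟨_, ⟨_, hs, rfl⟩, (σ + τ) * r', by positivity, ?_⟩
      rw [mul_smul, ← h', smul_add (σ + τ), smul_smul (σ + τ), mul_div_cancel₀ _ h0.ne']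
      module

lemma IsSegment.linearIndependent {c : ℝ → S3} {s₀ s₁ : ℝ} (h : IsSegment c s₀ s₁) (hlt : s₀ < s₁)
    (hne : c s₀ ≠ c s₁) : LinearIndependent ℝ ![(c s₀ : R4), (c s₁ : R4)] := by
  obtain ⟨a, b, hab⟩ := h
  obtain ⟨r₀, hr₀, h₀⟩ := hab s₀ ⟨le_rfl, hlt.le⟩
  obtain ⟨r₁, hr₁, h₁⟩ := hab s₁ ⟨hlt.le, le_rfl⟩
  rw [linearIndependent_two_iff]
  intro p q hpq
  have e : p • (c s₀ : R4) = (-q) • (c s₁ : R4) := by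
    rw [neg_smul]
    exact eq_neg_of_add_eq_zero_left hpq
  have habs : |p| = |q| := by
    have := congrArg norm e
    simpa [norm_smul] using this
  rcases abs_eq_abs.1 habs with rfl | rfl
  · -- The end points are antipodal only if the segment passes through the origin.
    by_contra hp
    have hp : p ≠ 0 := fun h0 ↦ hp ⟨h0, h0⟩
    have e' : (c s₁ : R4) = -(c s₀ : R4) := by
      have : p • ((c s₀ : R4) + c s₁) = 0 := by rw [smul_add, hpq]
      exact eq_neg_of_add_eq_zero_right ((smul_eq_zero.1 this).resolve_left hp)
    have hs : (r₁ * s₀ + r₀ * s₁) / (r₁ + r₀) ∈ Set.Icc s₀ s₁ := by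
      constructor
      · rw [le_div_iff₀ (by positivity)]
        nlinarith
      · rw [div_le_iff₀ (by positivity)]
        nlinarith
    obtain ⟨r', hr', h'⟩ := hab _ hs
    have hz : (r₁ + r₀) • (a + ((r₁ * s₀ + r₀ * s₁) / (r₁ + r₀)) • b) = 0 := by
      rw [smul_add, smul_smul, mul_div_cancel₀ _ (by positivity)]
      calc _ = r₁ • (a + s₀ • b) + r₀ • (a + s₁ • b) := by module
        _ = 0 := by rw [h₀, h₁, e']; module
    rw [h', smul_smul] at hz
    have h1 := (smul_eq_zero.1 hz).resolve_right (S3.ne_zero _)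
    have : 0 < (r₁ + r₀) * r' := by positivity
    exact this.ne' h1
  · by_contra hq
    have hq : -q ≠ 0 := fun h0 ↦ hq ⟨h0, neg_eq_zero.1 h0⟩
    exact hne (Subtype.ext (smul_right_injective R4 hq e))

lemma image_Icc_union (c : ℝ → S3) {s₀ s₁ s₂ : ℝ} (h : s₀ ≤ s₁) (h' : s₁ ≤ s₂) :
    coneOver (c '' Set.Icc s₀ s₂) =
      coneOver (c '' Set.Icc s₀ s₁) ∪ coneOver (c '' Set.Icc s₁ s₂) := by
  rw [← coneOver_union, ← Set.image_union, Set.Icc_union_Icc_eq_Icc h h']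

lemma IsPLPath.isTame {c : ℝ → S3} (hc : IsPLPath c) :
    IsTame (coneOver (c '' Set.Icc 0 1)) := by
  rw [isPLPath_iff] at hc
  generalize (0 : ℝ) = s₀, (1 : ℝ) = s₁ at hc ⊢
  induction hc with
  | refl s =>
    rw [Set.Icc_self, Set.image_singleton, coneOver_singleton]
    exact isTame_ray _
  | cons hlt hseg hpol ih =>
    rw [image_Icc_union c hlt.le hpol.le, hseg.coneOver_eq hlt]
    exact (isTame_cone _ _).union ih

lemma IsPLPath.isArc {c : ℝ → S3} (hc : IsPLPath c) (hinj : Set.InjOn c (Set.Icc 0 1)) :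
    IsArc (c 0) (coneOver (c '' Set.Icc 0 1)) (c 1) := by
  have key : ∀ s₀ s₁, IsPolygonal c s₀ s₁ → s₀ < s₁ → Set.InjOn c (Set.Icc s₀ s₁) →
      IsArc (c s₀) (coneOver (c '' Set.Icc s₀ s₁)) (c s₁) := by
    intro s₀ s₁ h
    induction h with
    | refl s => exact fun h ↦ absurd h (lt_irrefl _)
    | @cons s₀ s₁ s₂ hlt hseg hpol ih =>
      intro hlt' hinj
      have hle := hpol.le
      have hne : c s₀ ≠ c s₁ := fun h ↦
        hlt.ne (hinj ⟨le_rfl, hlt'.le⟩ ⟨hlt.le, hle⟩ h)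
      rcases hle.eq_or_lt with rfl | hlt₂
      · rw [hseg.coneOver_eq hlt]
        exact .segment (hseg.linearIndependent hlt hne)
      · rw [image_Icc_union c hlt.le hle, hseg.coneOver_eq hlt]
        refine .cons (hseg.linearIndependent hlt hne)
          (ih hlt₂ (hinj.mono (Set.Icc_subset_Icc_left hlt.le))) ?_
        rw [← hseg.coneOver_eq hlt]
        apply coneOver_inter_subset
        rintro _ ⟨⟨s, hs, rfl⟩, t, ht, hst⟩
        have := hinj ⟨hlt.le.trans ht.1, ht.2⟩ ⟨hs.1, hs.2.trans hle⟩ hst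
        have h1 : s = s₁ := le_antisymm hs.2 (this ▸ ht.1)
        rw [h1, Set.mem_singleton_iff]
  exact key 0 1 (isPLPath_iff.1 hc) one_pos hinj

/-! ### Paths with one corner -/

/-- Radial projection to the sphere (with an arbitrary value at the origin). -/
noncomputable def radial (x : R4) : S3 :=
  if h : x = 0 then ⟨EuclideanSpace.single 0 1, by simp⟩
  else ⟨‖x‖⁻¹ • x, by simp [norm_smul, h]⟩

lemma eq_smul_radial {x : R4} (hx : x ≠ 0) : x = ‖x‖ • (radial x : R4) := by
  rw [radial, dif_neg hx, smul_smul, mul_inv_cancel₀ (norm_ne_zero_iff.2 hx), one_smul]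

lemma radial_smul (y : S3) {r : ℝ} (hr : 0 < r) : radial (r • (y : R4)) = y := by
  have hne : r • (y : R4) ≠ 0 := smul_ne_zero hr.ne' y.ne_zero
  exact ((S3.eq_of_smul_eq hr (norm_nonneg _) (eq_smul_radial hne)).1).symm

lemma combo_ne_zero {A B : R4} (h : LinearIndependent ℝ ![A, B]) {s t : ℝ} (hst : s ≠ 0 ∨ t ≠ 0) :
    s • A + t • B ≠ 0 := by
  intro h0
  obtain ⟨h1, h2⟩ := linearIndependent_two_iff.1 h s t h0
  exact hst.elim (fun h ↦ h h1) (fun h ↦ h h2)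

lemma combo_ray_eq {A B : R4} (h : LinearIndependent ℝ ![A, B]) {s t : ℝ}
    (hst : radial ((1 - s) • A + s • B) = radial ((1 - t) • A + t • B)) : s = t := by
  have hne : ∀ s : ℝ, (1 - s) • A + s • B ≠ 0 := fun s ↦ combo_ne_zero h (by
    by_contra! h0
    linarith)
  set k := ‖(1 - s) • A + s • B‖ with hk
  set l := ‖(1 - t) • A + t • B‖ with hl
  have hk0 : 0 < k := norm_pos_iff.2 (hne s)
  have hl0 : 0 < l := norm_pos_iff.2 (hne t)
  have e1 := eq_smul_radial (hne s)
  have e2 := eq_smul_radial (hne t)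
  rw [hst, ← hk] at e1
  rw [← hl] at e2
  generalize radial ((1 - t) • A + t • B) = y at e1 e2
  have e3 : l • ((1 - s) • A + s • B) = k • ((1 - t) • A + t • B) := by
    rw [e1, e2, smul_smul, smul_smul, mul_comm]
  obtain ⟨h1, h2⟩ := linearIndependent_two_iff.1 h (l * (1 - s) - k * (1 - t)) (l * s - k * t)
    (by rw [← sub_eq_zero] at e3; rw [← e3]; module)
  have hkl : l = k := by linarith
  rw [hkl] at h2
  exact mul_left_cancel₀ hk0.ne' (sub_eq_zero.1 h2)

/-- The path that runs along the segments `AM` and `MB`. -/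
lemma exists_corner_path {A M B : R4} (hAM : LinearIndependent ℝ ![A, M])
    (hMB : LinearIndependent ℝ ![M, B]) (hcap : cone A M ∩ cone M B ⊆ ray M) :
    ∃ c : ℝ → S3, IsPLPath c ∧ Set.InjOn c (Set.Icc 0 1) ∧ c 0 = radial A ∧ c 1 = radial B ∧
      coneOver (c '' Set.Icc 0 1) = cone A M ∪ cone M B := by
  let c : ℝ → S3 := fun s ↦ if s ≤ 1 / 2 then radial ((1 - 2 * s) • A + (2 * s) • M)
    else radial ((1 - (2 * s - 1)) • M + (2 * s - 1) • B)
  have hne₁ : ∀ s : ℝ, (1 - s) • A + s • M ≠ 0 := fun s ↦ combo_ne_zero hAM (by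
    by_contra! h0
    linarith)
  have hne₂ : ∀ s : ℝ, (1 - s) • M + s • B ≠ 0 := fun s ↦ combo_ne_zero hMB (by
    by_contra! h0
    linarith)
  have hc₁ : ∀ s ≤ (1 / 2 : ℝ), c s = radial ((1 - 2 * s) • A + (2 * s) • M) :=
    fun s hs ↦ if_pos hs
  have hc₂ : ∀ s : ℝ, 1 / 2 ≤ s → c s = radial ((1 - (2 * s - 1)) • M + (2 * s - 1) • B) := by
    intro s hs
    rcases hs.eq_or_lt with rfl | hlt
    · rw [hc₁ _ le_rfl]
      norm_num
    · exact if_neg hlt.not_ge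
  have h0 : c 0 = radial A := by rw [hc₁ 0 (by norm_num)]; simp
  have h1 : c 1 = radial B := by rw [hc₂ 1 (by norm_num)]; norm_num
  have hm : c (1 / 2) = radial M := by rw [hc₁ _ le_rfl]; norm_num
  have seg₁ : IsSegment c 0 (1 / 2) := by
    refine ⟨A, (2 : ℝ) • (M - A), fun s hs ↦
      ⟨‖(1 - 2 * s) • A + (2 * s) • M‖, norm_pos_iff.2 (hne₁ _), ?_⟩⟩
    rw [hc₁ s hs.2, ← eq_smul_radial (hne₁ _)]
    module
  have seg₂ : IsSegment c (1 / 2) 1 := by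
    refine ⟨(2 : ℝ) • M - B, (2 : ℝ) • (B - M), fun s hs ↦
      ⟨‖(1 - (2 * s - 1)) • M + (2 * s - 1) • B‖, norm_pos_iff.2 (hne₂ _), ?_⟩⟩
    rw [hc₂ s hs.1, ← eq_smul_radial (hne₂ _)]
    module
  have hA0 : A ≠ 0 := by simpa using hne₁ 0
  have hM0 : M ≠ 0 := by simpa using hne₁ 1
  have hB0 : B ≠ 0 := by simpa using hne₂ 1
  have cone_radial : ∀ P Q : R4, P ≠ 0 → Q ≠ 0 →
      cone (radial P : R4) (radial Q : R4) = cone P Q := by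
    intro P Q hP hQ
    conv_rhs => rw [eq_smul_radial hP, eq_smul_radial hQ]
    rw [cone_smul_left _ _ (norm_pos_iff.2 hP), cone_smul_right _ _ (norm_pos_iff.2 hQ)]
  have im₁ : coneOver (c '' Set.Icc 0 (1 / 2)) = cone A M := by
    rw [seg₁.coneOver_eq (by norm_num), h0, hm, cone_radial A M hA0 hM0]
  have im₂ : coneOver (c '' Set.Icc (1 / 2) 1) = cone M B := by
    rw [seg₂.coneOver_eq (by norm_num), h1, hm, cone_radial M B hM0 hB0]
  have inj₁ : Set.InjOn c (Set.Icc 0 (1 / 2)) := by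
    intro s hs t ht hst
    rw [hc₁ s hs.2, hc₁ t ht.2] at hst
    have := combo_ray_eq hAM hst
    linarith
  have inj₂ : Set.InjOn c (Set.Icc (1 / 2) 1) := by
    intro s hs t ht hst
    rw [hc₂ s hs.1, hc₂ t ht.1] at hst
    have := combo_ray_eq hMB hst
    linarith
  -- A point of both halves is the corner.
  have cross : ∀ s ∈ Set.Icc (0 : ℝ) (1 / 2), ∀ t ∈ Set.Icc (1 / 2 : ℝ) 1, c s = c t → s = t := by
    intro s hs t ht hst
    have hmem : (c s : R4) ∈ ray M := hcap ⟨im₁ ▸ mem_coneOver.2 ⟨s, hs, rfl⟩,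
      im₂ ▸ mem_coneOver.2 ⟨t, ht, hst.symm⟩⟩
    obtain ⟨r, hr, hrM⟩ := hmem
    have hcm : c s = c (1 / 2) := by
      rw [hm]
      rw [eq_smul_radial hM0, smul_smul] at hrM
      exact (S3.eq_of_smul_eq one_pos (mul_nonneg hr (norm_nonneg M)) ((one_smul ℝ _).trans hrM)).1
    rw [inj₁ hs ⟨by norm_num, le_rfl⟩ hcm]
    exact inj₂ ⟨le_rfl, by norm_num⟩ ht (hcm.symm.trans hst)
  refine ⟨c, isPLPath_iff.2 ((seg₁.isPolygonal (by norm_num)).trans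
    (seg₂.isPolygonal (by norm_num))), fun s hs t ht hst ↦ ?_, h0, h1, ?_⟩
  · rcases le_total s (1 / 2) with h | h <;> rcases le_total t (1 / 2) with h' | h'
    · exact inj₁ ⟨hs.1, h⟩ ⟨ht.1, h'⟩ hst
    · exact cross s ⟨hs.1, h⟩ t ⟨h', ht.2⟩ hst
    · exact (cross t ⟨ht.1, h'⟩ s ⟨h, hs.2⟩ hst.symm).symm
    · exact inj₂ ⟨h, hs.2⟩ ⟨h', ht.2⟩ hst
  · rw [image_Icc_union c (s₁ := 1 / 2) (by norm_num) (by norm_num), im₁, im₂]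

/-! ### Spatial embeddings under homeomorphisms -/

variable {α : Type*} {β : Type*}

/-- The composite of a spatial embedding with a piecewise linear homeomorphism of the sphere. -/
noncomputable def SpatialEmbedding.map {G : Graph α β} (f : SpatialEmbedding G) {H : R4 ≃ₜ R4}
    (h : IsPLIso H) : SpatialEmbedding G where
  vert v := h.sphere (f.vert v)
  edge e s := h.sphere (f.edge e s)
  isPLPath e he := (f.isPLPath e he).comp h
  ends e u v huv := by simpa using f.ends e u v huv
  vert_injOn := h.sphere.injective.comp_injOn f.vert_injOn
  edge_ne_vert e he s hs v hv := by simpa using f.edge_ne_vert e he s hs v hv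
  edge_inj e he e' he' s hs s' hs' heq :=
    f.edge_inj e he e' he' s hs s' hs' (h.sphere.injective heq)

lemma SpatialEmbedding.map_image {G : Graph α β} (f : SpatialEmbedding G) {H : R4 ≃ₜ R4}
    (h : IsPLIso H) (γ : Cycle G) : (f.map h).image γ = h.sphere '' f.image γ := by
  simp only [SpatialEmbedding.image, Set.image_iUnion, Set.image_image]
  rfl

/-- The conclusion of the I(K or C3L) property for one embedding. -/
def HasKnotOrLink {G : Graph α β} (f : SpatialEmbedding G) : Prop :=
  (∃ γ : Cycle G, ¬ IsTrivialKnot (f.image γ)) ∨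
    (∃ γ₁ γ₂ γ₃ : Cycle G,
      γ₁.IsDisjoint γ₂ ∧ γ₁.IsDisjoint γ₃ ∧ γ₂.IsDisjoint γ₃ ∧
      ¬ IsSplittable (f.image γ₁) (f.image γ₂) ∧
      ¬ IsSplittable (f.image γ₁) (f.image γ₃) ∧
      ¬ IsSplittable (f.image γ₂) (f.image γ₃))

lemma HasKnotOrLink.of_map {G : Graph α β} {f : SpatialEmbedding G} {H : R4 ≃ₜ R4}
    {h : IsPLIso H} (hf : HasKnotOrLink (f.map h)) : HasKnotOrLink f := by
  have e : ∀ γ : Cycle G, H.symm '' coneOver ((f.map h).image γ) = coneOver (f.image γ) := by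
    intro γ
    rw [f.map_image, h.coneOver_image, ← Set.image_comp]
    simp
  have split : ∀ γ δ : Cycle G, IsSplittable (f.image γ) (f.image δ) →
      IsSplittable ((f.map h).image γ) ((f.map h).image δ) :=
    fun γ δ ↦ IsSplittable.of_image h.symm (e γ) (e δ)
  rcases hf with ⟨γ, hγ⟩ | ⟨γ₁, γ₂, γ₃, h12, h13, h23, s12, s13, s23⟩
  · exact Or.inl ⟨γ, fun ht ↦ hγ (ht.of_image h.symm (e γ))⟩
  · exact Or.inr ⟨γ₁, γ₂, γ₃, h12, h13, h23, mt (split _ _) s12, mt (split _ _) s13,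
      mt (split _ _) s23⟩

/-! ### Rerouting cycles -/

namespace Cycle

variable {G G' : Graph α β}

lemma mem_range_vert (γ : Cycle G) {e : β} (he : e ∈ Set.range γ.edge) {y z : α}
    (h : G.IsLink e y z) : y ∈ Set.range γ.vert := by
  obtain ⟨i, rfl⟩ := he
  rcases h.left_eq_or_eq (γ.isLink i) with rfl | rfl
  exacts [⟨_, rfl⟩, ⟨_, rfl⟩]

/-- Change of the starting point. -/
def rotate (γ : Cycle G) (i : Fin (γ.m + 1)) : Cycle G where
  m := γ.m
  vert j := γ.vert (j + i)
  edge j := γ.edge (j + i)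
  vert_injective := γ.vert_injective.comp (add_left_injective i)
  edge_injective := γ.edge_injective.comp (add_left_injective i)
  isLink j := by
    have := γ.isLink (j + i)
    rwa [add_right_comm] at this

lemma range_rotate_vert (γ : Cycle G) (i : Fin (γ.m + 1)) :
    Set.range (γ.rotate i).vert = Set.range γ.vert :=
  (Equiv.addRight i).surjective.range_comp γ.vert

lemma range_rotate_edge (γ : Cycle G) (i : Fin (γ.m + 1)) :
    Set.range (γ.rotate i).edge = Set.range γ.edge :=
  (Equiv.addRight i).surjective.range_comp γ.edge

/-- A cycle may be regarded as a cycle of any graph that contains its edges. -/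
def transfer (γ : Cycle G)
    (h : ∀ e ∈ Set.range γ.edge, ∀ y z, G.IsLink e y z → G'.IsLink e y z) : Cycle G' where
  m := γ.m
  vert := γ.vert
  edge := γ.edge
  vert_injective := γ.vert_injective
  edge_injective := γ.edge_injective
  isLink i := h _ ⟨i, rfl⟩ _ _ (γ.isLink i)

lemma exists_subdivide_last (γ : Cycle G) {x : α} {p q : β} (hx : x ∉ Set.range γ.vert)
    (hpq : p ≠ q) (hp : p ∉ Set.range γ.edge \ {γ.edge (Fin.last _)})
    (hq : q ∉ Set.range γ.edge \ {γ.edge (Fin.last _)})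
    (hpl : G'.IsLink p x (γ.vert (Fin.last _))) (hql : G'.IsLink q x (γ.vert 0))
    (h : ∀ e ∈ Set.range γ.edge, e ≠ γ.edge (Fin.last _) →
      ∀ y z, G.IsLink e y z → G'.IsLink e y z) :
    ∃ δ : Cycle G', Set.range δ.edge = (Set.range γ.edge \ {γ.edge (Fin.last _)}) ∪ {p, q} ∧
      Set.range δ.vert = insert x (Set.range γ.vert) := by
  have hmem : ∀ k : Fin γ.m, γ.edge k.castSucc ∈ Set.range γ.edge \ {γ.edge (Fin.last _)} :=
    fun k ↦ ⟨⟨_, rfl⟩, fun h ↦ (Fin.castSucc_lt_last k).ne (γ.edge_injective h)⟩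
  let E : Fin γ.m → β := fun k ↦ γ.edge k.castSucc
  have hE : Set.range E = Set.range γ.edge \ {γ.edge (Fin.last _)} := by
    apply Set.Subset.antisymm
    · rintro _ ⟨k, rfl⟩
      exact hmem k
    · rintro _ ⟨⟨i, rfl⟩, hi⟩
      obtain ⟨k, rfl⟩ | rfl := i.eq_castSucc_or_eq_last
      · exact ⟨k, rfl⟩
      · exact absurd rfl hi
  have hEinj : Function.Injective E := γ.edge_injective.comp (Fin.castSucc_injective _)
  refine ⟨{ m := γ.m + 1
            vert := Fin.snoc (α := fun _ ↦ α) γ.vert x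
            edge := Fin.snoc (α := fun _ ↦ β) (Fin.snoc (α := fun _ ↦ β) E p) q
            vert_injective := Fin.snoc_injective_of_injective γ.vert_injective hx
            edge_injective := Fin.snoc_injective_of_injective
              (Fin.snoc_injective_of_injective hEinj (hE ▸ hp)) ?_
            isLink := fun i ↦ ?_ }, ?_, ?_⟩
  · rw [Fin.range_snoc, hE]
    rintro (h | h)
    exacts [hpq h.symm, hq h]
  · obtain ⟨j, rfl⟩ | rfl := i.eq_castSucc_or_eq_last
    · rw [Fin.snoc_castSucc, Fin.snoc_castSucc, Fin.coeSucc_eq_succ]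
      obtain ⟨k, rfl⟩ | rfl := j.eq_castSucc_or_eq_last
      · rw [Fin.snoc_castSucc, Fin.succ_castSucc, Fin.snoc_castSucc, ← Fin.coeSucc_eq_succ]
        exact h _ (hmem k).1 (hmem k).2 _ _ (γ.isLink _)
      · rw [Fin.snoc_last, Fin.succ_last, Fin.snoc_last]
        exact hpl.symm
    · rw [Fin.snoc_last, Fin.snoc_last, Fin.last_add_one, ← Fin.castSucc_zero, Fin.snoc_castSucc]
      exact hql
  · rw [Fin.range_snoc, Fin.range_snoc, hE]
    ext e
    simp only [Set.mem_insert_iff, Set.mem_union, Set.mem_singleton_iff]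
    tauto
  · rw [Fin.range_snoc]

lemma exists_rotate_edge_last (γ : Cycle G) {e : β} (he : e ∈ Set.range γ.edge) :
    ∃ δ : Cycle G, δ.edge (Fin.last _) = e ∧ Set.range δ.vert = Set.range γ.vert ∧
      Set.range δ.edge = Set.range γ.edge := by
  obtain ⟨i, rfl⟩ := he
  refine ⟨γ.rotate (i + 1), ?_, γ.range_rotate_vert _, γ.range_rotate_edge _⟩
  change γ.edge (Fin.last _ + (i + 1)) = _
  rw [add_comm i 1, ← add_assoc, Fin.last_add_one, zero_add]

/-- An edge `e` of a cycle is replaced by two edges `p`, `q` through a new vertex `x`. -/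
lemma exists_subdivide (γ : Cycle G) {e : β} (he : e ∈ Set.range γ.edge) {x y z : α} {p q : β}
    (hl : G.IsLink e y z) (hx : x ∉ Set.range γ.vert) (hpq : p ≠ q)
    (hp : p ∉ Set.range γ.edge \ {e}) (hq : q ∉ Set.range γ.edge \ {e})
    (hpl : G'.IsLink p x y) (hql : G'.IsLink q x z)
    (h : ∀ e' ∈ Set.range γ.edge, e' ≠ e → ∀ y z, G.IsLink e' y z → G'.IsLink e' y z) :
    ∃ δ : Cycle G', Set.range δ.edge = (Set.range γ.edge \ {e}) ∪ {p, q} ∧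
      Set.range δ.vert = insert x (Set.range γ.vert) := by
  obtain ⟨δ, rfl, hV, hE⟩ := γ.exists_rotate_edge_last he
  have hlink := δ.isLink (Fin.last _)
  rw [Fin.last_add_one] at hlink
  rw [← hV] at hx
  rw [← hE] at hp hq h
  rw [← hV, ← hE]
  rcases hl.eq_and_eq_or_eq_and_eq hlink with ⟨rfl, rfl⟩ | ⟨rfl, rfl⟩
  · exact exists_subdivide_last _ hx hpq hp hq hpl hql h
  · rw [Set.pair_comm]
    exact exists_subdivide_last _ hx hpq.symm hq hp hql hpl h

lemma exists_rotate_vert_last (γ : Cycle G) {v : α} (hv : v ∈ Set.range γ.vert) :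
    ∃ δ : Cycle G, δ.vert (Fin.last _) = v ∧ Set.range δ.vert = Set.range γ.vert ∧
      Set.range δ.edge = Set.range γ.edge := by
  obtain ⟨i, rfl⟩ := hv
  refine ⟨γ.rotate (i + 1), ?_, γ.range_rotate_vert _, γ.range_rotate_edge _⟩
  change γ.vert (Fin.last _ + (i + 1)) = _
  rw [add_comm i 1, ← add_assoc, Fin.last_add_one, zero_add]

/-- Two edges of a cycle that meet in a vertex are consecutive. -/
lemma eq_last_of_isLink (γ : Cycle G) {e₁ e₂ : β} (he : e₁ ≠ e₂) (h₁ : e₁ ∈ Set.range γ.edge)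
    (h₂ : e₂ ∈ Set.range γ.edge) {y z : α} (hl₁ : G.IsLink e₁ y (γ.vert (Fin.last _)))
    (hl₂ : G.IsLink e₂ z (γ.vert (Fin.last _))) (hz : γ.vert (Fin.last _) ≠ z)
    (hy : γ.vert (Fin.last _) ≠ y) :
    ∃ j, j + 1 = Fin.last _ ∧ j ≠ Fin.last _ ∧
      ((γ.edge j = e₁ ∧ γ.edge (Fin.last _) = e₂ ∧ γ.vert j = y ∧ γ.vert 0 = z) ∨
        (γ.edge j = e₂ ∧ γ.edge (Fin.last _) = e₁ ∧ γ.vert j = z ∧ γ.vert 0 = y)) := by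
  have key : ∀ e ∈ Set.range γ.edge, ∀ y, G.IsLink e y (γ.vert (Fin.last _)) →
      γ.vert (Fin.last _) ≠ y → (γ.edge (Fin.last _) = e ∧ γ.vert 0 = y) ∨
        ∃ j, j + 1 = Fin.last _ ∧ γ.edge j = e ∧ γ.vert j = y := by
    rintro _ ⟨j, rfl⟩ y hl hy
    have hj := γ.isLink j
    rcases hl.symm.eq_and_eq_or_eq_and_eq hj with ⟨h1, h2⟩ | ⟨h1, h2⟩
    · have := γ.vert_injective h1
      subst this
      rw [Fin.last_add_one] at h2
      exact Or.inl ⟨rfl, h2.symm⟩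
    · exact Or.inr ⟨j, (γ.vert_injective h1).symm, rfl, h2.symm⟩
  rcases key _ h₁ y hl₁ hy with ⟨h1, h2⟩ | ⟨j, hj, h1, h2⟩ <;>
    rcases key _ h₂ z hl₂ hz with ⟨h3, h4⟩ | ⟨k, hk, h3, h4⟩
  · exact absurd (h1.symm.trans h3) he
  · exact ⟨k, hk, fun h ↦ he (by rw [← h1, ← h3, h]), Or.inr ⟨h3, h1, h4, h2⟩⟩
  · exact ⟨j, hj, fun h ↦ he (by rw [← h1, ← h3, h]), Or.inl ⟨h1, h3, h2, h4⟩⟩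
  · exact absurd (by rw [← h1, ← h3, add_right_cancel (hj.trans hk.symm)]) he

lemma exists_replace_last (γ : Cycle G) {j : Fin (γ.m + 1)} (hj : j + 1 = Fin.last _)
    (hjl : j ≠ Fin.last _) {x : α} {p r : β} (hx : x ∉ Set.range γ.vert) (hpr : p ≠ r)
    (hp : p ∉ Set.range γ.edge \ {γ.edge j, γ.edge (Fin.last _)})
    (hr : r ∉ Set.range γ.edge \ {γ.edge j, γ.edge (Fin.last _)})
    (hpl : G'.IsLink p x (γ.vert j)) (hrl : G'.IsLink r x (γ.vert 0))
    (h : ∀ e ∈ Set.range γ.edge, e ≠ γ.edge j → e ≠ γ.edge (Fin.last _) →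
      ∀ y z, G.IsLink e y z → G'.IsLink e y z) :
    ∃ δ : Cycle G',
      Set.range δ.edge = (Set.range γ.edge \ {γ.edge j, γ.edge (Fin.last _)}) ∪ {p, r} ∧
      Set.range δ.vert = insert x (Set.range γ.vert \ {γ.vert (Fin.last _)}) := by
  classical
  have h0 : (0 : Fin (γ.m + 1)) ≠ Fin.last _ := by
    intro h0
    rw [← h0, ← Fin.last_add_one] at hj
    exact hjl (add_right_cancel hj)
  let V : Fin (γ.m + 1) → α := fun i ↦ if i = Fin.last _ then x else γ.vert i
  let E : Fin (γ.m + 1) → β := fun i ↦ if i = Fin.last _ then r else if i = j then p else γ.edge i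
  have hVl : V (Fin.last _) = x := if_pos rfl
  have hV : ∀ i, i ≠ Fin.last _ → V i = γ.vert i := fun i hi ↦ if_neg hi
  have hEl : E (Fin.last _) = r := if_pos rfl
  have hEj : E j = p := by simp only [E, if_neg hjl, if_true]
  have hE : ∀ i, i ≠ Fin.last _ → i ≠ j → E i = γ.edge i := fun i hi hi' ↦ by
    simp only [E, if_neg hi, if_neg hi']
  have hmem : ∀ i, i ≠ Fin.last _ → i ≠ j →
      γ.edge i ∈ Set.range γ.edge \ {γ.edge j, γ.edge (Fin.last _)} := by
    intro i hi hi'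
    refine ⟨⟨i, rfl⟩, ?_⟩
    rintro (h | h)
    exacts [hi' (γ.edge_injective h), hi (γ.edge_injective h)]
  refine ⟨⟨γ.m, V, E, ?_, ?_, ?_⟩, ?_, ?_⟩
  · intro i i' hii
    by_cases hi : i = Fin.last _ <;> by_cases hi' : i' = Fin.last _
    · rw [hi, hi']
    · rw [hi, hVl, hV _ hi'] at hii
      exact absurd ⟨_, hii.symm⟩ hx
    · rw [hi', hVl, hV _ hi] at hii
      exact absurd ⟨_, hii⟩ hx
    · rw [hV _ hi, hV _ hi'] at hii
      exact γ.vert_injective hii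
  · have cases : ∀ i, (i = Fin.last _ ∧ E i = r) ∨ (i = j ∧ E i = p) ∨
        (E i = γ.edge i ∧ E i ∈ Set.range γ.edge \ {γ.edge j, γ.edge (Fin.last _)}) := by
      intro i
      by_cases hi : i = Fin.last _
      · exact Or.inl ⟨hi, hi ▸ hEl⟩
      by_cases hi' : i = j
      · exact Or.inr (Or.inl ⟨hi', hi' ▸ hEj⟩)
      · exact Or.inr (Or.inr ⟨hE i hi hi', hE i hi hi' ▸ hmem i hi hi'⟩)
    intro i i' hii
    rcases cases i with ⟨h1, h2⟩ | ⟨h1, h2⟩ | ⟨h1, h2⟩ <;>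
      rcases cases i' with ⟨h3, h4⟩ | ⟨h3, h4⟩ | ⟨h3, h4⟩
    · rw [h1, h3]
    · exact absurd (h4.symm.trans (hii.symm.trans h2)) hpr
    · rw [← hii, h2] at h4
      exact absurd h4 hr
    · exact absurd (h2.symm.trans (hii.trans h4)) hpr
    · rw [h1, h3]
    · rw [← hii, h2] at h4
      exact absurd h4 hp
    · rw [hii, h4] at h2
      exact absurd h2 hr
    · rw [hii, h4] at h2
      exact absurd h2 hp
    · exact γ.edge_injective (h1.symm.trans (hii.trans h3))
  · intro i
    by_cases hi : i = Fin.last _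
    · rw [hi, hVl, hEl, Fin.last_add_one, hV _ h0]
      exact hrl
    by_cases hi' : i = j
    · rw [hi', hEj, hj, hVl, hV _ hjl]
      exact hpl.symm
    · have : i + 1 ≠ Fin.last _ := fun h ↦ hi' (add_right_cancel (h.trans hj.symm))
      rw [hE i hi hi', hV i hi, hV _ this]
      exact h _ ⟨i, rfl⟩ (fun h ↦ hi' (γ.edge_injective h)) (fun h ↦ hi (γ.edge_injective h)) _ _
        (γ.isLink i)
  · apply Set.Subset.antisymm
    · rintro _ ⟨i, rfl⟩
      change E i ∈ _
      by_cases hi : i = Fin.last _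
      · rw [hi, hEl]
        exact Or.inr (Or.inr rfl)
      by_cases hi' : i = j
      · rw [hi', hEj]
        exact Or.inr (Or.inl rfl)
      · rw [hE i hi hi']
        exact Or.inl (hmem i hi hi')
    · rintro _ (⟨⟨i, rfl⟩, hi⟩ | rfl | rfl)
      · refine ⟨i, hE i (fun h ↦ hi (Or.inr ?_)) (fun h ↦ hi (Or.inl ?_))⟩ <;> rw [h]
        rfl
      · exact ⟨j, hEj⟩
      · exact ⟨_, hEl⟩
  · apply Set.Subset.antisymm
    · rintro _ ⟨i, rfl⟩
      change V i ∈ _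
      by_cases hi : i = Fin.last _
      · rw [hi, hVl]
        exact Or.inl rfl
      · exact Or.inr ⟨⟨i, (hV i hi).symm⟩, fun h ↦ hi (γ.vert_injective ((hV i hi).symm.trans h))⟩
    · rintro _ (rfl | ⟨⟨i, rfl⟩, hi⟩)
      · exact ⟨_, hVl⟩
      · exact ⟨i, hV i fun h ↦ hi (by rw [h]; rfl)⟩

/-- Two consecutive edges `e₁`, `e₂` of a cycle, with common vertex `v`, are replaced by two edges
`p`, `r` through a new vertex `x`. -/
lemma exists_replace (γ : Cycle G) {e₁ e₂ : β} (he : e₁ ≠ e₂) (h₁ : e₁ ∈ Set.range γ.edge)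
    (h₂ : e₂ ∈ Set.range γ.edge) {x y v z : α} {p r : β} (hl₁ : G.IsLink e₁ y v)
    (hl₂ : G.IsLink e₂ z v) (hy : v ≠ y) (hz : v ≠ z) (hx : x ∉ Set.range γ.vert) (hpr : p ≠ r)
    (hp : p ∉ Set.range γ.edge \ {e₁, e₂}) (hr : r ∉ Set.range γ.edge \ {e₁, e₂})
    (hpl : G'.IsLink p x y) (hrl : G'.IsLink r x z)
    (h : ∀ e ∈ Set.range γ.edge, e ≠ e₁ → e ≠ e₂ → ∀ y z, G.IsLink e y z → G'.IsLink e y z) :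
    ∃ δ : Cycle G', Set.range δ.edge = (Set.range γ.edge \ {e₁, e₂}) ∪ {p, r} ∧
      Set.range δ.vert = insert x (Set.range γ.vert \ {v}) := by
  obtain ⟨δ, rfl, hv, hE⟩ := γ.exists_rotate_vert_last (γ.mem_range_vert h₁ hl₁.symm)
  rw [← hE] at h₁ h₂ hp hr h
  rw [← hv] at hx
  rw [← hE, ← hv]
  obtain ⟨j, hj, hjl, ⟨rfl, rfl, rfl, rfl⟩ | ⟨rfl, rfl, rfl, rfl⟩⟩ :=
    δ.eq_last_of_isLink he h₁ h₂ hl₁ hl₂ hz hy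
  · exact δ.exists_replace_last hj hjl hx hpr hp hr hpl hrl h
  · rw [Set.pair_comm (δ.edge (Fin.last _)), Set.pair_comm p]
    rw [Set.pair_comm (δ.edge (Fin.last _))] at hp hr
    exact δ.exists_replace_last hj hjl hx hpr.symm hr hp hrl hpl
      fun e he h1 h2 ↦ h e he h2 h1

/-- A cycle that contains the three edges of a triangle is this triangle. -/
lemma range_edge_of_triangle (γ : Cycle G) {a b c : β} {u v w : α} (huv : u ≠ v) (hvw : v ≠ w)
    (ha : G.IsLink a u v) (hb : G.IsLink b v w) (hc : G.IsLink c w u) (hab : a ≠ b)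
    (hbc : b ≠ c) (hca : c ≠ a)
    (haγ : a ∈ Set.range γ.edge) (hbγ : b ∈ Set.range γ.edge) (hcγ : c ∈ Set.range γ.edge) :
    Set.range γ.edge = {a, b, c} := by
  obtain ⟨δ, rfl, hv, hE⟩ := γ.exists_rotate_vert_last (γ.mem_range_vert haγ ha.symm)
  rw [← hE] at haγ hbγ hcγ
  rw [← hE]
  obtain ⟨j, hj, hjl, hcase⟩ := δ.eq_last_of_isLink hab haγ hbγ ha hb.symm hvw huv.symm
  -- The third edge joins the two neighbours of the last vertex, so the indices are `0, 1, 2`.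
  obtain ⟨k, rfl⟩ := hcγ
  have hk : k = 0 ∧ k + 1 = j := by
    have hlink : G.IsLink (δ.edge k) (δ.vert 0) (δ.vert j) := by
      rcases hcase with ⟨-, -, rfl, rfl⟩ | ⟨-, -, rfl, rfl⟩
      exacts [hc, hc.symm]
    rcases hlink.eq_and_eq_or_eq_and_eq (δ.isLink k) with ⟨h1, h2⟩ | ⟨h1, h2⟩
    · exact ⟨(δ.vert_injective h1).symm, (δ.vert_injective h2).symm⟩
    · have h3 := δ.vert_injective h2
      have h4 := δ.vert_injective h1
      rw [← h3, ← Fin.last_add_one] at h4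
      exact absurd (add_right_cancel h4).symm hjl
  obtain ⟨hk0, hk1⟩ := hk
  have hset : ({δ.edge 0, δ.edge j, δ.edge (Fin.last _)} : Set β) = {a, b, δ.edge k} := by
    rw [hk0]
    rcases hcase with ⟨h1, h2, -, -⟩ | ⟨h1, h2, -, -⟩ <;> rw [h1, h2] <;> ext e <;>
      simp only [Set.mem_insert_iff, Set.mem_singleton_iff] <;> tauto
  rw [← hset]
  apply Set.Subset.antisymm
  · have hm : ∀ i : Fin (δ.m + 1), i = 0 ∨ i = j ∨ i = Fin.last _ := by
      have h2 : (0 : Fin (δ.m + 1)) + 1 + 1 = Fin.last _ := by rw [← hk0, hk1, hj]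
      rw [← hk1, hk0]
      revert h2
      generalize δ.m = n
      intro h2
      match n, h2 with
      | 0, _ => exact fun i ↦ Or.inl (Fin.ext (by omega))
      | 1, _ => decide
      | 2, _ => decide
      | n + 3, h2 =>
        exfalso
        have := congrArg Fin.val h2
        simp [Fin.val_add, Nat.mod_eq_of_lt] at this
    rintro _ ⟨i, rfl⟩
    rcases hm i with rfl | rfl | rfl <;> simp
  · rintro _ (rfl | rfl | rfl) <;> exact ⟨_, rfl⟩

end Cycle

/-! ### Straightening a `Y` -/

lemma IsArc.exists_straighten_off {A C : R4} {S Z : Set R4} (h : IsArc A S C) (hZ : IsTame Z)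
    (hZS : Z ∩ S ⊆ ray A) {U : Submodule ℝ R4} (hU : U ≠ ⊤) (hA : A ∈ U) :
    ∃ H : R4 ≃ₜ R4, IsPLIso H ∧ (∀ x ∈ Z, H x = x) ∧ H A = A ∧ H C ∉ U ∧
      LinearIndependent ℝ ![A, H C] ∧ H '' S = cone A (H C) := by
  obtain ⟨H₁, hH₁, hfix₁, hA₁, hli, him₁⟩ := h.exists_straighten Z hZ hZS
  have hq : ∀ s : ℝ, 0 ≤ s → H₁ C + s • A ∉ Z := by
    intro s hs hmem
    have h1 : H₁ C + s • A ∈ H₁ '' S := by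
      rw [him₁]
      exact ⟨s, 1, hs, zero_le_one, by module⟩
    obtain ⟨y, hy, hyq⟩ := h1
    have h2 : y = H₁ C + s • A := H₁.injective (by rw [hyq, hfix₁ _ hmem])
    exact add_smul_notMem_ray hli s (hZS ⟨hmem, h2 ▸ hy⟩)
  obtain ⟨H₂, hH₂, hfix₂, hA₂, hoff, him₂⟩ := exists_move_off_subspace hli hZ hq hU hA
  refine ⟨H₁.trans H₂, hH₁.trans hH₂, fun x hx ↦ by simp [hfix₁ x hx, hfix₂ x hx],
    by simp [hA₁, hA₂], hoff, ?_, ?_⟩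
  · refine linearIndependent_two_iff.2 fun r s h0 ↦ ?_
    have hs : s = 0 := by
      by_contra hs
      refine hoff ((U.smul_mem_iff hs).1 ?_)
      have : s • H₂ (H₁ C) = -(r • A) := eq_neg_of_add_eq_zero_right h0
      rw [this]
      exact U.neg_mem (U.smul_mem _ hA)
    subst hs
    have hA0 : A ≠ 0 := fun h ↦ one_ne_zero
      (linearIndependent_two_iff.1 hli 1 0 (by simp [h])).1
    exact ⟨(smul_eq_zero.1 (by simpa using h0)).resolve_right hA0, rfl⟩
  · change (H₂ ∘ H₁) '' S = _
    rw [Set.image_comp, him₁, him₂]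
    rfl

/-- Three arcs that meet only in their common first point are made straight and independent. -/
lemma exists_straighten_star {X U V W : R4} {P Q R : Set R4} (hP : IsArc X P U) (hQ : IsArc X Q V)
    (hR : IsArc X R W) (hPQ : P ∩ Q ⊆ ray X) (hPR : P ∩ R ⊆ ray X) (hQR : Q ∩ R ⊆ ray X) :
    ∃ H : R4 ≃ₜ R4, IsPLIso H ∧ H X = X ∧ LinearIndependent ℝ ![X, H U, H V, H W] ∧
      H '' P = cone X (H U) ∧ H '' Q = cone X (H V) ∧ H '' R = cone X (H W) := by
  have hend : ∀ {A C : R4} {S : Set R4}, IsArc A S C → C ∈ S := by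
    intro A C S h
    induction h with
    | segment _ => exact ray_subset_cone_right _ _ (self_mem_ray _)
    | cons _ _ _ ih => exact Or.inr ih
  have hfiximage : ∀ {S : Set R4} {H : R4 ≃ₜ R4}, (∀ x ∈ S, H x = x) → H '' S = S :=
    fun hH ↦ (Set.image_congr hH).trans (Set.image_id _)
  -- If `H` fixes `S`, then the image of `T` still meets `S` only in the ray of `X`.
  have hinter : ∀ {S T : Set R4} {H : R4 ≃ₜ R4}, (∀ x ∈ S, H x = x) → S ∩ T ⊆ ray X →
      S ∩ H '' T ⊆ ray X := by
    rintro S T H hH hST _ ⟨hx, y, hy, rfl⟩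
    have : y = H y := H.injective (hH _ hx).symm
    rw [← this] at hx ⊢
    exact hST ⟨hx, hy⟩
  have hU₁ := span_ne_top ![X] (by norm_num)
  obtain ⟨H₁, hH₁, hfix₁, hX₁, -, hli₁, him₁⟩ := hP.exists_straighten_off
    (hQ.isTame.union hR.isTame) (by
      rintro x ⟨hx | hx, hx'⟩
      exacts [hPQ ⟨hx', hx⟩, hPR ⟨hx', hx⟩]) hU₁ (Submodule.subset_span ⟨0, rfl⟩)
  set U' := H₁ U
  have hP' : ∀ {S : Set R4}, (∀ x ∈ S, H₁ x = x) → P ∩ S ⊆ ray X → S ∩ cone X U' ⊆ ray X :=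
    fun hS hPS ↦ him₁ ▸ hinter hS (by rwa [Set.inter_comm])
  obtain ⟨H₂, hH₂, hfix₂, hX₂, hV', -, him₂⟩ := hQ.exists_straighten_off
    ((isTame_cone X U').union hR.isTame) (by
      rintro x ⟨hx | hx, hx'⟩
      · exact hP' (fun x hx ↦ hfix₁ x (Or.inl hx)) hPQ ⟨hx', hx⟩
      · exact hQR ⟨hx', hx⟩) (span_ne_top ![X, U'] (by norm_num)) (Submodule.subset_span ⟨0, rfl⟩)
  set V' := H₂ V
  obtain ⟨H₃, hH₃, hfix₃, hX₃, hW', -, him₃⟩ := hR.exists_straighten_off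
    ((isTame_cone X U').union (isTame_cone X V')) (by
      rintro x ⟨hx | hx, hx'⟩
      · exact hP' (fun x hx ↦ hfix₁ x (Or.inr hx)) hPR ⟨hx', hx⟩
      · rw [← him₂] at hx
        exact hinter (fun x hx ↦ hfix₂ x (Or.inr hx)) (by rwa [Set.inter_comm]) ⟨hx', hx⟩)
    (span_ne_top ![X, U', V'] (by norm_num)) (Submodule.subset_span ⟨0, rfl⟩)
  set W' := H₃ W
  have hUcone : U' ∈ cone X U' := ray_subset_cone_right _ _ (self_mem_ray _)
  have hVcone : V' ∈ cone X V' := ray_subset_cone_right _ _ (self_mem_ray _)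
  have eU : ((H₁.trans H₂).trans H₃) U = U' := by
    change H₃ (H₂ U') = U'
    rw [hfix₂ _ (Or.inl hUcone), hfix₃ _ (Or.inl hUcone)]
  have eV : ((H₁.trans H₂).trans H₃) V = V' := by
    change H₃ (H₂ (H₁ V)) = V'
    rw [hfix₁ _ (Or.inl (hend hQ)), hfix₃ _ (Or.inr hVcone)]
  have eW : ((H₁.trans H₂).trans H₃) W = W' := by
    change H₃ (H₂ (H₁ W)) = W'
    rw [hfix₁ _ (Or.inr (hend hR)), hfix₂ _ (Or.inr (hend hR))]
  have eim : ∀ S : Set R4, ((H₁.trans H₂).trans H₃) '' S = H₃ '' (H₂ '' (H₁ '' S)) := fun S ↦ by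
    rw [← Set.image_comp, ← Set.image_comp]
    rfl
  refine ⟨(H₁.trans H₂).trans H₃, (hH₁.trans hH₂).trans hH₃, ?_, ?_, ?_, ?_, ?_⟩
  · change H₃ (H₂ (H₁ X)) = X
    rw [hX₁, hX₂, hX₃]
  · rw [eU, eV, eW]
    have h2 : LinearIndependent ℝ ![V', X, U'] := linearIndependent_finCons.2 ⟨hli₁, hV'⟩
    have h2' : LinearIndependent ℝ ![X, U', V'] := by
      rw [linearIndependent_three_iff] at h2 ⊢
      intro r s t h0
      obtain ⟨h1, h2, h3⟩ := h2 t r s (by rw [← h0]; module)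
      exact ⟨h2, h3, h1⟩
    have h3 : LinearIndependent ℝ ![W', X, U', V'] := linearIndependent_finCons.2 ⟨h2', hW'⟩
    rw [linearIndependent_four_iff] at h3 ⊢
    intro r s t u h0
    obtain ⟨h1, h2, h3, h4⟩ := h3 u r s t (by rw [← h0]; module)
    exact ⟨h2, h3, h4, h1⟩
  · rw [eim, eU, him₁, hfiximage fun x hx ↦ hfix₂ x (Or.inl hx),
      hfiximage fun x hx ↦ hfix₃ x (Or.inl hx)]
  · rw [eim, eV, hfiximage fun x hx ↦ hfix₁ x (Or.inl hx), him₂,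
      hfiximage fun x hx ↦ hfix₃ x (Or.inr hx)]
  · rw [eim, eW, hfiximage fun x hx ↦ hfix₁ x (Or.inr hx),
      hfiximage fun x hx ↦ hfix₂ x (Or.inr hx), him₃]

/-! ### The `ΔY`-exchange -/

/-- The data of a `ΔY`-exchange, as in `IsDeltaYExchange`, with names for all vertices and edges
involved. -/
structure IsExchange (GΔ GY : Graph α β) (u v w x : α) (a b c p q r : β) : Prop where
  huv : u ≠ v
  hvw : v ≠ w
  hwu : w ≠ u
  ha : GΔ.IsLink a u v
  hb : GΔ.IsLink b v w
  hc : GΔ.IsLink c w u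
  hx : x ∉ GΔ.vertexSet
  hpq : p ≠ q
  hqr : q ≠ r
  hrp : r ≠ p
  hnew : ∀ e ∈ ({p, q, r} : Set β), e ∉ GΔ.edgeSet \ {a, b, c}
  hV : GY.vertexSet = insert x GΔ.vertexSet
  hE : ∀ e y z, GY.IsLink e y z ↔
    (GΔ.IsLink e y z ∧ e ∉ ({a, b, c} : Set β)) ∨
    (e = p ∧ s(y, z) = s(x, u)) ∨ (e = q ∧ s(y, z) = s(x, v)) ∨ (e = r ∧ s(y, z) = s(x, w))

namespace IsExchange

variable {GΔ GY : Graph α β} {u v w x : α} {a b c p q r : β}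

lemma rotate (h : IsExchange GΔ GY u v w x a b c p q r) :
    IsExchange GΔ GY v w u x b c a q r p := by
  have h1 : ({b, c, a} : Set β) = {a, b, c} := by
    ext; simp only [Set.mem_insert_iff, Set.mem_singleton_iff]; tauto
  have h2 : ({q, r, p} : Set β) = {p, q, r} := by
    ext; simp only [Set.mem_insert_iff, Set.mem_singleton_iff]; tauto
  refine ⟨h.hvw, h.hwu, h.huv, h.hb, h.hc, h.ha, h.hx, h.hqr, h.hrp, h.hpq, ?_, h.hV, ?_⟩
  · rw [h1, h2]
    exact h.hnew
  · intro e y z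
    rw [h.hE, h1]
    tauto

lemma linkP (h : IsExchange GΔ GY u v w x a b c p q r) : GY.IsLink p x u :=
  (h.hE p x u).2 (Or.inr (Or.inl ⟨rfl, rfl⟩))

lemma linkQ (h : IsExchange GΔ GY u v w x a b c p q r) : GY.IsLink q x v :=
  h.rotate.linkP

lemma linkR (h : IsExchange GΔ GY u v w x a b c p q r) : GY.IsLink r x w :=
  h.rotate.rotate.linkP

lemma link_of_notMem (h : IsExchange GΔ GY u v w x a b c p q r) {e : β}
    (he : e ∉ ({a, b, c} : Set β)) {y z : α} (hl : GΔ.IsLink e y z) : GY.IsLink e y z :=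
  (h.hE e y z).2 (Or.inl ⟨hl, he⟩)

lemma ab (h : IsExchange GΔ GY u v w x a b c p q r) : a ≠ b := by
  rintro rfl
  rcases h.ha.eq_and_eq_or_eq_and_eq h.hb with ⟨h1, -⟩ | ⟨h1, -⟩
  exacts [h.huv h1, h.hwu h1.symm]

lemma bc (h : IsExchange GΔ GY u v w x a b c p q r) : b ≠ c := h.rotate.ab

lemma ca (h : IsExchange GΔ GY u v w x a b c p q r) : c ≠ a := h.rotate.rotate.ab

lemma mem_edgeSet (h : IsExchange GΔ GY u v w x a b c p q r) {e : β}
    (he : e ∈ GΔ.edgeSet \ {a, b, c}) : e ∈ GY.edgeSet := by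
  obtain ⟨y, z, hl⟩ := GΔ.exists_isLink_of_mem_edgeSet he.1
  exact (h.link_of_notMem he.2 hl).edge_mem

end IsExchange

namespace SpatialEmbedding

variable {G : Graph α β}

lemma edge_zero_one (f : SpatialEmbedding G) {e : β} (he : e ∈ G.edgeSet) {s : ℝ}
    (hs : s = 0 ∨ s = 1) : ∃ y, G.Inc e y ∧ f.edge e s = f.vert y := by
  obtain ⟨y, z, hl⟩ := G.exists_isLink_of_mem_edgeSet he
  rcases f.ends e y z hl with ⟨h0, h1⟩ | ⟨h0, h1⟩ <;> rcases hs with rfl | rfl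
  · exact ⟨y, hl.inc_left, h0⟩
  · exact ⟨z, hl.inc_right, h1⟩
  · exact ⟨z, hl.inc_right, h0⟩
  · exact ⟨y, hl.inc_left, h1⟩

lemma end_of_notMem_Ioo {s : ℝ} (hs : s ∈ Set.Icc (0 : ℝ) 1) (h : s ∉ Set.Ioo (0 : ℝ) 1) :
    s = 0 ∨ s = 1 := by
  by_contra! h0
  exact h ⟨lt_of_le_of_ne hs.1 h0.1.symm, lt_of_le_of_ne hs.2 h0.2⟩

/-- A vertex on an edge is an end of this edge. -/
lemma inc_of_edge_eq_vert (f : SpatialEmbedding G) {e : β} (he : e ∈ G.edgeSet) {s : ℝ}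
    (hs : s ∈ Set.Icc (0 : ℝ) 1) {y : α} (hy : y ∈ G.vertexSet) (h : f.edge e s = f.vert y) :
    G.Inc e y := by
  obtain ⟨z, hz, hz'⟩ := f.edge_zero_one he
    (end_of_notMem_Ioo hs fun hs' ↦ f.edge_ne_vert e he s hs' y hy h)
  rwa [f.vert_injOn hy hz.vertex_mem (h.symm.trans hz')]

/-- Two edges meet only in common ends. -/
lemma exists_inc_of_edge_eq (f : SpatialEmbedding G) {e e' : β} (he : e ∈ G.edgeSet)
    (he' : e' ∈ G.edgeSet) (hne : e ≠ e') {s s' : ℝ} (hs : s ∈ Set.Icc (0 : ℝ) 1)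
    (hs' : s' ∈ Set.Icc (0 : ℝ) 1) (h : f.edge e s = f.edge e' s') :
    ∃ y, G.Inc e y ∧ G.Inc e' y ∧ f.edge e s = f.vert y := by
  obtain ⟨y, hy, hy'⟩ := f.edge_zero_one he
    (end_of_notMem_Ioo hs fun hs0 ↦ hne (f.edge_inj e he e' he' s hs0 s' hs' h).1)
  exact ⟨y, hy, f.inc_of_edge_eq_vert he' hs' hy.vertex_mem (h.symm.trans hy'), hy'⟩

lemma edge_injOn (f : SpatialEmbedding G) {e : β} {y z : α} (hl : G.IsLink e y z) (hyz : y ≠ z) :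
    Set.InjOn (f.edge e) (Set.Icc 0 1) := by
  have he := hl.edge_mem
  have hne : f.edge e 0 ≠ f.edge e 1 := by
    have h := f.vert_injOn.ne hl.left_mem hl.right_mem hyz
    rcases f.ends e y z hl with ⟨h0, h1⟩ | ⟨h0, h1⟩ <;> rw [h0, h1]
    exacts [h, h.symm]
  intro s hs t ht hst
  by_cases hs' : s ∈ Set.Ioo (0 : ℝ) 1
  · exact (f.edge_inj e he e he s hs' t ht hst).2
  by_cases ht' : t ∈ Set.Ioo (0 : ℝ) 1
  · exact (f.edge_inj e he e he t ht' s hs hst.symm).2.symm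
  rcases end_of_notMem_Ioo hs hs' with rfl | rfl <;>
    rcases end_of_notMem_Ioo ht ht' with rfl | rfl
  exacts [rfl, absurd hst hne, absurd hst.symm hne, rfl]

/-- The image of an edge. -/
def arc (f : SpatialEmbedding G) (e : β) : Set S3 := f.edge e '' Set.Icc (0 : ℝ) 1

lemma isArc (f : SpatialEmbedding G) {e : β} {y z : α} (hl : G.IsLink e y z) (hyz : y ≠ z) :
    IsArc (f.vert y) (coneOver (f.arc e)) (f.vert z) := by
  have hc := f.isPLPath e hl.edge_mem
  have hinj := f.edge_injOn hl hyz
  rcases f.ends e y z hl with ⟨h0, h1⟩ | ⟨h0, h1⟩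
  · have := hc.isArc hinj
    rwa [h0, h1] at this
  · have hrev : Set.InjOn (fun s ↦ f.edge e (1 - s)) (Set.Icc 0 1) := by
      intro s hs t ht hst
      have := hinj ⟨by linarith [hs.2], by linarith [hs.1]⟩
        ⟨by linarith [ht.2], by linarith [ht.1]⟩ hst
      linarith
    have := hc.reverse.isArc hrev
    have him : (fun s ↦ f.edge e (1 - s)) '' Set.Icc 0 1 = f.arc e := by
      change (f.edge e ∘ fun s ↦ 1 - s) '' Set.Icc 0 1 = _
      rw [Set.image_comp]
      simp [arc]
    rw [him] at this
    simpa [h0, h1] using this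

lemma image_eq (f : SpatialEmbedding G) (γ : Cycle G) :
    f.image γ = ⋃ e ∈ Set.range γ.edge, f.arc e := by
  rw [Set.biUnion_range]
  rfl

lemma isTame_arc (f : SpatialEmbedding G) {e : β} (he : e ∈ G.edgeSet) :
    IsTame (coneOver (f.arc e)) := (f.isPLPath e he).isTame

end SpatialEmbedding

lemma SpatialEmbedding.arc_inter_subset {G : Graph α β} (f : SpatialEmbedding G) {e e' : β}
    (he : e ∈ G.edgeSet) (he' : e' ∈ G.edgeSet) (hne : e ≠ e') {z : α}
    (hz : ∀ y, G.Inc e y → G.Inc e' y → y = z) : f.arc e ∩ f.arc e' ⊆ {f.vert z} := by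
  rintro _ ⟨⟨s, hs, rfl⟩, s', hs', h⟩
  obtain ⟨y, hy, hy', hv⟩ := f.exists_inc_of_edge_eq he he' hne hs hs' h.symm
  rw [Set.mem_singleton_iff, hv, hz y hy hy']

lemma inc_iff_of_isLink {G : Graph α β} {e : β} {y z t : α} (h : G.IsLink e y z) :
    G.Inc e t ↔ t = y ∨ t = z := by
  constructor
  · rintro ⟨t', ht⟩
    exact ht.left_eq_or_eq h
  · rintro (rfl | rfl)
    exacts [h.inc_left, h.inc_right]

namespace IsExchange

variable {GΔ GY : Graph α β} {u v w x : α} {a b c p q r : β}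

lemma inc_iff (h : IsExchange GΔ GY u v w x a b c p q r) {e : β} (he : e ∈ GΔ.edgeSet \ {a, b, c})
    {y : α} : GY.Inc e y ↔ GΔ.Inc e y := by
  obtain ⟨y', z', hl⟩ := GΔ.exists_isLink_of_mem_edgeSet he.1
  rw [inc_iff_of_isLink hl, inc_iff_of_isLink (h.link_of_notMem he.2 hl)]

lemma ne_x (h : IsExchange GΔ GY u v w x a b c p q r) {y : α} (hy : y ∈ GΔ.vertexSet) : y ≠ x :=
  fun hyx ↦ h.hx (hyx ▸ hy)

lemma mem_vertexSet (h : IsExchange GΔ GY u v w x a b c p q r) {y : α} (hy : y ∈ GΔ.vertexSet) :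
    y ∈ GY.vertexSet := by
  rw [h.hV]
  exact Or.inr hy

/-- The image of the common part of the two graphs. -/
def commonImage (_ : IsExchange GΔ GY u v w x a b c p q r) (f : SpatialEmbedding GY) : Set S3 :=
  f.vert '' GΔ.vertexSet ∪ ⋃ e ∈ GΔ.edgeSet \ {a, b, c}, f.arc e

lemma isTame_commonImage (h : IsExchange GΔ GY u v w x a b c p q r) (f : SpatialEmbedding GY)
    (hV : GΔ.vertexSet.Finite) (hE : GΔ.edgeSet.Finite) : IsTame (coneOver (h.commonImage f)) := by
  rw [commonImage, coneOver_union, coneOver_biUnion, ← Set.biUnion_of_singleton (f.vert '' _),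
    coneOver_biUnion]
  refine (isTame_biUnion (hV.image _) fun y _ ↦ ?_).union
    (isTame_biUnion hE.sdiff fun e he ↦ f.isTame_arc (h.mem_edgeSet he))
  rw [coneOver_singleton]
  exact isTame_ray _

lemma commonImage_rotate (h : IsExchange GΔ GY u v w x a b c p q r) (f : SpatialEmbedding GY) :
    h.rotate.commonImage f = h.commonImage f := by
  rw [commonImage, commonImage, show ({b, c, a} : Set β) = {a, b, c} by
    ext; simp only [Set.mem_insert_iff, Set.mem_singleton_iff]; tauto]

lemma arc_inter_commonImage (h : IsExchange GΔ GY u v w x a b c p q r) (f : SpatialEmbedding GY) :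
    f.arc p ∩ h.commonImage f ⊆ {f.vert u} := by
  rintro P ⟨hP, ⟨y, hy, rfl⟩ | hP'⟩
  · obtain ⟨s, hs, hs'⟩ := hP
    have := f.inc_of_edge_eq_vert h.linkP.edge_mem hs (h.mem_vertexSet hy) hs'
    rcases (inc_iff_of_isLink h.linkP).1 this with rfl | rfl
    exacts [absurd rfl (h.ne_x hy), rfl]
  · simp only [Set.mem_iUnion, exists_prop] at hP'
    obtain ⟨e, he, hPe⟩ := hP'
    refine f.arc_inter_subset h.linkP.edge_mem (h.mem_edgeSet he)
      (fun hpe ↦ h.hnew p (by simp) (hpe ▸ he)) (fun y hy hy' ↦ ?_) ⟨hP, hPe⟩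
    rcases (inc_iff_of_isLink h.linkP).1 hy with rfl | rfl
    exacts [absurd rfl (h.ne_x ((h.inc_iff he).1 hy').vertex_mem), rfl]

lemma arc_inter_arc (h : IsExchange GΔ GY u v w x a b c p q r) (f : SpatialEmbedding GY) :
    f.arc p ∩ f.arc q ⊆ {f.vert x} := by
  refine f.arc_inter_subset h.linkP.edge_mem h.linkQ.edge_mem h.hpq fun y hy hy' ↦ ?_
  rcases (inc_iff_of_isLink h.linkP).1 hy with rfl | rfl
  · rfl
  · rcases (inc_iff_of_isLink h.linkQ).1 hy' with h1 | h1
    exacts [h1, absurd h1 h.huv]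

end IsExchange

/-! ### Embeddings with a straight `Y` -/

/-- The edges of the `Y` are straight, with centre `X` and ends `U`, `V`, `W` (in homogeneous
coordinates), and the set `K` meets a neighbourhood of the `Y` only in its three ends. -/
structure IsStraight {G : Graph α β} (f : SpatialEmbedding G) (K : Set S3) (u v w : α)
    (p q r : β) (X U V W : R4) : Prop where
  indep : LinearIndependent ℝ ![X, U, V, W]
  posU : ∃ ρ : ℝ, 0 < ρ ∧ U = ρ • (f.vert u : R4)
  posV : ∃ ρ : ℝ, 0 < ρ ∧ V = ρ • (f.vert v : R4)
  posW : ∃ ρ : ℝ, 0 < ρ ∧ W = ρ • (f.vert w : R4)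
  thinU : IsThinAt (coneOver K) U X V W
  thinV : IsThinAt (coneOver K) V X U W
  thinW : IsThinAt (coneOver K) W X U V
  arcP : coneOver (f.arc p) = cone X U
  arcQ : coneOver (f.arc q) = cone X V
  arcR : coneOver (f.arc r) = cone X W

lemma IsStraight.rotate {G : Graph α β} {f : SpatialEmbedding G} {K : Set S3} {u v w : α}
    {p q r : β} {X U V W : R4} (h : IsStraight f K u v w p q r X U V W) :
    IsStraight f K v w u q r p X V W U where
  indep := by
    have := h.indep
    rw [linearIndependent_four_iff] at this ⊢
    intro r s t u h0
    obtain ⟨h1, h2, h3, h4⟩ := this r u s t (by rw [← h0]; module)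
    exact ⟨h1, h3, h4, h2⟩
  posU := h.posV
  posV := h.posW
  posW := h.posU
  thinU := h.thinV.swap
  thinV := h.thinW.swap
  thinW := h.thinU
  arcP := h.arcQ
  arcQ := h.arcR
  arcR := h.arcP

/-- A set that meets the segment from `B` to `A` only in `A` stays off a thin neighbourhood of this
segment. -/
lemma IsTame.exists_isThinAt {L : Set R4} (hL : IsTame L) {A B : R4} (E₁ E₂ : R4)
    (hAB : LinearIndependent ℝ ![A, B]) (h : cone B A ∩ L ⊆ ray A) :
    ∃ η₀ > 0, ∀ η : ℝ, 0 < η → η ≤ η₀ → IsThinAt L (η • A) B (η • E₁) (η • E₂) := by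
  obtain ⟨η₀, hη₀, H⟩ := hL.exists_thin E₁ E₂ fun s hs hmem ↦
    add_smul_notMem_ray hAB s (h ⟨⟨1, s, zero_le_one, hs, by module⟩, hmem⟩)
  refine ⟨η₀, hη₀, fun η hη hle a b c d ha hb hc hd hmem ↦ ?_⟩
  by_contra hne
  refine H η hη.le hle (a * η) b c d (by positivity) hb hc hd ?_ (by rwa [← smul_smul])
  by_contra hle
  exact hne ⟨by linarith, by linarith, by linarith⟩

/-- Every embedding of `GY` can be changed by a homeomorphism so that the edges of the `Y` become
straight. -/
lemma IsExchange.exists_isStraight {GΔ GY : Graph α β} {u v w x : α} {a b c p q r : β}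
    (h : IsExchange GΔ GY u v w x a b c p q r) (hV : GΔ.vertexSet.Finite)
    (hE : GΔ.edgeSet.Finite) (f : SpatialEmbedding GY) :
    ∃ (H : R4 ≃ₜ R4) (hH : IsPLIso H) (X U V W : R4),
      IsStraight (f.map hH) (h.commonImage (f.map hH)) u v w p q r X U V W := by
  have hxu := (h.ne_x h.ha.left_mem).symm
  have hxv := (h.ne_x h.hb.left_mem).symm
  have hxw := (h.ne_x h.hc.left_mem).symm
  obtain ⟨H, hH, hX, hli, hP, hQ, hR⟩ := exists_straighten_star (f.isArc h.linkP hxu)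
    (f.isArc h.linkQ hxv) (f.isArc h.linkR hxw)
    (coneOver_inter_subset (h.arc_inter_arc f))
    (by rw [Set.inter_comm]; exact coneOver_inter_subset (h.rotate.rotate.arc_inter_arc f))
    (coneOver_inter_subset (h.rotate.arc_inter_arc f))
  have harc : ∀ e, coneOver ((f.map hH).arc e) = H '' coneOver (f.arc e) := fun e ↦ by
    rw [← hH.coneOver_image]
    simp only [SpatialEmbedding.arc, Set.image_image]
    rfl
  rw [← harc] at hP hQ hR
  have hvert : ∀ y, H (f.vert y) = ‖H (f.vert y)‖ • ((f.map hH).vert y : R4) :=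
    fun y ↦ hH.apply_eq _
  have hpos : ∀ y, 0 < ‖H (f.vert y)‖ := fun y ↦ hH.norm_pos _
  have hray : ∀ y, ray (H (f.vert y)) = ray ((f.map hH).vert y : R4) := fun y ↦ by
    rw [hvert y, ray_smul _ (hpos y)]
  set f' := f.map hH
  set U := H (f.vert u)
  set V := H (f.vert v)
  set W := H (f.vert w)
  set X : R4 := (f.vert x : R4)
  have hT := h.isTame_commonImage f' hV hE
  have hU2 : LinearIndependent ℝ ![U, X] := linearIndependent_two_iff.2 fun r s h0 ↦ by
    obtain ⟨h1, h2, -, -⟩ := linearIndependent_four_iff.1 hli s r 0 0 (by rw [← h0]; module)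
    exact ⟨h2, h1⟩
  have hV2 : LinearIndependent ℝ ![V, X] := linearIndependent_two_iff.2 fun r s h0 ↦ by
    obtain ⟨h1, -, h2, -⟩ := linearIndependent_four_iff.1 hli s 0 r 0 (by rw [← h0]; module)
    exact ⟨h2, h1⟩
  have hW2 : LinearIndependent ℝ ![W, X] := linearIndependent_two_iff.2 fun r s h0 ↦ by
    obtain ⟨h1, -, -, h2⟩ := linearIndependent_four_iff.1 hli s 0 0 r (by rw [← h0]; module)
    exact ⟨h2, h1⟩
  obtain ⟨η₁, hη₁, H₁⟩ := hT.exists_isThinAt V W hU2 (by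
    rw [← hP, hray u]
    exact coneOver_inter_subset (h.arc_inter_commonImage f'))
  obtain ⟨η₂, hη₂, H₂⟩ := hT.exists_isThinAt U W hV2 (by
    rw [← hQ, hray v, ← h.commonImage_rotate f']
    exact coneOver_inter_subset (h.rotate.arc_inter_commonImage f'))
  obtain ⟨η₃, hη₃, H₃⟩ := hT.exists_isThinAt U V hW2 (by
    rw [← hR, hray w, ← h.commonImage_rotate f', ← h.rotate.commonImage_rotate f']
    exact coneOver_inter_subset (h.rotate.rotate.arc_inter_commonImage f'))
  obtain ⟨η, hη, h1, h2, h3⟩ : ∃ η : ℝ, 0 < η ∧ η ≤ η₁ ∧ η ≤ η₂ ∧ η ≤ η₃ :=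
    ⟨min η₁ (min η₂ η₃), by positivity, min_le_left _ _, (min_le_right _ _).trans (min_le_left _ _),
      (min_le_right _ _).trans (min_le_right _ _)⟩
  have hmul : ∀ y, ∃ ρ : ℝ, 0 < ρ ∧ η • H (f.vert y) = ρ • (f'.vert y : R4) := fun y ↦
    ⟨η * ‖H (f.vert y)‖, mul_pos hη (hpos y), by rw [← smul_smul, ← hvert y]⟩
  refine ⟨H, hH, X, η • U, η • V, η • W, ?_, hmul u, hmul v, hmul w, H₁ η hη h1, H₂ η hη h2,
    H₃ η hη h3, ?_, ?_, ?_⟩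
  · rw [linearIndependent_four_iff] at hli ⊢
    intro r s t k h0
    obtain ⟨e1, e2, e3, e4⟩ := hli r (s * η) (t * η) (k * η) (by rw [← h0]; module)
    exact ⟨e1, (mul_eq_zero.1 e2).resolve_right hη.ne', (mul_eq_zero.1 e3).resolve_right hη.ne',
      (mul_eq_zero.1 e4).resolve_right hη.ne'⟩
  · rw [hP, cone_smul_right _ _ hη]
  · rw [hQ, cone_smul_right _ _ hη]
  · rw [hR, cone_smul_right _ _ hη]

/-! ### The embedding of the graph before the exchange -/

namespace IsStraight

variable {G : Graph α β} {f : SpatialEmbedding G} {K : Set S3} {u v w : α} {p q r : β}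
  {X U V W : R4}

lemma eq_of_mem_ray (h : IsStraight f K u v w p q r X U V W) {y : S3} (hy : (y : R4) ∈ ray U) :
    y = f.vert u := by
  obtain ⟨ρ, hρ, rfl⟩ := h.posU
  rw [ray_smul _ hρ, ← coneOver_singleton, mem_coneOver] at hy
  exact hy

/-- The new edge from `u` to `v` meets the common image only in its ends. -/
lemma path_inter_subset (h : IsStraight f K u v w p q r X U V W) :
    (cone U (corner X U V) ∪ cone (corner X U V) V) ∩ coneOver K ⊆ ray U ∪ ray V := by
  rintro _ ⟨⟨s, t, hs, ht, rfl⟩ | ⟨s, t, hs, ht, rfl⟩, hK⟩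
  · obtain ⟨h1, -, -⟩ := h.thinU (s + t) t t 0 (by positivity) ht ht le_rfl
      (by convert hK using 1; unfold corner; module)
    exact Or.inl ⟨s, hs, by simp [h1]⟩
  · obtain ⟨h1, -, -⟩ := h.thinV (s + t) s s 0 (by positivity) hs hs le_rfl
      (by convert hK using 1; unfold corner; module)
    exact Or.inr ⟨t, ht, by simp [h1]⟩

/-- Two of the new edges meet only in their common end. -/
lemma path_inter_path (h : IsStraight f K u v w p q r X U V W) :
    (cone U (corner X U V) ∪ cone (corner X U V) V) ∩
      (cone V (corner X V W) ∪ cone (corner X V W) W) ⊆ ray V := by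
  rintro y ⟨hy, hy'⟩
  -- The `U`-coordinate vanishes on the second path; on the first, it vanishes only in the ray of `V`.
  obtain ⟨k, l, m, hk, hm, rfl, hkm⟩ : ∃ k l m : ℝ, 0 ≤ k ∧ 0 ≤ m ∧
      y = k • X + l • U + m • V ∧ (k = 0 ∨ l ≠ 0) := by
    rcases hy with ⟨s, t, hs, ht, rfl⟩ | ⟨s, t, hs, ht, rfl⟩
    · refine ⟨2 * t, s + t, t, by positivity, ht, by unfold corner; module, ?_⟩
      rcases ht.eq_or_lt with rfl | ht
      exacts [Or.inl (by simp), Or.inr (by positivity)]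
    · refine ⟨2 * s, s, s + t, by positivity, by positivity, by unfold corner; module, ?_⟩
      rcases eq_or_ne s 0 with rfl | hs
      exacts [Or.inl (by simp), Or.inr hs]
  have hl : l = 0 := by
    rcases hy' with ⟨s, t, hs, ht, e⟩ | ⟨s, t, hs, ht, e⟩
    · exact (coeff_eq h.indep e (x := k) (u := l) (v := m) (w := 0) (x' := 2 * t) (u' := 0)
        (v' := s + t) (w' := t) (by module) (by unfold corner; module)).2.1
    · exact (coeff_eq h.indep e (x := k) (u := l) (v := m) (w := 0) (x' := 2 * s) (u' := 0)
        (v' := s) (w' := s + t) (by module) (by unfold corner; module)).2.1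
  subst hl
  obtain rfl : k = 0 := hkm.resolve_right (not_not_intro rfl)
  exact ⟨m, hm, by simp⟩

/-- The new edge from `u` to `v` runs close to the edges `xu` and `xv`. -/
lemma exists_path (h : IsStraight f K u v w p q r X U V W) :
    ∃ c : ℝ → S3, IsPLPath c ∧ Set.InjOn c (Set.Icc 0 1) ∧ c 0 = f.vert u ∧ c 1 = f.vert v ∧
      coneOver (c '' Set.Icc 0 1) = cone U (corner X U V) ∪ cone (corner X U V) V ∧
      ∀ s ∈ Set.Icc (0 : ℝ) 1, c s ∈ K → c s = f.vert u ∨ c s = f.vert v := by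
  obtain ⟨c, hc, hinj, h0, h1, him⟩ := exists_corner_path (A := U) (M := corner X U V) (B := V)
    (linearIndependent_two_iff.2 fun s t h0 ↦ by
      obtain ⟨h1, h2, h3, -⟩ := linearIndependent_four_iff.1 h.indep (2 * t) (s + t) t 0
        (by rw [← h0]; unfold corner; module)
      exact ⟨by linarith, h3⟩)
    (linearIndependent_two_iff.2 fun s t h0 ↦ by
      obtain ⟨h1, h2, h3, -⟩ := linearIndependent_four_iff.1 h.indep (2 * s) s (s + t) 0
        (by rw [← h0]; unfold corner; module)
      exact ⟨h2, by linarith⟩)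
    (by
      rintro _ ⟨⟨s, t, hs, ht, rfl⟩, s', t', hs', ht', e⟩
      obtain ⟨h1, h2, h3, -⟩ := coeff_eq h.indep e (x := 2 * t) (u := s + t) (v := t) (w := 0)
        (x' := 2 * s') (u' := s') (v' := s' + t') (w' := 0) (by unfold corner; module)
        (by unfold corner; module)
      obtain rfl : s = 0 := by linarith
      exact ⟨t, ht, by simp⟩)
  obtain ⟨ρ, hρ, hU⟩ := h.posU
  obtain ⟨σ, hσ, hV⟩ := h.posV
  refine ⟨c, hc, hinj, ?_, ?_, him, fun s hs hK ↦ ?_⟩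
  · rw [h0, hU, radial_smul _ hρ]
  · rw [h1, hV, radial_smul _ hσ]
  · have hmem : (c s : R4) ∈ coneOver (c '' Set.Icc 0 1) := mem_coneOver.2 ⟨s, hs, rfl⟩
    rw [him] at hmem
    rcases h.path_inter_subset ⟨hmem, mem_coneOver.2 hK⟩ with h1 | h1
    exacts [Or.inl (h.eq_of_mem_ray h1), Or.inr (h.rotate.eq_of_mem_ray h1)]

end IsStraight

/-- The embeddings `f` of `GY` and `g` of `GΔ` agree away from the exchange, where the edges of
the `Y` are straight and the edges of the `Δ` run close to them. -/
structure IsCompanion {GΔ GY : Graph α β} (f : SpatialEmbedding GY) (g : SpatialEmbedding GΔ)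
    (K : Set S3) (u v w x : α) (a b c p q r : β) (X U V W : R4) : Prop where
  exch : IsExchange GΔ GY u v w x a b c p q r
  straight : IsStraight f K u v w p q r X U V W
  vert : g.vert = f.vert
  edge : ∀ e, e ≠ a → e ≠ b → e ≠ c → g.edge e = f.edge e
  arc_subset : ∀ e ∈ GΔ.edgeSet, e ≠ a → e ≠ b → e ≠ c → f.arc e ⊆ K
  arcA : coneOver (g.arc a) = cone U (corner X U V) ∪ cone (corner X U V) V
  arcB : coneOver (g.arc b) = cone V (corner X V W) ∪ cone (corner X V W) W
  arcC : coneOver (g.arc c) = cone W (corner X W U) ∪ cone (corner X W U) U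

lemma IsCompanion.rotate {GΔ GY : Graph α β} {f : SpatialEmbedding GY} {g : SpatialEmbedding GΔ}
    {K : Set S3} {u v w x : α} {a b c p q r : β} {X U V W : R4}
    (h : IsCompanion f g K u v w x a b c p q r X U V W) :
    IsCompanion f g K v w u x b c a q r p X V W U where
  exch := h.exch.rotate
  straight := h.straight.rotate
  vert := h.vert
  edge e hb hc ha := h.edge e ha hb hc
  arc_subset e he hb hc ha := h.arc_subset e he ha hb hc
  arcA := h.arcB
  arcB := h.arcC
  arcC := h.arcA

/-- The triangle is embedded close to the straight `Y`. -/
lemma IsExchange.exists_isCompanion {GΔ GY : Graph α β} {u v w x : α} {a b c p q r : β}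
    (h : IsExchange GΔ GY u v w x a b c p q r) {f : SpatialEmbedding GY} {X U V W : R4}
    (hf : IsStraight f (h.commonImage f) u v w p q r X U V W) :
    ∃ g : SpatialEmbedding GΔ,
      IsCompanion f g (h.commonImage f) u v w x a b c p q r X U V W := by
  classical
  obtain ⟨ca, hca, inja, a0, a1, ima, aK⟩ := hf.exists_path
  obtain ⟨cb, hcb, injb, b0, b1, imb, bK⟩ := hf.rotate.exists_path
  obtain ⟨cc, hcc, injc, c0, c1, imc, cK⟩ := hf.rotate.rotate.exists_path
  -- Two of the new edges meet only in their common end.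
  have cross : ∀ {c c' : ℝ → S3} {s s' : ℝ}, s ∈ Set.Icc (0 : ℝ) 1 → s' ∈ Set.Icc (0 : ℝ) 1 →
      c s = c' s' → (c s : R4) ∈ coneOver (c '' Set.Icc 0 1) ∩ coneOver (c' '' Set.Icc 0 1) :=
    fun hs hs' heq ↦ ⟨mem_coneOver.2 ⟨_, hs, rfl⟩, mem_coneOver.2 ⟨_, hs', heq.symm⟩⟩
  have vertK : ∀ y ∈ GΔ.vertexSet, f.vert y ∈ h.commonImage f := fun y hy ↦ Or.inl ⟨y, hy, rfl⟩
  have arcK : ∀ e ∈ GΔ.edgeSet \ {a, b, c}, f.arc e ⊆ h.commonImage f :=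
    fun e he ↦ (Set.subset_biUnion_of_mem (u := f.arc) he).trans Set.subset_union_right
  let E : β → ℝ → S3 := fun e ↦ if e = a then ca else if e = b then cb else if e = c then cc
    else f.edge e
  have Ea : E a = ca := if_pos rfl
  have Eb : E b = cb := (if_neg h.ab.symm).trans (if_pos rfl)
  have Ec : E c = cc := (if_neg h.ca).trans ((if_neg h.bc.symm).trans (if_pos rfl))
  have Ee : ∀ e, e ≠ a → e ≠ b → e ≠ c → E e = f.edge e := fun e ha hb hc ↦
    (if_neg ha).trans ((if_neg hb).trans (if_neg hc))
  have Ee' : ∀ e ∈ GΔ.edgeSet \ {a, b, c}, E e = f.edge e := fun e he ↦ by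
    have := he.2
    simp only [Set.mem_insert_iff, Set.mem_singleton_iff, not_or] at this
    exact Ee e this.1 this.2.1 this.2.2
  have cover : ∀ e ∈ GΔ.edgeSet, e = a ∨ e = b ∨ e = c ∨ e ∈ GΔ.edgeSet \ {a, b, c} := by
    intro e he
    by_cases h' : e ∈ ({a, b, c} : Set β)
    · simp only [Set.mem_insert_iff, Set.mem_singleton_iff] at h'
      tauto
    · exact Or.inr (Or.inr (Or.inr ⟨he, h'⟩))
  -- The edges avoid the vertices.
  have avoid : ∀ {c : ℝ → S3} {y z : α}, Set.InjOn c (Set.Icc 0 1) → c 0 = f.vert y →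
      c 1 = f.vert z →
      (∀ s ∈ Set.Icc (0 : ℝ) 1, c s ∈ h.commonImage f → c s = f.vert y ∨ c s = f.vert z) →
      ∀ s ∈ Set.Ioo (0 : ℝ) 1, ∀ t ∈ GΔ.vertexSet, c s ≠ f.vert t := by
    intro c y z hinj h0 h1 hcK s hs t ht heq
    have hs' := Set.Ioo_subset_Icc_self hs
    rcases hcK s hs' (heq ▸ vertK t ht) with h2 | h2
    · exact hs.1.ne' (hinj hs' ⟨le_rfl, zero_le_one⟩ (h2.trans h0.symm))
    · exact hs.2.ne (hinj hs' ⟨zero_le_one, le_rfl⟩ (h2.trans h1.symm))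
  have ne_vert : ∀ e ∈ GΔ.edgeSet, ∀ s ∈ Set.Ioo (0 : ℝ) 1, ∀ t ∈ GΔ.vertexSet,
      E e s ≠ f.vert t := by
    intro e he
    rcases cover e he with rfl | rfl | rfl | he'
    · rw [Ea]
      exact avoid inja a0 a1 aK
    · rw [Eb]
      exact avoid injb b0 b1 bK
    · rw [Ec]
      exact avoid injc c0 c1 cK
    · rw [Ee' e he']
      exact fun s hs t ht ↦ f.edge_ne_vert e (h.mem_edgeSet he') s hs t (h.mem_vertexSet ht)
  -- Different edges meet only in vertices.
  let Meets : β → β → Prop := fun e e' ↦ ∀ s ∈ Set.Icc (0 : ℝ) 1, ∀ s' ∈ Set.Icc (0 : ℝ) 1,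
    E e s = E e' s' → ∃ y ∈ GΔ.vertexSet, E e s = f.vert y
  have Meets_symm : ∀ {e e'}, Meets e e' → Meets e' e := fun hm s hs s' hs' heq ↦ by
    obtain ⟨y, hy, h'⟩ := hm s' hs' s hs heq.symm
    exact ⟨y, hy, heq.trans h'⟩
  have mab : Meets a b := fun s hs s' hs' heq ↦ by
    rw [Ea, Eb] at heq
    have := cross hs hs' heq
    rw [ima, imb] at this
    exact ⟨v, h.hb.left_mem, by rw [Ea, hf.rotate.eq_of_mem_ray (hf.path_inter_path this)]⟩
  have mbc : Meets b c := fun s hs s' hs' heq ↦ by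
    rw [Eb, Ec] at heq
    have := cross hs hs' heq
    rw [imb, imc] at this
    exact ⟨w, h.hc.left_mem,
      by rw [Eb, hf.rotate.rotate.eq_of_mem_ray (hf.rotate.path_inter_path this)]⟩
  have mca : Meets c a := fun s hs s' hs' heq ↦ by
    rw [Ec, Ea] at heq
    have := cross hs hs' heq
    rw [imc, ima] at this
    exact ⟨u, h.ha.left_mem, by rw [Ec, hf.eq_of_mem_ray (hf.rotate.rotate.path_inter_path this)]⟩
  have mnew : ∀ {e d : β} {y z : α}, y ∈ GΔ.vertexSet → z ∈ GΔ.vertexSet →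
      (∀ s ∈ Set.Icc (0 : ℝ) 1, E d s ∈ h.commonImage f → E d s = f.vert y ∨ E d s = f.vert z) →
      e ∈ GΔ.edgeSet \ {a, b, c} → Meets d e := by
    intro e d y z hy hz hd he s hs s' hs' heq
    rw [Ee' e he] at heq
    rcases hd s hs (heq ▸ arcK e he ⟨s', hs', rfl⟩) with h' | h'
    exacts [⟨y, hy, h'⟩, ⟨z, hz, h'⟩]
  have ma : ∀ e ∈ GΔ.edgeSet \ {a, b, c}, Meets a e := fun e ↦
    mnew h.ha.left_mem h.hb.left_mem (by rwa [Ea])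
  have mb : ∀ e ∈ GΔ.edgeSet \ {a, b, c}, Meets b e := fun e ↦
    mnew h.hb.left_mem h.hc.left_mem (by rwa [Eb])
  have mc : ∀ e ∈ GΔ.edgeSet \ {a, b, c}, Meets c e := fun e ↦
    mnew h.hc.left_mem h.ha.left_mem (by rwa [Ec])
  have mold : ∀ e ∈ GΔ.edgeSet \ {a, b, c}, ∀ e' ∈ GΔ.edgeSet \ {a, b, c}, e ≠ e' →
      Meets e e' := by
    intro e he e' he' hne s hs s' hs' heq
    rw [Ee' e he, Ee' e' he'] at heq
    obtain ⟨y, hy, -, h'⟩ := f.exists_inc_of_edge_eq (h.mem_edgeSet he) (h.mem_edgeSet he') hne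
      hs hs' heq
    exact ⟨y, ((h.inc_iff he).1 hy).vertex_mem, by rw [Ee' e he, h']⟩
  have meets : ∀ e ∈ GΔ.edgeSet, ∀ e' ∈ GΔ.edgeSet, e ≠ e' → Meets e e' := by
    intro e he e' he' hne
    rcases cover e he with rfl | rfl | rfl | he <;> rcases cover e' he' with rfl | rfl | rfl | he'
    exacts [absurd rfl hne, mab, Meets_symm mca, ma _ he', Meets_symm mab, absurd rfl hne, mbc,
      mb _ he', mca, Meets_symm mbc, absurd rfl hne, mc _ he', Meets_symm (ma _ he),
      Meets_symm (mb _ he), Meets_symm (mc _ he), mold _ he _ he' hne]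
  have injE : ∀ e ∈ GΔ.edgeSet, ∀ s ∈ Set.Ioo (0 : ℝ) 1, ∀ s' ∈ Set.Icc (0 : ℝ) 1,
      E e s = E e s' → s = s' := by
    intro e he s hs s' hs' heq
    have hs0 := Set.Ioo_subset_Icc_self hs
    rcases cover e he with rfl | rfl | rfl | he'
    · rw [Ea] at heq
      exact inja hs0 hs' heq
    · rw [Eb] at heq
      exact injb hs0 hs' heq
    · rw [Ec] at heq
      exact injc hs0 hs' heq
    · rw [Ee' e he'] at heq
      exact (f.edge_inj e (h.mem_edgeSet he') e (h.mem_edgeSet he') s hs s' hs' heq).2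
  have hends : ∀ {c : ℝ → S3} {e : β} {y z y' z' : α}, c 0 = f.vert y → c 1 = f.vert z →
      GΔ.IsLink e y z → GΔ.IsLink e y' z' →
      (c 0 = f.vert y' ∧ c 1 = f.vert z') ∨ (c 0 = f.vert z' ∧ c 1 = f.vert y') := by
    intro c e y z y' z' h0 h1 hl hl'
    rcases hl.eq_and_eq_or_eq_and_eq hl' with ⟨rfl, rfl⟩ | ⟨rfl, rfl⟩
    exacts [Or.inl ⟨h0, h1⟩, Or.inr ⟨h0, h1⟩]
  refine ⟨{ vert := f.vert
            edge := E
            isPLPath := fun e he ↦ ?_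
            ends := fun e y z hl ↦ ?_
            vert_injOn := f.vert_injOn.mono fun y hy ↦ h.mem_vertexSet hy
            edge_ne_vert := ne_vert
            edge_inj := fun e he e' he' s hs s' hs' heq ↦ ?_ }, h, hf, rfl, Ee, ?_, ?_, ?_, ?_⟩
  · rcases cover e he with rfl | rfl | rfl | he'
    · rwa [Ea]
    · rwa [Eb]
    · rwa [Ec]
    · rw [Ee' e he']
      exact f.isPLPath e (h.mem_edgeSet he')
  · rcases cover e hl.edge_mem with rfl | rfl | rfl | he'
    · rw [Ea]
      exact hends a0 a1 h.ha hl
    · rw [Eb]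
      exact hends b0 b1 h.hb hl
    · rw [Ec]
      exact hends c0 c1 h.hc hl
    · rw [Ee' e he']
      exact f.ends e y z (h.link_of_notMem he'.2 hl)
  · by_cases hne : e = e'
    · subst hne
      exact ⟨rfl, injE e he s hs s' hs' heq⟩
    · obtain ⟨y, hy, h'⟩ := meets e he e' he' hne s (Set.Ioo_subset_Icc_self hs) s' hs' heq
      exact absurd h' (ne_vert e he s hs y hy)
  · exact fun e he ha hb hc ↦ arcK e ⟨he, by simp [ha, hb, hc]⟩
  · exact (congrArg (fun k : ℝ → S3 ↦ coneOver (k '' Set.Icc 0 1)) Ea).trans ima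
  · exact (congrArg (fun k : ℝ → S3 ↦ coneOver (k '' Set.Icc 0 1)) Eb).trans imb
  · exact (congrArg (fun k : ℝ → S3 ↦ coneOver (k '' Set.Icc 0 1)) Ec).trans imc

/-! ### Knots and links in the two embeddings -/

namespace SpatialEmbedding

variable {G : Graph α β}

lemma coneOver_image (f : SpatialEmbedding G) (γ : Cycle G) :
    coneOver (f.image γ) = ⋃ e ∈ Set.range γ.edge, coneOver (f.arc e) := by
  rw [f.image_eq, coneOver_biUnion]

lemma isTame_image (f : SpatialEmbedding G) (γ : Cycle G) : IsTame (coneOver (f.image γ)) := by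
  rw [f.coneOver_image]
  refine isTame_biUnion (Set.finite_range _) ?_
  rintro _ ⟨i, rfl⟩
  exact f.isTame_arc (γ.isLink i).edge_mem

lemma mem_range_of_vert_mem_arc (f : SpatialEmbedding G) (γ : Cycle G) {y : α}
    (hy : y ∈ G.vertexSet) {e : β} (he : e ∈ Set.range γ.edge) (hye : f.vert y ∈ f.arc e) :
    y ∈ Set.range γ.vert := by
  obtain ⟨i, rfl⟩ := he
  obtain ⟨s, hs, h⟩ := hye
  obtain ⟨z, hz⟩ := f.inc_of_edge_eq_vert (γ.isLink i).edge_mem hs hy h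
  exact γ.mem_range_vert ⟨i, rfl⟩ hz

lemma vert_notMem_image (f : SpatialEmbedding G) (γ : Cycle G) {y : α} (hy : y ∈ G.vertexSet)
    (hyγ : y ∉ Set.range γ.vert) : (f.vert y : R4) ∉ coneOver (f.image γ) := by
  rw [mem_coneOver, f.image_eq]
  simp only [Set.mem_iUnion, exists_prop, not_exists, not_and]
  exact fun e he hye ↦ hyγ (f.mem_range_of_vert_mem_arc γ hy he hye)

end SpatialEmbedding

lemma Cycle.range_vert_subset {G : Graph α β} (γ : Cycle G) : Set.range γ.vert ⊆ G.vertexSet := by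
  rintro _ ⟨i, rfl⟩
  exact (γ.isLink i).left_mem

lemma Cycle.range_edge_subset {G : Graph α β} (γ : Cycle G) : Set.range γ.edge ⊆ G.edgeSet := by
  rintro _ ⟨i, rfl⟩
  exact (γ.isLink i).edge_mem

/-- The cycle `γ'` of `GY`, whose only new vertex may be `x`, has the same knot type as the cycle
`γ` of `GΔ`, also in the complement of any part `D` of the common image that misses `γ`. -/
def IsRerouting {GΔ GY : Graph α β} (f : SpatialEmbedding GY) (g : SpatialEmbedding GΔ)
    (K : Set S3) (x : α) (γ : Cycle GΔ) (γ' : Cycle GY) : Prop :=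
  Set.range γ'.vert ⊆ insert x (Set.range γ.vert) ∧
    ∀ D : Set R4, IsTame D → D ⊆ coneOver K → (∀ y ∈ Set.range γ.vert, (f.vert y : R4) ∉ D) →
      MovesTo D (coneOver (g.image γ)) (coneOver (f.image γ'))

namespace IsCompanion

variable {GΔ GY : Graph α β} {f : SpatialEmbedding GY} {g : SpatialEmbedding GΔ} {K : Set S3}
  {u v w x : α} {a b c p q r : β} {X U V W : R4}

lemma arc_eq (h : IsCompanion f g K u v w x a b c p q r X U V W) {e : β} (ha : e ≠ a)
    (hb : e ≠ b) (hc : e ≠ c) : g.arc e = f.arc e := by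
  rw [SpatialEmbedding.arc, SpatialEmbedding.arc, h.edge e ha hb hc]

/-- Edges outside the triangle have the same images under `f` and `g`, contained in the common
image. -/
lemma isTame_rest (h : IsCompanion f g K u v w x a b c p q r X U V W) {S : Set β}
    (hS : S.Finite) (hSE : S ⊆ GΔ.edgeSet) (ha : a ∉ S) (hb : b ∉ S) (hc : c ∉ S) :
    IsTame (⋃ e ∈ S, coneOver (f.arc e)) ∧ (⋃ e ∈ S, coneOver (f.arc e)) ⊆ coneOver K ∧
      ⋃ e ∈ S, coneOver (g.arc e) = ⋃ e ∈ S, coneOver (f.arc e) := by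
  have hne : ∀ e ∈ S, e ≠ a ∧ e ≠ b ∧ e ≠ c := fun e he ↦
    ⟨fun h ↦ ha (h ▸ he), fun h ↦ hb (h ▸ he), fun h ↦ hc (h ▸ he)⟩
  refine ⟨isTame_biUnion hS fun e he ↦ f.isTame_arc (h.exch.mem_edgeSet ⟨hSE he, ?_⟩),
    Set.iUnion₂_subset fun e he ↦ coneOver_mono ?_, Set.iUnion₂_congr fun e he ↦ ?_⟩
  · simpa using hne e he
  · exact h.arc_subset e (hSE he) (hne e he).1 (hne e he).2.1 (hne e he).2.2
  · rw [h.arc_eq (hne e he).1 (hne e he).2.1 (hne e he).2.2]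

lemma x_notMem (h : IsCompanion f g K u v w x a b c p q r X U V W) (γ : Cycle GΔ) :
    x ∉ Set.range γ.vert := fun hx ↦ h.exch.hx (γ.range_vert_subset hx)

lemma link_of_ne (h : IsCompanion f g K u v w x a b c p q r X U V W) {e : β} (ha : e ≠ a)
    (hb : e ≠ b) (hc : e ≠ c) {y z : α} (hl : GΔ.IsLink e y z) : GY.IsLink e y z :=
  h.exch.link_of_notMem (by simp [ha, hb, hc]) hl

/-- A cycle without edges of the triangle is also a cycle of `GY`, with the same image. -/
lemma exists_transfer (h : IsCompanion f g K u v w x a b c p q r X U V W) (γ : Cycle GΔ)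
    (ha : a ∉ Set.range γ.edge) (hb : b ∉ Set.range γ.edge) (hc : c ∉ Set.range γ.edge) :
    ∃ γ' : Cycle GY, Set.range γ'.vert = Set.range γ.vert ∧
      coneOver (f.image γ') = coneOver (g.image γ) := by
  refine ⟨γ.transfer fun e he y z hl ↦ h.link_of_ne (fun h ↦ ha (h ▸ he)) (fun h ↦ hb (h ▸ he))
    (fun h ↦ hc (h ▸ he)) hl, rfl, ?_⟩
  rw [f.coneOver_image, g.coneOver_image,
    (h.isTame_rest (Set.finite_range γ.edge) γ.range_edge_subset ha hb hc).2.2]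
  rfl

lemma image_subset (h : IsCompanion f g K u v w x a b c p q r X U V W) (γ : Cycle GΔ)
    (ha : a ∉ Set.range γ.edge) (hb : b ∉ Set.range γ.edge) (hc : c ∉ Set.range γ.edge) :
    coneOver (g.image γ) ⊆ coneOver K := by
  have := h.isTame_rest (Set.finite_range γ.edge) γ.range_edge_subset ha hb hc
  rw [g.coneOver_image, this.2.2]
  exact this.2.1

/-- One edge `uv` of the triangle is replaced by the edges `xu` and `xv`. -/
lemma exists_isRerouting_of_one (h : IsCompanion f g K u v w x a b c p q r X U V W) (γ : Cycle GΔ)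
    (ha : a ∈ Set.range γ.edge) (hb : b ∉ Set.range γ.edge) (hc : c ∉ Set.range γ.edge) :
    ∃ γ' : Cycle GY, IsRerouting f g K x γ γ' := by
  have hnew : ∀ e ∈ ({p, q, r} : Set β), e ∉ Set.range γ.edge \ {a} := by
    refine fun e he he' ↦ h.exch.hnew e he ⟨γ.range_edge_subset he'.1, ?_⟩
    rintro (rfl | rfl | rfl)
    exacts [he'.2 rfl, hb he'.1, hc he'.1]
  obtain ⟨δ, hE, hV⟩ := γ.exists_subdivide (G' := GY) ha h.exch.ha (h.x_notMem γ) h.exch.hpq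
    (hnew p (by simp)) (hnew q (by simp)) h.exch.linkP h.exch.linkQ fun e he hea y z hl ↦
      h.link_of_ne hea (fun h ↦ hb (h ▸ he)) (fun h ↦ hc (h ▸ he)) hl
  obtain ⟨hT, hK, hR⟩ := h.isTame_rest (S := Set.range γ.edge \ {a}) (Set.finite_range _).sdiff
    (Set.sdiff_subset.trans γ.range_edge_subset) (by simp) (fun hb' ↦ hb hb'.1) (fun hc' ↦ hc hc'.1)
  have hγ : Set.range γ.edge = insert a (Set.range γ.edge \ {a}) := by
    rw [Set.insert_sdiff_singleton, Set.insert_eq_of_mem ha]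
  refine ⟨δ, hV.le, fun D hDT hDK _ ↦ ?_⟩
  have hs := h.straight
  have hsub := Set.union_subset hDK hK
  have hm := (movesTo_of_one_edge hs.indep (hDT.union hT) (hs.thinU.mono hsub)
    (hs.thinV.mono hsub)).union
  rw [g.coneOver_image, f.coneOver_image, hE, hγ, Set.biUnion_insert, hR, h.arcA, ← hγ,
    Set.union_comm _ {p, q}, Set.biUnion_union, Set.biUnion_pair, hs.arcP, hs.arcQ]
  exact hm

/-- Two edges `uv`, `vw` of the triangle are replaced by `xu` and `xw`, so that `v` is bypassed. -/
lemma exists_isRerouting_of_two (h : IsCompanion f g K u v w x a b c p q r X U V W) (γ : Cycle GΔ)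
    (ha : a ∈ Set.range γ.edge) (hb : b ∈ Set.range γ.edge) (hc : c ∉ Set.range γ.edge) :
    ∃ γ' : Cycle GY, IsRerouting f g K x γ γ' := by
  have hnew : ∀ e ∈ ({p, q, r} : Set β), e ∉ Set.range γ.edge \ {a, b} := by
    refine fun e he he' ↦ h.exch.hnew e he ⟨γ.range_edge_subset he'.1, ?_⟩
    rintro (rfl | rfl | rfl)
    exacts [he'.2 (Or.inl rfl), he'.2 (Or.inr rfl), hc he'.1]
  obtain ⟨δ, hE, hV⟩ := γ.exists_replace (G' := GY) h.exch.ab ha hb h.exch.ha h.exch.hb.symm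
    h.exch.huv.symm h.exch.hvw (h.x_notMem γ) h.exch.hrp.symm (hnew p (by simp)) (hnew r (by simp))
    h.exch.linkP h.exch.linkR fun e he hea heb y z hl ↦
      h.link_of_ne hea heb (fun h ↦ hc (h ▸ he)) hl
  obtain ⟨hT, hK, hR⟩ := h.isTame_rest (S := Set.range γ.edge \ {a, b}) (Set.finite_range _).sdiff
    (Set.sdiff_subset.trans γ.range_edge_subset) (by simp) (by simp) (fun hc' ↦ hc hc'.1)
  have hγ : Set.range γ.edge = {a, b} ∪ (Set.range γ.edge \ {a, b}) := by
    rw [Set.union_sdiff_cancel]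
    rintro _ (rfl | rfl) <;> assumption
  refine ⟨δ, hV.le.trans (Set.insert_subset_insert Set.sdiff_subset), fun D hDT hDK hD ↦ ?_⟩
  have hs := h.straight
  have hsub := Set.union_subset hDK hK
  -- The rerouted cycle avoids the vertex `v`.
  have hvδ : v ∉ Set.range δ.vert := by
    rw [hV]
    rintro (hvx | hv)
    exacts [h.exch.ne_x h.exch.hb.left_mem hvx, hv.2 rfl]
  obtain ⟨ρ, hρ, hVv⟩ := hs.posV
  have hVL : V ∉ D ∪ ⋃ e ∈ Set.range γ.edge \ {a, b}, coneOver (f.arc e) := by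
    rw [hVv]
    refine (hDT.union hT).smul_notMem ?_ hρ
    rintro (hmem | hmem)
    · exact hD v (γ.mem_range_vert ha h.exch.ha.symm) hmem
    · simp only [Set.mem_iUnion, exists_prop] at hmem
      obtain ⟨e, he, hmem⟩ := hmem
      exact hvδ (f.mem_range_of_vert_mem_arc δ (h.exch.mem_vertexSet h.exch.hb.left_mem)
        (hE ▸ Or.inl he) (mem_coneOver.1 hmem))
  have hm := (movesTo_of_two_edges hs.indep (hDT.union hT) (hs.thinU.mono hsub)
    (hs.thinV.mono hsub) (hs.thinW.mono hsub) hVL).union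
  rw [g.coneOver_image, f.coneOver_image, hE, hγ, Set.biUnion_union, Set.biUnion_pair, hR, h.arcA,
    h.arcB, ← hγ, Set.union_comm _ {p, r}, Set.biUnion_union, Set.biUnion_pair, hs.arcP, hs.arcR]
  exact hm

/-- Every cycle of `GΔ` apart from the triangle is rerouted through `GY`. -/
lemma exists_isRerouting (h : IsCompanion f g K u v w x a b c p q r X U V W) (γ : Cycle GΔ)
    (hγ : ¬ (a ∈ Set.range γ.edge ∧ b ∈ Set.range γ.edge ∧ c ∈ Set.range γ.edge)) :
    ∃ γ' : Cycle GY, IsRerouting f g K x γ γ' := by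
  by_cases ha : a ∈ Set.range γ.edge <;> by_cases hb : b ∈ Set.range γ.edge <;>
    by_cases hc : c ∈ Set.range γ.edge
  · exact absurd ⟨ha, hb, hc⟩ hγ
  · exact h.exists_isRerouting_of_two γ ha hb hc
  · exact h.rotate.rotate.exists_isRerouting_of_two γ hc ha hb
  · exact h.exists_isRerouting_of_one γ ha hb hc
  · exact h.rotate.exists_isRerouting_of_two γ hb hc ha
  · exact h.rotate.exists_isRerouting_of_one γ hb hc ha
  · exact h.rotate.rotate.exists_isRerouting_of_one γ hc ha hb
  · obtain ⟨γ', hV, him⟩ := h.exists_transfer γ ha hb hc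
    exact ⟨γ', hV.le.trans (Set.subset_insert _ _), fun D _ _ _ ↦
      ⟨Homeomorph.refl _, isPLIso_refl, fun _ _ ↦ rfl, by rw [him]; simp⟩⟩

/-- The triangle bounds a disc that is disjoint from all parts of the common image that miss its
vertices. -/
lemma exists_movesTo_triangle (h : IsCompanion f g K u v w x a b c p q r X U V W) (γ : Cycle GΔ)
    (ha : a ∈ Set.range γ.edge) (hb : b ∈ Set.range γ.edge) (hc : c ∈ Set.range γ.edge)
    {D : Set R4} (hDT : IsTame D) (hDK : D ⊆ coneOver K)
    (hD : ∀ y ∈ Set.range γ.vert, (f.vert y : R4) ∉ D) :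
    ∃ P Q R : R4, LinearIndependent ℝ ![P, Q, R] ∧
      (∀ r s t : ℝ, 0 ≤ r → 0 ≤ s → 0 ≤ t → r • P + s • Q + t • R ∈ D →
        r = 0 ∧ s = 0 ∧ t = 0) ∧
      MovesTo D (coneOver (g.image γ)) (cone P Q ∪ cone Q R ∪ cone R P) := by
  have hs := h.straight
  have he := h.exch
  have hpos : ∀ {y : α} {Y : R4}, y ∈ Set.range γ.vert →
      (∃ ρ : ℝ, 0 < ρ ∧ Y = ρ • (f.vert y : R4)) → Y ∉ D := by
    rintro y _ hy ⟨ρ, hρ, rfl⟩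
    exact hDT.smul_notMem (hD y hy) hρ
  obtain ⟨P, Q, R, hPQR, hdisc, hm⟩ := movesTo_of_three_edges hs.indep hDT (hs.thinU.mono hDK)
    (hs.thinV.mono hDK) (hs.thinW.mono hDK) (hpos (γ.mem_range_vert ha he.ha) hs.posU)
    (hpos (γ.mem_range_vert hb he.hb) hs.posV) (hpos (γ.mem_range_vert hc he.hc) hs.posW)
  refine ⟨P, Q, R, hPQR, hdisc, ?_⟩
  rw [g.coneOver_image, γ.range_edge_of_triangle he.huv he.hvw he.ha he.hb he.hc he.ab he.bc he.ca
    ha hb hc, Set.biUnion_insert, Set.biUnion_pair, h.arcA, h.arcB, h.arcC, ← Set.union_assoc]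
  exact hm

lemma isTrivialKnot_of_triangle (h : IsCompanion f g K u v w x a b c p q r X U V W) (γ : Cycle GΔ)
    (ha : a ∈ Set.range γ.edge) (hb : b ∈ Set.range γ.edge) (hc : c ∈ Set.range γ.edge) :
    IsTrivialKnot (g.image γ) := by
  obtain ⟨P, Q, R, hPQR, -, H, hH, -, him⟩ := h.exists_movesTo_triangle γ ha hb hc isTame_empty
    (Set.empty_subset _) (fun _ _ ↦ Set.notMem_empty _)
  obtain ⟨H', hH', him'⟩ := exists_triangle_to_greatCircle hPQR
  refine isTrivialKnot_of_image (hH.trans hH') ?_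
  change (H' ∘ H) '' _ = _
  rw [Set.image_comp, him, him']

/-- Disjoint cycles of `GΔ` do not both pass through edges of the triangle. -/
lemma notMem_of_isDisjoint (h : IsCompanion f g K u v w x a b c p q r X U V W) {γ δ : Cycle GΔ}
    (hγδ : γ.IsDisjoint δ)
    (hγ : a ∈ Set.range γ.edge ∨ b ∈ Set.range γ.edge ∨ c ∈ Set.range γ.edge) :
    a ∉ Set.range δ.edge ∧ b ∉ Set.range δ.edge ∧ c ∉ Set.range δ.edge := by
  have two : ∀ ε : Cycle GΔ,
      (a ∈ Set.range ε.edge ∨ b ∈ Set.range ε.edge ∨ c ∈ Set.range ε.edge) →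
      (u ∈ Set.range ε.vert ∧ v ∈ Set.range ε.vert) ∨
        (v ∈ Set.range ε.vert ∧ w ∈ Set.range ε.vert) ∨
        (w ∈ Set.range ε.vert ∧ u ∈ Set.range ε.vert) := by
    rintro ε (hε | hε | hε)
    · exact Or.inl ⟨ε.mem_range_vert hε h.exch.ha, ε.mem_range_vert hε h.exch.ha.symm⟩
    · exact Or.inr (Or.inl ⟨ε.mem_range_vert hε h.exch.hb, ε.mem_range_vert hε h.exch.hb.symm⟩)
    · exact Or.inr (Or.inr ⟨ε.mem_range_vert hε h.exch.hc, ε.mem_range_vert hε h.exch.hc.symm⟩)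
  have hdisj : ∀ y, y ∈ Set.range γ.vert → y ∉ Set.range δ.vert :=
    fun y hy hy' ↦ Set.disjoint_left.1 hγδ hy hy'
  have hu := hdisj u
  have hv := hdisj v
  have hw := hdisj w
  have h1 := two γ hγ
  have h2 : ¬ (a ∈ Set.range δ.edge ∨ b ∈ Set.range δ.edge ∨ c ∈ Set.range δ.edge) :=
    fun hδ ↦ by
      have := two δ hδ
      tauto
  tauto

lemma isSplittable_of_triangle (h : IsCompanion f g K u v w x a b c p q r X U V W)
    {γ δ : Cycle GΔ} (hγδ : γ.IsDisjoint δ)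
    (ha : a ∈ Set.range γ.edge) (hb : b ∈ Set.range γ.edge) (hc : c ∈ Set.range γ.edge) :
    IsSplittable (g.image γ) (g.image δ) := by
  obtain ⟨haδ, hbδ, hcδ⟩ := h.notMem_of_isDisjoint hγδ (Or.inl ha)
  have hT := g.isTame_image δ
  obtain ⟨P, Q, R, hPQR, hdisc, H, hH, hfix, him⟩ := h.exists_movesTo_triangle γ ha hb hc hT
    (h.image_subset δ haδ hbδ hcδ) fun y hy ↦ by
      rw [← h.vert]
      exact g.vert_notMem_image δ (γ.range_vert_subset hy) (Set.disjoint_left.1 hγδ hy)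
  obtain ⟨H', hH', hpos, hneg⟩ := exists_triangle_split hPQR hT hdisc
  refine isSplittable_of_sign (hH.trans hH') (fun y hy hy0 ↦ ?_) fun y hy hy0 ↦ ?_
  · exact hpos (H y) (him ▸ Set.mem_image_of_mem H hy)
      fun h0 ↦ hy0 (H.injective (h0.trans hH.map_zero.symm))
  · change H' (H y) 3 < 0
    rw [hfix y hy]
    exact hneg y hy hy0

/-- A completely 3-linked link of `g`, at most one component of which passes through edges of the
triangle, is carried to one of `f`. -/
lemma hasKnotOrLink_of_disjoint (h : IsCompanion f g K u v w x a b c p q r X U V W)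
    {γ δ₁ δ₂ : Cycle GΔ} (h₁ : γ.IsDisjoint δ₁) (h₂ : γ.IsDisjoint δ₂) (h₁₂ : δ₁.IsDisjoint δ₂)
    (ha₁ : a ∉ Set.range δ₁.edge) (hb₁ : b ∉ Set.range δ₁.edge) (hc₁ : c ∉ Set.range δ₁.edge)
    (ha₂ : a ∉ Set.range δ₂.edge) (hb₂ : b ∉ Set.range δ₂.edge) (hc₂ : c ∉ Set.range δ₂.edge)
    (s₁ : ¬ IsSplittable (g.image γ) (g.image δ₁)) (s₂ : ¬ IsSplittable (g.image γ) (g.image δ₂))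
    (s₁₂ : ¬ IsSplittable (g.image δ₁) (g.image δ₂)) : HasKnotOrLink f := by
  obtain ⟨γ', hγV, hγ⟩ := h.exists_isRerouting γ
    fun hall ↦ s₁ (h.isSplittable_of_triangle h₁ hall.1 hall.2.1 hall.2.2)
  obtain ⟨δ₁', hV₁, him₁⟩ := h.exists_transfer δ₁ ha₁ hb₁ hc₁
  obtain ⟨δ₂', hV₂, him₂⟩ := h.exists_transfer δ₂ ha₂ hb₂ hc₂
  obtain ⟨H, hH, hfix, him⟩ := hγ (coneOver (g.image δ₁) ∪ coneOver (g.image δ₂))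
    ((g.isTame_image δ₁).union (g.isTame_image δ₂))
    (Set.union_subset (h.image_subset δ₁ ha₁ hb₁ hc₁) (h.image_subset δ₂ ha₂ hb₂ hc₂)) (by
      rintro y hy (hmem | hmem) <;> rw [← h.vert] at hmem
      · exact g.vert_notMem_image δ₁ (γ.range_vert_subset hy) (Set.disjoint_left.1 h₁ hy) hmem
      · exact g.vert_notMem_image δ₂ (γ.range_vert_subset hy) (Set.disjoint_left.1 h₂ hy) hmem)
  have hdisj : ∀ {δ : Cycle GΔ} {δ' : Cycle GY}, γ.IsDisjoint δ →
      Set.range δ'.vert = Set.range δ.vert → γ'.IsDisjoint δ' := by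
    intro δ δ' hd hV
    refine Set.disjoint_left.2 fun y hy hy' ↦ ?_
    rw [hV] at hy'
    rcases hγV hy with rfl | hy
    exacts [h.x_notMem δ hy', Set.disjoint_left.1 hd hy hy']
  have him₁' : H '' coneOver (g.image δ₁) = coneOver (f.image δ₁') := by
    rw [Set.image_congr fun y hy ↦ hfix y (Or.inl hy), Set.image_id', him₁]
  have him₂' : H '' coneOver (g.image δ₂) = coneOver (f.image δ₂') := by
    rw [Set.image_congr fun y hy ↦ hfix y (Or.inr hy), Set.image_id', him₂]
  refine Or.inr ⟨γ', δ₁', δ₂', hdisj h₁ hV₁, hdisj h₂ hV₂, ?_,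
    mt (IsSplittable.of_image hH him him₁') s₁, mt (IsSplittable.of_image hH him him₂') s₂, ?_⟩
  · rwa [Cycle.IsDisjoint, hV₁, hV₂]
  · rwa [coneOver_injective him₁, coneOver_injective him₂]

/-- A nontrivial knot or a completely 3-linked link of `g` yields one of `f`. -/
lemma hasKnotOrLink (h : IsCompanion f g K u v w x a b c p q r X U V W) (hg : HasKnotOrLink g) :
    HasKnotOrLink f := by
  rcases hg with ⟨γ, hγ⟩ | ⟨γ₁, γ₂, γ₃, h12, h13, h23, s12, s13, s23⟩
  · obtain ⟨γ', -, hm⟩ := h.exists_isRerouting γ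
      fun hall ↦ hγ (h.isTrivialKnot_of_triangle γ hall.1 hall.2.1 hall.2.2)
    obtain ⟨H, hH, -, him⟩ := hm ∅ isTame_empty (Set.empty_subset _) fun _ _ ↦ Set.notMem_empty _
    exact Or.inl ⟨γ', fun ht ↦ hγ (ht.of_image hH him)⟩
  · have swap : ∀ {γ δ : Cycle GΔ}, ¬ IsSplittable (g.image γ) (g.image δ) →
        ¬ IsSplittable (g.image δ) (g.image γ) := mt IsSplittable.symm
    by_cases h2 : a ∈ Set.range γ₂.edge ∨ b ∈ Set.range γ₂.edge ∨ c ∈ Set.range γ₂.edge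
    · obtain ⟨ha₁, hb₁, hc₁⟩ := h.notMem_of_isDisjoint h12.symm h2
      obtain ⟨ha₃, hb₃, hc₃⟩ := h.notMem_of_isDisjoint h23 h2
      exact h.hasKnotOrLink_of_disjoint h12.symm h23 h13 ha₁ hb₁ hc₁ ha₃ hb₃ hc₃ (swap s12) s23 s13
    by_cases h3 : a ∈ Set.range γ₃.edge ∨ b ∈ Set.range γ₃.edge ∨ c ∈ Set.range γ₃.edge
    · obtain ⟨ha₁, hb₁, hc₁⟩ := h.notMem_of_isDisjoint h13.symm h3
      obtain ⟨ha₂, hb₂, hc₂⟩ := h.notMem_of_isDisjoint h23.symm h3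
      exact h.hasKnotOrLink_of_disjoint h13.symm h23.symm h12 ha₁ hb₁ hc₁ ha₂ hb₂ hc₂ (swap s13)
        (swap s23) s12
    push Not at h2 h3
    exact h.hasKnotOrLink_of_disjoint h12 h13 h23 h2.1 h2.2.1 h2.2.2 h3.1 h3.2.1 h3.2.2 s12 s13 s23

end IsCompanion

end SpatialGraph

theorem lemma2p6 {α : Type*} {β : Type*} (GΔ GY : Graph α β)
    (hV : GΔ.vertexSet.Finite) (hE : GΔ.edgeSet.Finite)
    (hY : SpatialGraph.IsDeltaYExchange GΔ GY)
    (hG : SpatialGraph.IsIKC3L GΔ) :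
    SpatialGraph.IsIKC3L GY := by
  obtain ⟨u, v, w, x, a, b, c, p, q, r, huv, hvw, hwu, ha, hb, hc, hx, hpq, hqr, hrp, hnew, hVY,
    hEY⟩ := hY
  have h : SpatialGraph.IsExchange GΔ GY u v w x a b c p q r :=
    ⟨huv, hvw, hwu, ha, hb, hc, hx, hpq, hqr, hrp, hnew, hVY, hEY⟩
  intro f
  obtain ⟨H, hH, X, U, V, W, hf⟩ := h.exists_isStraight hV hE f
  obtain ⟨g, hg⟩ := h.exists_isCompanion hf
  exact SpatialGraph.HasKnotOrLink.of_map (hg.hasKnotOrLink (hG g))
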